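/- **Setting.** All manifolds are smooth, finite-dimensional (of constant dimension), Hausdorff and second countable, and vector bundles have constant rank. Let $G$ be a Lie groupoid with unit space $G^0$ and range and source maps $r,s$. Let $(X,p)$ be a $G$-manifold: $p:X\to G^0$ is a surjective submersion and $G$ acts smoothly on $X$, with $g:X^{s(g)}\to X^{r(g)}$, $X^u=p^{-1}(u)$. Let $Z$ be a compact manifold, $E\to Z$ a smooth complex vector bundle and $\tilde E\to X$ a smooth $G$-equivariant complex vector bundle ($\tilde E$ is a $G$-manifold over $G^0$ and $G$ acts by linear isomorphisms $\tilde E^x\to\tilde E^{gx}$ covering the action on $X$). Assume that $\tilde E\to X\to G^0$ is a locally trivial bundle over $G^0$ with fibre $E\to Z$ and structure group $\mathrm{Diff}(Z,E)$: every point of $G^0$ has an open neighbourhood $U$ with a *chart* $\varphi$ over $U$, i.e. a diffeomorphism $X|_U\cong U\times Z$ over $U$, $x\mapsto(p(x),\tau(x))$, covered by a diffeomorphism $\tilde E|_U\cong U\times E$ that is a linear isomorphism $\varphi:\tilde E^x\to E^{\tau(x)}$ on each fibre. Hermitian metrics are conjugate linear in the first variable and are required to be continuous. Let $\tilde E$ and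 the complexified bundle of vectors tangent to the fibres $X^u$ be given $G$-isometric hermitian metrics, and let $\mu^u$ be the measure on $X^u$ given in local coordinates by $|\det(g_{ij}^u)|^{1/2}\,dx$, where $(g^u_{ij})$ is the matrix of the latter metric. Let $\tilde E^{(u)}=\tilde E|_{X^u}$. **Proposition 5.2.** Let $\mu$ be a smooth positive measure on $Z$ and give $E$ a hermitian metric. Then $H=L^2(Z,E,\mu)$ is a Hilbert space, and there is a topology on the disjoint union $\mathfrak H=\bigsqcup_{u\in G^0}L^2(X^u,\tilde E^{(u)},\mu^u)$ which makes $\mathfrak H\to G^0$ a Hilbert bundle with fibre $H$, i.e. a locally trivial bundle with fibrewise unitary local trivializations whose transition functions $U\cap U'\to U(H)$ are continuous for the strong operator topology, and such that for each chart $\varphi$ over an open set $U$ the maps $$(\chi_\varphi f)(z)=r^u(z)^{1/2}(A^x)^{1/2}\varphi(f(x))\qquad (f\in L^2(X^u,\tilde E^{(u)},\mu^u),\ u\in U,\ x\in X^u,\ z=\tau(x))$$ are the fibre maps of one of its unitary local trivializations $\mathfrak H|_U\to U\times H$. Here $r^u=d(\tau|_{X^u})_*\mu^u/d\mu$, and $A^x$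 is the positive endomorphism of $E^z$ with $\langle\xi,\xi'\rangle^x=\langle A^x\varphi(\xi),\varphi(\xi')\rangle^z$ for $\xi,\xi'\in\tilde E^x$. The topology is the only one with these properties. Moreover $(L_gf)(x)=g[f(g^{-1}x)]$ ($x\in X^{r(g)}$) defines unitary operators $L_g:L^2(X^{s(g)},\tilde E^{(s(g))},\mu^{s(g)})\to L^2(X^{r(g)},\tilde E^{(r(g))},\mu^{r(g)})$ which form a continuous action of $G$ on $\mathfrak H$: $L_{gh}=L_gL_h$ whenever $s(g)=r(h)$, $L_{g^{-1}}=L_g^{-1}$, and the map $(g,f)\mapsto L_gf$, $\{(g,f)\in G\times\mathfrak H: f\in\mathfrak H^{s(g)}\}\to\mathfrak H$, is continuous. -/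

import Mathlib

open Bundle MeasureTheory Set
open scoped ContDiff Manifold TensorProduct Topology ComplexConjugate

/-! ## Hermitian metrics and `L²`-spaces of sections -/

/-- A hermitian metric on a complex vector bundle `V`: a positive definite hermitian form on each
fibre, conjugate linear in the first variable and linear in the second, such that the squared norm
is a continuous function on the total space (by polarization, pairings of continuous sections are
then continuous).  Smooth metrics are a special case. -/
structure HermitianMetric {B : Type*} (F : Type*) (V : B → Type*)
    [TopologicalSpace (TotalSpace F V)] [∀ x, AddCommGroup (V x)] [∀ x, Module ℂ (V x)] where
  form : ∀ x, V x →ₗ⋆[ℂ] V x →ₗ[ℂ] ℂ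
  conj_symm : ∀ x v w, conj (form x w v) = form x v w
  pos : ∀ x v, v ≠ 0 → 0 < (form x v v).re
  continuous_sq : Continuous fun v : TotalSpace F V => (form v.proj v.2 v.2).re

noncomputable instance pullbackAddCommGroup {B B' : Type*} (j : B' → B) (V : B → Type*)
    [∀ x, AddCommGroup (V x)] (x : B') : AddCommGroup ((j *ᵖ V) x) :=
  inferInstanceAs (AddCommGroup (V (j x)))

section L2

variable {B : Type*} [TopologicalSpace B] [MeasurableSpace B]
  {F : Type*} [NormedAddCommGroup F] [NormedSpace ℂ F]
  {V : B → Type*} [TopologicalSpace (TotalSpace F V)] [∀ x, AddCommGroup (V x)]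
  [∀ x, Module ℂ (V x)] [∀ x, TopologicalSpace (V x)] [FiberBundle F V]

variable (F) in
/-- A (not necessarily continuous) section `f` is `ν`-measurable if it is so in the local
trivializations of the bundle. -/
def AEMeasurableSection (ν : Measure B) (f : ∀ x, V x) : Prop :=
  ∀ b : B, AEStronglyMeasurable (fun x => (trivializationAt F V b ⟨x, f x⟩).2)
    (ν.restrict (trivializationAt F V b).baseSet)

theorem AEMeasurableSection.add [OpensMeasurableSpace B] [VectorBundle ℂ F V]
    {ν : Measure B} {f g : ∀ x, V x}
    (hf : AEMeasurableSection F ν f) (hg : AEMeasurableSection F ν g) :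
    AEMeasurableSection F ν (f + g) := fun b => by
  refine ((hf b).add (hg b)).congr ?_
  refine ae_restrict_of_forall_mem (trivializationAt F V b).open_baseSet.measurableSet ?_
  intro x hx
  exact (((trivializationAt F V b).linear ℂ hx).map_add (f x) (g x)).symm

theorem AEMeasurableSection.smul [OpensMeasurableSpace B] [VectorBundle ℂ F V]
    {ν : Measure B} {f : ∀ x, V x} (c : ℂ)
    (hf : AEMeasurableSection F ν f) : AEMeasurableSection F ν (c • f) := fun b => by
  refine ((hf b).const_smul c).congr ?_
  refine ae_restrict_of_forall_mem (trivializationAt F V b).open_baseSet.measurableSet ?_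
  intro x hx
  exact (((trivializationAt F V b).linear ℂ hx).map_smul c (f x)).symm

theorem AEMeasurableSection.zero [OpensMeasurableSpace B] [VectorBundle ℂ F V]
    {ν : Measure B} : AEMeasurableSection F ν (0 : ∀ x, V x) := fun b => by
  refine (aestronglyMeasurable_const (b := (0 : F))).congr ?_
  refine ae_restrict_of_forall_mem (trivializationAt F V b).open_baseSet.measurableSet ?_
  intro x hx
  exact (((trivializationAt F V b).linear ℂ hx).map_zero).symm

end L2

namespace HermitianMetric

section Algebra

variable {B : Type*} {F : Type*} {V : B → Type*} [TopologicalSpace (TotalSpace F V)]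
  [∀ x, AddCommGroup (V x)] [∀ x, Module ℂ (V x)]

/-- The pullback of a hermitian metric along a continuous map. -/
def pullback {B' : Type*} [TopologicalSpace B] [TopologicalSpace B']
    (h : HermitianMetric F V) (j : C(B', B)) : HermitianMetric F (j *ᵖ V) where
  form x := h.form (j x)
  conj_symm x v w := h.conj_symm (j x) v w
  pos x v hv := h.pos (j x) v hv
  continuous_sq := h.continuous_sq.comp (Pullback.continuous_lift F V j)

/-- The function `x ↦ ⟨f x, f x⟩`. -/
def normSq (h : HermitianMetric F V) (f : ∀ x, V x) (x : B) : ℝ := (h.form x (f x) (f x)).re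

theorem normSq_nonneg (h : HermitianMetric F V) (f : ∀ x, V x) (x : B) : 0 ≤ h.normSq f x := by
  by_cases hx : f x = 0
  · simp [normSq, hx]
  · exact (h.pos x _ hx).le

theorem normSq_add_add_sub (h : HermitianMetric F V) (f g : ∀ x, V x) (x : B) :
    h.normSq (f + g) x + h.normSq (f - g) x = 2 * (h.normSq f x + h.normSq g x) := by
  simp [normSq]; ring

theorem normSq_smul (h : HermitianMetric F V) (c : ℂ) (f : ∀ x, V x) (x : B) :
    h.normSq (c • f) x = ‖c‖ ^ 2 * h.normSq f x := by
  simp only [normSq, Pi.smul_apply, LinearMap.map_smulₛₗ, LinearMap.smul_apply, smul_eq_mul,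
    RingHom.id_apply]
  rw [← mul_assoc, mul_comm c, ← Complex.normSq_eq_conj_mul_self, Complex.re_ofReal_mul,
    Complex.normSq_eq_norm_sq]

end Algebra

section L2

variable {B : Type*} [TopologicalSpace B] [MeasurableSpace B]
  {F : Type*} [NormedAddCommGroup F] [NormedSpace ℂ F]
  {V : B → Type*} [TopologicalSpace (TotalSpace F V)] [∀ x, AddCommGroup (V x)]
  [∀ x, Module ℂ (V x)] [∀ x, TopologicalSpace (V x)] [FiberBundle F V]
  [SecondCountableTopology B] [OpensMeasurableSpace B] [FiniteDimensional ℂ F]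

theorem aestronglyMeasurable_normSq (h : HermitianMetric F V) {ν : Measure B} {f : ∀ x, V x}
    (hf : AEMeasurableSection F ν f) : AEStronglyMeasurable (h.normSq f) ν := by
  classical
  obtain ⟨s, hs, hU⟩ := TopologicalSpace.countable_cover_nhds
    (f := fun b : B => (trivializationAt F V b).baseSet)
    (fun b => (trivializationAt F V b).open_baseSet.mem_nhds (mem_baseSet_trivializationAt F V b))
  have : Countable s := hs.to_subtype
  rw [← Measure.restrict_univ (μ := ν), ← hU, biUnion_eq_iUnion, aestronglyMeasurable_iUnion_iff]
  rintro ⟨b, -⟩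
  dsimp only
  set e := trivializationAt F V b with he
  borelize F
  have : SecondCountableTopology F := by
    have := FiniteDimensional.proper ℂ F
    infer_instance
  have hfin : AEMeasurable (fun x => (x, (e ⟨x, f x⟩).2)) (ν.restrict e.baseSet) :=
    aemeasurable_id.prodMk (hf b).aemeasurable
  have hc : ContinuousOn (fun y : B × F =>
      (h.form (e.toOpenPartialHomeomorph.symm y).proj (e.toOpenPartialHomeomorph.symm y).2
        (e.toOpenPartialHomeomorph.symm y).2).re) (e.baseSet ×ˢ univ) := by
    rw [← e.target_eq]
    exact h.continuous_sq.comp_continuousOn e.toOpenPartialHomeomorph.symm.continuousOn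
  have hm := (hc.measurable_piecewise (g := fun _ => (0 : ℝ)) continuousOn_const
    (e.open_baseSet.prod isOpen_univ).measurableSet)
  refine ((hm.comp_aemeasurable hfin).congr ?_).aestronglyMeasurable
  refine ae_restrict_of_forall_mem e.open_baseSet.measurableSet ?_
  intro x hx
  have h0 : (⟨x, f x⟩ : TotalSpace F V) ∈ e.source := by rw [e.source_eq]; exact hx
  have h1 : (x, (e ⟨x, f x⟩).2) = e ⟨x, f x⟩ := Prod.ext (e.coe_fst h0).symm rfl
  have h2 : e.toOpenPartialHomeomorph.symm (e ⟨x, f x⟩) = ⟨x, f x⟩ :=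
    e.toOpenPartialHomeomorph.left_inv h0
  have h3 : (x, (e ⟨x, f x⟩).2) ∈ e.baseSet ×ˢ (univ : Set F) := ⟨hx, mem_univ _⟩
  simp only [Function.comp_apply]
  rw [piecewise_eq_of_mem _ _ _ h3, h1, h2]
  rfl

variable [VectorBundle ℂ F V]

/-- The space of measurable sections `f` with `∫ ⟨f, f⟩ dν < ∞`. -/
def squareIntegrable (h : HermitianMetric F V) (ν : Measure B) : Submodule ℂ (∀ x, V x) where
  carrier := {f | AEMeasurableSection F ν f ∧ Integrable (h.normSq f) ν}
  zero_mem' := ⟨.zero, by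
    have : h.normSq (0 : ∀ x, V x) = 0 := by ext x; simp [normSq]
    rw [this]; exact integrable_zero _ _ _⟩
  add_mem' {f g} hf hg := ⟨hf.1.add hg.1, by
    refine ((hf.2.add hg.2).const_mul 2).mono' (h.aestronglyMeasurable_normSq (hf.1.add hg.1))
      (.of_forall fun x => ?_)
    rw [Real.norm_of_nonneg (h.normSq_nonneg _ _)]
    have := h.normSq_add_add_sub f g x
    have := h.normSq_nonneg (f - g) x
    simp only [Pi.add_apply]
    linarith⟩
  smul_mem' c f hf := ⟨hf.1.smul c, by
    have : h.normSq (c • f) = fun x => ‖c‖ ^ 2 * h.normSq f x := funext (h.normSq_smul c f)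
    rw [this]; exact hf.2.const_mul _⟩

theorem integrable_form (h : HermitianMetric F V) {ν : Measure B} (f g : h.squareIntegrable ν) :
    Integrable (fun x => h.form x (f.1 x) (g.1 x)) ν := by
  have key : ∀ f g : h.squareIntegrable ν,
      Integrable (fun x => (h.form x (f.1 x) (g.1 x)).re) ν := fun f g => by
    refine (((f + g).2.2.sub (f - g).2.2).const_mul (1 / 4)).congr (.of_forall fun x => ?_)
    have := congrArg Complex.re (h.conj_symm x (f.1 x) (g.1 x))
    rw [Complex.conj_re] at this
    simp [normSq]
    rw [this]; ring
  refine ((key f g).ofReal (𝕜 := ℂ) |>.add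
    (((key f (Complex.I • g)).neg.ofReal (𝕜 := ℂ)).mul_const Complex.I)).congr
    (.of_forall fun x => ?_)
  apply Complex.ext <;> simp

variable (h : HermitianMetric F V) (ν : Measure B)

/-- The square integrable sections, as a type carrying the semi-inner product
`⟪f, g⟫ = ∫ ⟨f x, g x⟩ dν(x)`. -/
def SqIntegrable : Type _ := h.squareIntegrable ν

noncomputable instance : AddCommGroup (h.SqIntegrable ν) :=
  inferInstanceAs (AddCommGroup (h.squareIntegrable ν))

noncomputable instance : Module ℂ (h.SqIntegrable ν) :=
  inferInstanceAs (Module ℂ (h.squareIntegrable ν))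

variable {h ν} in
/-- The underlying section of a square integrable section. -/
def SqIntegrable.sec (f : h.SqIntegrable ν) : ∀ x, V x := f.1

@[reducible] noncomputable def preCore : PreInnerProductSpace.Core ℂ (h.SqIntegrable ν) where
  inner f g := ∫ x, h.form x (f.sec x) (g.sec x) ∂ν
  conj_inner_symm f g := by
    rw [← integral_conj]
    simp only [h.conj_symm]
  re_inner_nonneg f := by
    have := integral_re (𝕜 := ℂ) (h.integrable_form f f)
    refine le_of_le_of_eq ?_ this
    exact integral_nonneg fun x => h.normSq_nonneg f.1 x
  add_left f g k := by
    refine Eq.trans ?_ (integral_add (h.integrable_form f k) (h.integrable_form g k))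
    congr 1; ext x
    change h.form x (f.1 x + g.1 x) (k.1 x) = h.form x (f.1 x) (k.1 x) + h.form x (g.1 x) (k.1 x)
    simp
  smul_left f g c := by
    rw [← integral_const_mul]
    congr 1; ext x
    change h.form x (c • f.1 x) (g.1 x) = conj c * h.form x (f.1 x) (g.1 x)
    simp

noncomputable instance : SeminormedAddCommGroup (h.SqIntegrable ν) :=
  @InnerProductSpace.Core.toSeminormedAddCommGroup ℂ _ _ _ _ (h.preCore ν)

noncomputable instance : InnerProductSpace ℂ (h.SqIntegrable ν) :=
  InnerProductSpace.ofCore (h.preCore ν)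

/-- The space `L²(B, V, ν)`: square integrable sections modulo those of seminorm zero (that is,
modulo sections vanishing `ν`-almost everywhere). -/
abbrev L2 : Type _ := SeparationQuotient (h.SqIntegrable ν)

variable {h ν} in
/-- The class in `L²(B, V, ν)` of a square integrable section. -/
noncomputable def SqIntegrable.toL2 (f : h.SqIntegrable ν) : h.L2 ν := SeparationQuotient.mk f

end L2

end HermitianMetric

/-! ## Hilbert bundles -/

section Hilbert

variable {B : Type*} [TopologicalSpace B]

/-- The strong operator topology on the unitary group of `H`. -/
@[reducible] def strongOperatorTopology (H : Type*) [NormedAddCommGroup H]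
    [InnerProductSpace ℂ H] : TopologicalSpace (H ≃ₗᵢ[ℂ] H) :=
  TopologicalSpace.induced (fun T v => T v) Pi.topologicalSpace

/-- A local trivialization, over an open set, of a family `E` of inner product spaces with fibre
`H` which is unitary on each fibre. -/
structure UnitaryChart (H : Type*) [NormedAddCommGroup H] [InnerProductSpace ℂ H]
    (E : B → Type*) [∀ b, NormedAddCommGroup (E b)] [∀ b, InnerProductSpace ℂ (E b)]
    [TopologicalSpace (TotalSpace H E)] extends Trivialization H (π H E) where
  unitary : ∀ b ∈ baseSet, E b ≃ₗᵢ[ℂ] H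
  apply_eq : ∀ b (hb : b ∈ baseSet) (v : E b), toFun ⟨b, v⟩ = (b, unitary b hb v)

/-- The transition function `U ∩ U' → U(H)` between two unitary charts. -/
def UnitaryChart.transition {H : Type*} [NormedAddCommGroup H] [InnerProductSpace ℂ H]
    {E : B → Type*} [∀ b, NormedAddCommGroup (E b)] [∀ b, InnerProductSpace ℂ (E b)]
    [TopologicalSpace (TotalSpace H E)] (e e' : UnitaryChart H E)
    (b : ↥(e.baseSet ∩ e'.baseSet)) : H ≃ₗᵢ[ℂ] H :=
  (e'.unitary b b.2.2).symm.trans (e.unitary b b.2.1)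

/-- A Hilbert bundle structure on the topologized total space of a family `E`: a locally trivial
bundle whose fibre is the Hilbert space `H` and whose structure group is the unitary group of `H`
with the strong operator topology. -/
structure HilbertBundle (H : Type*) [NormedAddCommGroup H] [InnerProductSpace ℂ H]
    (E : B → Type*) [∀ b, NormedAddCommGroup (E b)] [∀ b, InnerProductSpace ℂ (E b)]
    [TopologicalSpace (TotalSpace H E)] where
  complete : CompleteSpace H
  atlas : Set (UnitaryChart H E)
  cover : ∀ b, ∃ e ∈ atlas, b ∈ e.baseSet
  continuous_transition : ∀ e ∈ atlas, ∀ e' ∈ atlas,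
    @Continuous _ _ _ (strongOperatorTopology H) (e.transition e')

end Hilbert

/-! ## Lie groupoids and their actions -/

/-- A Lie groupoid with manifold of arrows `G` and manifold of units `M`.  The unit space is
identified with a submanifold of `G` by `unit`, a smooth section of `src`.  The product `mul a b`
is only meaningful if `src a = tgt b`; its smoothness is smoothness on the submanifold of
composable pairs. -/
structure LieGroupoid (dM dG : ℕ) (M G : Type*)
    [TopologicalSpace M] [ChartedSpace (EuclideanSpace ℝ (Fin dM)) M]
    [TopologicalSpace G] [ChartedSpace (EuclideanSpace ℝ (Fin dG)) G] where
  src : G → M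
  tgt : G → M
  unit : M → G
  inv : G → G
  mul : G → G → G
  src_unit : ∀ u, src (unit u) = u
  tgt_unit : ∀ u, tgt (unit u) = u
  src_inv : ∀ a, src (inv a) = tgt a
  tgt_inv : ∀ a, tgt (inv a) = src a
  src_mul : ∀ {a b}, src a = tgt b → src (mul a b) = src b
  tgt_mul : ∀ {a b}, src a = tgt b → tgt (mul a b) = tgt a
  mul_assoc : ∀ {a b c}, src a = tgt b → src b = tgt c → mul (mul a b) c = mul a (mul b c)
  unit_mul : ∀ a, mul (unit (tgt a)) a = a
  mul_unit : ∀ a, mul a (unit (src a)) = a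
  mul_inv : ∀ a, mul a (inv a) = unit (tgt a)
  inv_mul : ∀ a, mul (inv a) a = unit (src a)
  submersion_src : Manifold.IsSubmersion (𝓡 dG) (𝓡 dM) ∞ src
  submersion_tgt : Manifold.IsSubmersion (𝓡 dG) (𝓡 dM) ∞ tgt
  smooth_unit : ContMDiff (𝓡 dM) (𝓡 dG) ∞ unit
  smooth_inv : ContMDiff (𝓡 dG) (𝓡 dG) ∞ inv
  smooth_mul : ContMDiffOn ((𝓡 dG).prod (𝓡 dG)) (𝓡 dG) ∞ (fun q : G × G => mul q.1 q.2)
    {q | src q.1 = tgt q.2}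

section Actions

variable {dM dG : ℕ} {M G : Type*}
  [TopologicalSpace M] [ChartedSpace (EuclideanSpace ℝ (Fin dM)) M]
  [TopologicalSpace G] [ChartedSpace (EuclideanSpace ℝ (Fin dG)) G]

/-- A `G`-manifold structure on `(Y, p)`: `p` is a surjective submersion onto the unit space, and
`G` acts smoothly.  `act g y` is only meaningful if `src g = p y`, and smoothness is smoothness on
the submanifold `G * Y` of such pairs. -/
structure GManifold (𝒢 : LieGroupoid dM dG M G) {EY HY : Type*} [NormedAddCommGroup EY]
    [NormedSpace ℝ EY] [TopologicalSpace HY] (I : ModelWithCorners ℝ EY HY)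
    {Y : Type*} [TopologicalSpace Y] [ChartedSpace HY Y] (p : Y → M) where
  submersion : Manifold.IsSubmersion I (𝓡 dM) ∞ p
  surjective : Function.Surjective p
  act : G → Y → Y
  anchor_act : ∀ {g y}, 𝒢.src g = p y → p (act g y) = 𝒢.tgt g
  mul_act : ∀ {g h y}, 𝒢.src g = 𝒢.tgt h → 𝒢.src h = p y → act (𝒢.mul g h) y = act g (act h y)
  inv_act : ∀ {g y}, 𝒢.src g = p y → act (𝒢.inv g) (act g y) = y
  smooth_act : ContMDiffOn ((𝓡 dG).prod I) I ∞ (fun q : G × Y => act q.1 q.2)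
    {q | 𝒢.src q.1 = p q.2}

/-- A `G`-equivariant structure on a smooth complex vector bundle `V` over a `G`-manifold: the
total space is a `G`-manifold, its action covers the action on the base and is a linear
isomorphism between fibres. -/
structure EquivariantStructure {𝒢 : LieGroupoid dM dG M G} {dX : ℕ} {X : Type*}
    [TopologicalSpace X] [ChartedSpace (EuclideanSpace ℝ (Fin dX)) X] {p : X → M}
    (A : GManifold 𝒢 (𝓡 dX) p)
    (F : Type*) [NormedAddCommGroup F] [NormedSpace ℂ F] (V : X → Type*)
    [TopologicalSpace (TotalSpace F V)] [∀ x, AddCommGroup (V x)] [∀ x, Module ℂ (V x)]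
    [∀ x, TopologicalSpace (V x)] [FiberBundle F V] where
  total : GManifold 𝒢 ((𝓡 dX).prod 𝓘(ℝ, F)) (fun v : TotalSpace F V => p v.proj)
  lin : ∀ g x, 𝒢.src g = p x → V x ≃ₗ[ℂ] V (A.act g x)
  act_eq : ∀ g x (hgx : 𝒢.src g = p x) (ξ : V x),
    total.act g ⟨x, ξ⟩ = ⟨A.act g x, lin g x hgx ξ⟩

/-- The hermitian metric `h` is `G`-isometric. -/
def EquivariantStructure.IsIsometric {𝒢 : LieGroupoid dM dG M G} {dX : ℕ} {X : Type*}
    [TopologicalSpace X] [ChartedSpace (EuclideanSpace ℝ (Fin dX)) X] {p : X → M}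
    {A : GManifold 𝒢 (𝓡 dX) p}
    {F : Type*} [NormedAddCommGroup F] [NormedSpace ℂ F] {V : X → Type*}
    [TopologicalSpace (TotalSpace F V)] [∀ x, AddCommGroup (V x)] [∀ x, Module ℂ (V x)]
    [∀ x, TopologicalSpace (V x)] [FiberBundle F V]
    (ℰ : EquivariantStructure A F V) (h : HermitianMetric F V) : Prop :=
  ∀ g x (hgx : 𝒢.src g = p x) (v w : V x),
    h.form (A.act g x) (ℰ.lin g x hgx v) (ℰ.lin g x hgx w) = h.form x v w

/-- A continuous unitary action of `G` on (the topologized total space of) a family `E` of inner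
product spaces over the unit space.  It is given by unitaries `lin g : E (src g) → E (tgt g)`;
`act` is the resulting map `G * E → E`. -/
structure UnitaryAction (𝒢 : LieGroupoid dM dG M G)
    (H : Type*) (E : M → Type*) [∀ u, NormedAddCommGroup (E u)] [∀ u, InnerProductSpace ℂ (E u)]
    [TopologicalSpace (TotalSpace H E)] where
  lin : ∀ g, E (𝒢.src g) ≃ₗᵢ[ℂ] E (𝒢.tgt g)
  act : {q : G × TotalSpace H E // 𝒢.src q.1 = q.2.proj} → TotalSpace H E
  act_eq : ∀ g (v : E (𝒢.src g)), act ⟨(g, ⟨𝒢.src g, v⟩), rfl⟩ = ⟨𝒢.tgt g, lin g v⟩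
  proj_act : ∀ q, (act q).proj = 𝒢.tgt q.1.1
  mul_act : ∀ g h ξ (hgh : 𝒢.src g = 𝒢.tgt h) (hξ : 𝒢.src h = ξ.proj),
    act ⟨(𝒢.mul g h, ξ), (𝒢.src_mul hgh).trans hξ⟩ =
      act ⟨(g, act ⟨(h, ξ), hξ⟩), hgh.trans (proj_act ⟨(h, ξ), hξ⟩).symm⟩
  inv_act : ∀ g ξ (hξ : 𝒢.src g = ξ.proj),
    act ⟨(𝒢.inv g, act ⟨(g, ξ), hξ⟩), (𝒢.src_inv g).trans (proj_act ⟨(g, ξ), hξ⟩).symm⟩ = ξ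
  continuous_act : Continuous act

end Actions

/-! ## Measures along the fibres -/

noncomputable section Vertical

variable {M X : Type*}

theorem mem_of_mem_fibre {p : X → M} {u : M} {U : Set M} (hu : u ∈ U) (x : ↥(p ⁻¹' {u})) :
    p x.1 ∈ U := by
  have hx : p x.1 = u := x.2
  rwa [hx]

/-- The inclusion of the fibre `X^u = p⁻¹(u)` into `X`. -/
def fibreIncl [TopologicalSpace X] (p : X → M) (u : M) : C(↥(p ⁻¹' {u}), X) :=
  ⟨Subtype.val, continuous_subtype_val⟩

variable (dX dM j : ℕ)
  [TopologicalSpace M] [ChartedSpace (EuclideanSpace ℝ (Fin dM)) M]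
  [TopologicalSpace X] [ChartedSpace (EuclideanSpace ℝ (Fin dX)) X] (p : X → M)

/-- The real tangent space at `x` to the fibre of `p` through `x`. -/
abbrev VertTangent (x : X) : Submodule ℝ (TangentSpace (𝓡 dX) x) :=
  LinearMap.ker (mfderiv (𝓡 dX) (𝓡 dM) p x).toLinearMap

open Classical in
/-- A tangent vector to a fibre, as an element of the tangent space to the fibre (vectors not
tangent to the fibre are sent to `0`). -/
noncomputable def toVert (x : X) (v : TangentSpace (𝓡 dX) x) : VertTangent dX dM p x :=
  if hv : v ∈ VertTangent dX dM p x then ⟨v, hv⟩ else 0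

/-- A hermitian metric on the complexification of the bundle of vectors tangent to the fibres of
`p`: the pairing of (local, smooth, real) vector fields along the fibres is continuous.  Smooth
metrics are a special case. -/
structure VerticalMetric [IsManifold (𝓡 dX) ∞ X] where
  form : ∀ x, (ℂ ⊗[ℝ] VertTangent dX dM p x) →ₗ⋆[ℂ] (ℂ ⊗[ℝ] VertTangent dX dM p x) →ₗ[ℂ] ℂ
  conj_symm : ∀ x a b, conj (form x b a) = form x a b
  pos : ∀ x a, a ≠ 0 → 0 < (form x a a).re
  continuousOn : ∀ (O : Set X), IsOpen O → ∀ ξ η : ∀ x, VertTangent dX dM p x,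
    ContMDiffOn (𝓡 dX) (𝓡 dX).tangent ∞
      (fun x => (⟨x, (ξ x : TangentSpace (𝓡 dX) x)⟩ : TangentBundle (𝓡 dX) X)) O →
    ContMDiffOn (𝓡 dX) (𝓡 dX).tangent ∞
      (fun x => (⟨x, (η x : TangentSpace (𝓡 dX) x)⟩ : TangentBundle (𝓡 dX) X)) O →
    ContinuousOn (fun x => form x (1 ⊗ₜ ξ x) (1 ⊗ₜ η x)) O

/-- A local parametrization of the `j`-dimensional fibre `X^u` (the inverse of a local coordinate
system on it). -/
structure FibreParam (u : M) where
  dom : Set (EuclideanSpace ℝ (Fin j))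
  isOpen_dom : IsOpen dom
  toFun : EuclideanSpace ℝ (Fin j) → X
  mem_fibre : ∀ w ∈ dom, p (toFun w) = u
  injOn : InjOn toFun dom
  smooth : ContMDiffOn (𝓡 j) (𝓡 dX) ∞ toFun dom
  immersion : ∀ w ∈ dom, Function.Injective (mfderiv (𝓡 j) (𝓡 dX) toFun w)

variable {dX dM j p} [IsManifold (𝓡 dX) ∞ X]

/-- The matrix `(g_{ab})`, `g_{ab} = ⟨∂_a, ∂_b⟩`, in the coordinates of `ψ`. -/
noncomputable def VerticalMetric.gram (m : VerticalMetric dX dM p) {u : M}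
    (ψ : FibreParam dX j p u) (w : EuclideanSpace ℝ (Fin j)) : Matrix (Fin j) (Fin j) ℂ :=
  Matrix.of fun a b => m.form (ψ.toFun w)
    (1 ⊗ₜ toVert dX dM p (ψ.toFun w)
      (mfderiv (𝓡 j) (𝓡 dX) ψ.toFun w (EuclideanSpace.single a (1 : ℝ))))
    (1 ⊗ₜ toVert dX dM p (ψ.toFun w)
      (mfderiv (𝓡 j) (𝓡 dX) ψ.toFun w (EuclideanSpace.single b (1 : ℝ))))

/-- The measure `|det g_{ab}|^{1/2} dw` on the image of the local parametrization `ψ`. -/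
noncomputable def VerticalMetric.localMeasure [MeasurableSpace X] (m : VerticalMetric dX dM p)
    {u : M} (ψ : FibreParam dX j p u) : Measure X :=
  ((volume.restrict ψ.dom).withDensity
    fun w => ENNReal.ofReal (√ ‖(m.gram ψ w).det‖)).map ψ.toFun

variable (j) in
/-- The measure `μ^u` on the `j`-dimensional fibre `X^u` given by `|det g_{ab}|^{1/2} dw` in local
coordinates.  The local measures agree on overlaps, so that gluing them is the same as taking
their supremum. -/
noncomputable def VerticalMetric.fibreMeasure [MeasurableSpace X] (m : VerticalMetric dX dM p)
    (u : M) : Measure ↥(p ⁻¹' {u}) :=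
  (⨆ ψ : FibreParam dX j p u, m.localMeasure ψ).comap Subtype.val

/-- The metric `m` along the fibres is `G`-isometric: the (complexified) differential
`(ℓ_g)_* : T X^{s(g)} → T X^{r(g)}` of `ℓ_g : X^{s(g)} → X^{r(g)}` preserves it.  Here `D'` is
the differential at `x`, as the restriction to the tangent spaces of the fibres of any derivative
`D` of `ℓ_g` within `X^{s(g)}`. -/
def VerticalMetric.IsIsometric {dG : ℕ} {G : Type*}
    [TopologicalSpace G] [ChartedSpace (EuclideanSpace ℝ (Fin dG)) G]
    {𝒢 : LieGroupoid dM dG M G} (m : VerticalMetric dX dM p) (A : GManifold 𝒢 (𝓡 dX) p) : Prop :=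
  ∀ g x, 𝒢.src g = p x →
    ∀ (D : TangentSpace (𝓡 dX) x →L[ℝ] TangentSpace (𝓡 dX) (A.act g x))
      (D' : VertTangent dX dM p x →ₗ[ℝ] VertTangent dX dM p (A.act g x)),
      HasMFDerivWithinAt (𝓡 dX) (𝓡 dX) (A.act g) (p ⁻¹' {𝒢.src g}) x D →
      (∀ v, (D' v : TangentSpace (𝓡 dX) (A.act g x)) = D v) →
      ∀ a b, m.form (A.act g x) (D'.baseChange ℂ a) (D'.baseChange ℂ b) = m.form x a b

end Vertical

/-- A smooth (positive) measure on a manifold: in every chart it has a smooth, strictly positive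
density with respect to Lebesgue measure. -/
def IsSmoothMeasure {d : ℕ} {Z : Type*} [TopologicalSpace Z]
    [ChartedSpace (EuclideanSpace ℝ (Fin d)) Z] [MeasurableSpace Z] (μ : Measure Z) : Prop :=
  ∀ e ∈ IsManifold.maximalAtlas (𝓡 d) ∞ Z, ∃ ρ : EuclideanSpace ℝ (Fin d) → ℝ,
    ContDiffOn ℝ ∞ ρ e.target ∧ (∀ w ∈ e.target, 0 < ρ w) ∧
      (μ.restrict e.source).map e =
        (volume.restrict e.target).withDensity fun w => ENNReal.ofReal (ρ w)

/-! ## Fibre bundle charts and the resulting charts of the family of `L²`-spaces -/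

section Charts

variable {dM dX dZ : ℕ} {M X Z : Type*}
  [TopologicalSpace M] [ChartedSpace (EuclideanSpace ℝ (Fin dM)) M]
  [TopologicalSpace X] [ChartedSpace (EuclideanSpace ℝ (Fin dX)) X]
  [TopologicalSpace Z] [ChartedSpace (EuclideanSpace ℝ (Fin dZ)) Z]
  {F : Type*} [NormedAddCommGroup F] [NormedSpace ℂ F]
  {VX : X → Type*} [TopologicalSpace (TotalSpace F VX)] [∀ x, AddCommGroup (VX x)]
  [∀ x, Module ℂ (VX x)] [∀ x, TopologicalSpace (VX x)] [FiberBundle F VX]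
  {VZ : Z → Type*} [TopologicalSpace (TotalSpace F VZ)] [∀ z, AddCommGroup (VZ z)]
  [∀ z, Module ℂ (VZ z)] [∀ z, TopologicalSpace (VZ z)] [FiberBundle F VZ]

/-- A smooth local trivialization, over an open subset `U` of `M`, of `VX → X → M` as a bundle
over `M` with fibre the vector bundle `VZ → Z` and structure group `Diff(Z, VZ)`: a diffeomorphism
`base : X|_U ≅ U × Z` over `U`, covered by a diffeomorphism `total : VX|_U ≅ U × VZ` which is a
linear isomorphism `lin x` on the fibre over each `x`. -/
structure BundleChart (dM dX dZ : ℕ) {M X Z : Type*}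
    [TopologicalSpace M] [ChartedSpace (EuclideanSpace ℝ (Fin dM)) M]
    [TopologicalSpace X] [ChartedSpace (EuclideanSpace ℝ (Fin dX)) X]
    [TopologicalSpace Z] [ChartedSpace (EuclideanSpace ℝ (Fin dZ)) Z]
    (p : X → M) (F : Type*) [NormedAddCommGroup F] [NormedSpace ℂ F]
    (VX : X → Type*) [TopologicalSpace (TotalSpace F VX)] [∀ x, AddCommGroup (VX x)]
    [∀ x, Module ℂ (VX x)] [∀ x, TopologicalSpace (VX x)] [FiberBundle F VX]
    (VZ : Z → Type*) [TopologicalSpace (TotalSpace F VZ)] [∀ z, AddCommGroup (VZ z)]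
    [∀ z, Module ℂ (VZ z)] [∀ z, TopologicalSpace (VZ z)] [FiberBundle F VZ] where
  base : Trivialization Z p
  total : Trivialization (TotalSpace F VZ) (fun v : TotalSpace F VX => p v.proj)
  baseSet_eq : total.baseSet = base.baseSet
  lin : ∀ x, p x ∈ base.baseSet → VX x ≃ₗ[ℂ] VZ (base x).2
  total_apply : ∀ x (hx : p x ∈ base.baseSet) (ξ : VX x),
    total ⟨x, ξ⟩ = (p x, ⟨(base x).2, lin x hx ξ⟩)
  smooth_base : ContMDiffOn (𝓡 dX) ((𝓡 dM).prod (𝓡 dZ)) ∞ base base.source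
  smooth_base_symm : ContMDiffOn ((𝓡 dM).prod (𝓡 dZ)) (𝓡 dX) ∞
    base.toOpenPartialHomeomorph.symm base.target
  smooth_total : ContMDiffOn ((𝓡 dX).prod 𝓘(ℝ, F)) ((𝓡 dM).prod ((𝓡 dZ).prod 𝓘(ℝ, F))) ∞
    total total.source
  smooth_total_symm : ContMDiffOn ((𝓡 dM).prod ((𝓡 dZ).prod 𝓘(ℝ, F))) ((𝓡 dX).prod 𝓘(ℝ, F)) ∞
    total.toOpenPartialHomeomorph.symm total.target

variable {p : X → M} [SecondCountableTopology X] [MeasurableSpace X] [BorelSpace X]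
  [IsManifold (𝓡 dX) ∞ X]
  [FiniteDimensional ℂ F] [VectorBundle ℂ F VX]

/-- The fibre `L²(X^u, VX^{(u)}, μ^u)` of the family of `L²`-spaces over the point `u`; `VX^{(u)}`
is the restriction of `VX` to `X^u`, and `d` is the dimension of `X^u`. -/
abbrev FibreL2 (d : ℕ) (h : HermitianMetric F VX) (m : VerticalMetric dX dM p) (u : M) : Type _ :=
  (h.pullback (fibreIncl p u)).L2 (m.fibreMeasure d u)

/-- The value in `VX x` of a section of the restriction `VX^{(u)}` at a point `x ∈ X^u`. -/
noncomputable def fibreSec {h : HermitianMetric F VX} {u : M} {ν : Measure ↥(p ⁻¹' {u})}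
    (f : (h.pullback (fibreIncl p u)).SqIntegrable ν) (x : ↥(p ⁻¹' {u})) : VX x.1 := f.sec x

variable [SecondCountableTopology Z] [MeasurableSpace Z] [BorelSpace Z] [VectorBundle ℂ F VZ]

/-- `T : L²(X^u, VX^{(u)}, μ^u) → L²(Z, VZ, μ)` is the unitary induced by the chart `φ`, namely
`T f (z) = r(z)^{1/2} A_x^{1/2} φ(f(x))` for `z = τ(x)` and `x ∈ X^u`.  Here `τ : X^u → Z` is the
diffeomorphism determined by `φ`, `r = d(τ_* μ^u)/dμ`, and `A_x` is the positive endomorphism of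
`VZ z` with `⟨ξ, ξ'⟩_x = ⟨A_x φ(ξ), φ(ξ')⟩_z`; its positive square root is `S` below. -/
def BundleChart.Induces (φ : BundleChart dM dX dZ p F VX VZ) (h : HermitianMetric F VX)
    (m : VerticalMetric dX dM p) (hZ : HermitianMetric F VZ) (μ : Measure Z)
    (u : M) (hu : u ∈ φ.base.baseSet) (T : FibreL2 dZ h m u ≃ₗᵢ[ℂ] hZ.L2 μ) : Prop :=
  ∀ (f : (h.pullback (fibreIncl p u)).SqIntegrable (m.fibreMeasure dZ u))
    (k : hZ.SqIntegrable μ), T f.toL2 = k.toL2 →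
    ∀ᵐ x ∂(m.fibreMeasure dZ u), ∃ S : VZ (φ.base x.1).2 →ₗ[ℂ] VZ (φ.base x.1).2,
      (∀ v w, hZ.form _ (S v) w = hZ.form _ v (S w)) ∧
      (∀ v, 0 ≤ (hZ.form _ (S v) v).re) ∧
      (∀ ξ ξ' : VX x.1, h.form x.1 ξ ξ' =
        hZ.form _ (S (S (φ.lin x.1 (mem_of_mem_fibre hu x) ξ))) (φ.lin x.1 (mem_of_mem_fibre hu x) ξ')) ∧
      k.sec (φ.base x.1).2 =
        ((√ (((m.fibreMeasure dZ u).map fun y => (φ.base y.1).2).rnDeriv μ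
          (φ.base x.1).2).toReal : ℝ) : ℂ) • S (φ.lin x.1 (mem_of_mem_fibre hu x) (fibreSec f x))

variable (dZ) in
/-- The topology `t` on the total space of the family `u ↦ L²(X^u, VX^{(u)}, μ^u)` makes it into a
Hilbert bundle with fibre `L²(Z, VZ, μ)` in which each local trivialization `φ` of `VX` over an
open set `U` induces a unitary local trivialization over the same set `U`. -/
def IsNaturalHilbertBundle (h : HermitianMetric F VX) (m : VerticalMetric dX dM p)
    (hZ : HermitianMetric F VZ) (μ : Measure Z)
    (t : TopologicalSpace (TotalSpace (hZ.L2 μ) (FibreL2 dZ h m))) : Prop :=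
  ∃ 𝓑 : HilbertBundle (hZ.L2 μ) (FibreL2 dZ h m),
    ∀ φ : BundleChart dM dX dZ p F VX VZ, ∃ e ∈ 𝓑.atlas, ∃ he : e.baseSet = φ.base.baseSet,
      ∀ u (hu : u ∈ e.baseSet), φ.Induces h m hZ μ u (he ▸ hu) (e.unitary u hu)

end Charts

/-! Everything rests on one kind of map: a vector bundle isomorphism over a homeomorphism of the
bases that multiplies squared norms by a positive continuous function `ratio`, while the image of
the first measure is `ratio` times the second. The two factors cancel, so such a `ConformalIso` acts
unitarily on square integrable sections.

Both maps of the proposition are of this kind. For a chart `φ`, the map `r^{1/2} A^{1/2} φ` over `τ`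
multiplies squared norms by `r`, and `τ` carries `μ^u` to `r^u μ`. For `g` in the groupoid the ratio
is `1`: the metric on the bundle is invariant by hypothesis, and so are the measures `μ^u`, because
a translated fibre parametrization is again a fibre parametrization, with the same Gram determinant.
That the chart maps are jointly continuous in `u` and `z` needs two facts. The density `r` is a
quotient of continuous positive coordinate densities (`SmoothTriv.exists_density`); before that,
change of variables shows that over a coordinate domain the supremum defining `μ^u` is a single
local measure. The square root of `A` depends continuously on the two metrics
(`IsSqrtForm.continuous`), by local boundedness, compactness and uniqueness of positive square
roots.

The analytic core is `EquivariantStructure.continuous_kernel`: `L_g`, read in two charts, is jointly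
continuous in `g` and the vector of `L²(Z)`. As these operators are isometries, it suffices to test
on a dense set of vectors. For a continuous section the result is a section jointly continuous in
`(g, z)`, hence continuous in `g` uniformly over the compact `Z`, hence in `L²`. Density of
continuous sections and completeness of `L²(Z)` are inherited from vector-valued `Lp` spaces by
writing the bundle over `Z` as a direct summand of a trivial bundle.

The transition functions are the kernels at the units of the groupoid, so their continuity is a
special case; gluing gives the Hilbert bundle, and the kernels give continuity of the action. For
uniqueness, the positive square root of `A` is unique, so the formula fixes the fibre maps of every
chart, and these determine all neighbourhood filters of the total space. -/

set_option linter.unusedSectionVars false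

/-! ## Measurable sections as measurable maps into the total space -/

section Measurability

variable {B : Type*} [TopologicalSpace B] [MeasurableSpace B]
  [SecondCountableTopology B] [OpensMeasurableSpace B]
  {F : Type*} [NormedAddCommGroup F] [NormedSpace ℂ F] [FiniteDimensional ℂ F]
  {V : B → Type*} [TopologicalSpace (TotalSpace F V)] [∀ x, AddCommGroup (V x)]
  [∀ x, Module ℂ (V x)] [∀ x, TopologicalSpace (V x)] [FiberBundle F V]
  [MeasurableSpace (TotalSpace F V)] [BorelSpace (TotalSpace F V)]

theorem secondCountableTopology_of_finiteDimensional_complex : SecondCountableTopology F := by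
  have := FiniteDimensional.proper ℂ F
  infer_instance

/-- Countably many trivializing sets cover the base, and over each of them the section is the
inverse trivialization applied to measurable coordinates. In this form measurability is preserved by
composing with any continuous bundle map, without choosing trivializations. -/
theorem AEMeasurableSection.aemeasurable_total {ν : Measure B} {f : ∀ x, V x}
    (hf : AEMeasurableSection F ν f) :
    AEMeasurable (fun x => (⟨x, f x⟩ : TotalSpace F V)) ν := by
  classical
  obtain ⟨s, hs, hU⟩ := TopologicalSpace.countable_cover_nhds
    (f := fun b : B => (trivializationAt F V b).baseSet)
    (fun b => (trivializationAt F V b).open_baseSet.mem_nhds (mem_baseSet_trivializationAt F V b))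
  have : Countable s := hs.to_subtype
  rw [← Measure.restrict_univ (μ := ν), ← hU, biUnion_eq_iUnion, aemeasurable_iUnion_iff]
  rintro ⟨b, -⟩
  dsimp only
  set e := trivializationAt F V b with he
  borelize F
  have : SecondCountableTopology F := secondCountableTopology_of_finiteDimensional_complex
  have hfin : AEMeasurable (fun x => (x, (e ⟨x, f x⟩).2)) (ν.restrict e.baseSet) :=
    aemeasurable_id.prodMk (hf b).aemeasurable
  have hc : ContinuousOn e.toOpenPartialHomeomorph.symm (e.baseSet ×ˢ univ) := by
    rw [← e.target_eq]
    exact e.toOpenPartialHomeomorph.symm.continuousOn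
  -- The piecewise extension below needs some constant value `c`; if there is none, the base is
  -- empty and the measure is zero.
  by_cases hne : Nonempty (TotalSpace F V)
  swap
  · have hB : IsEmpty B := ⟨fun b => hne ⟨⟨b, 0⟩⟩⟩
    have h0 : ν.restrict e.baseSet = 0 := Measure.eq_zero_of_isEmpty _
    rw [h0]
    exact aemeasurable_zero_measure
  obtain ⟨c⟩ := hne
  have hm := (hc.measurable_piecewise (g := fun _ => c) continuousOn_const
    (e.open_baseSet.prod isOpen_univ).measurableSet)
  refine (hm.comp_aemeasurable hfin).congr ?_
  refine ae_restrict_of_forall_mem e.open_baseSet.measurableSet ?_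
  intro x hx
  have h0 : (⟨x, f x⟩ : TotalSpace F V) ∈ e.source := by rw [e.source_eq]; exact hx
  have h1 : (x, (e ⟨x, f x⟩).2) = e ⟨x, f x⟩ := Prod.ext (e.coe_fst h0).symm rfl
  have h2 : e.toOpenPartialHomeomorph.symm (e ⟨x, f x⟩) = ⟨x, f x⟩ :=
    e.toOpenPartialHomeomorph.left_inv h0
  have h3 : (x, (e ⟨x, f x⟩).2) ∈ e.baseSet ×ˢ (univ : Set F) := ⟨hx, mem_univ _⟩
  simp only [Function.comp_apply]
  rw [piecewise_eq_of_mem _ _ _ h3, h1, h2]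

theorem AEMeasurableSection.of_aemeasurable_total {ν : Measure B} {f : ∀ x, V x}
    (hf : AEMeasurable (fun x => (⟨x, f x⟩ : TotalSpace F V)) ν) :
    AEMeasurableSection F ν f := by
  classical
  intro b
  set e := trivializationAt F V b with he
  borelize F
  have : SecondCountableTopology F := secondCountableTopology_of_finiteDimensional_complex
  have hc : ContinuousOn (fun v => (e v).2) e.source :=
    continuous_snd.comp_continuousOn e.continuousOn
  have hm := (hc.measurable_piecewise (g := fun _ => 0) continuousOn_const
    e.open_source.measurableSet)
  refine AEMeasurable.aestronglyMeasurable ?_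
  refine (hm.comp_aemeasurable hf.restrict).congr ?_
  refine ae_restrict_of_forall_mem e.open_baseSet.measurableSet ?_
  intro x hx
  have h0 : (⟨x, f x⟩ : TotalSpace F V) ∈ e.source := by rw [e.source_eq]; exact hx
  simp only [Function.comp_apply]
  rw [piecewise_eq_of_mem _ _ _ h0]

end Measurability

namespace HermitianMetric

section L2

variable {B : Type*} [TopologicalSpace B] [MeasurableSpace B]
  {F : Type*} [NormedAddCommGroup F] [NormedSpace ℂ F]
  {V : B → Type*} [TopologicalSpace (TotalSpace F V)] [∀ x, AddCommGroup (V x)]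
  [∀ x, Module ℂ (V x)] [∀ x, TopologicalSpace (V x)] [FiberBundle F V]
  [SecondCountableTopology B] [OpensMeasurableSpace B] [FiniteDimensional ℂ F]
  [VectorBundle ℂ F V] {h : HermitianMetric F V} {ν : Measure B}

theorem norm_sq_eq_integral (f : h.SqIntegrable ν) : ‖f‖ ^ 2 = ∫ x, h.normSq f.sec x ∂ν := by
  rw [← inner_self_eq_norm_sq (𝕜 := ℂ) f]
  have := integral_re (𝕜 := ℂ) (h.integrable_form (ν := ν) f f)
  exact this.symm

theorem sec_sub (f g : h.SqIntegrable ν) : (f - g).sec = f.sec - g.sec := rfl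

theorem normSq_eq_zero_iff (h : HermitianMetric F V) (f : ∀ x, V x) (x : B) :
    h.normSq f x = 0 ↔ f x = 0 := by
  refine ⟨fun hx => ?_, fun hx => by simp [normSq, hx]⟩
  by_contra hne
  exact (h.pos x _ hne).ne' hx

theorem norm_eq_zero_iff_ae (f : h.SqIntegrable ν) : ‖f‖ = 0 ↔ ∀ᵐ x ∂ν, f.sec x = 0 := by
  have hi : Integrable (h.normSq f.sec) ν := f.2.2
  rw [← sq_eq_zero_iff, norm_sq_eq_integral,
    integral_eq_zero_iff_of_nonneg (fun x => h.normSq_nonneg _ _) hi]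
  refine Filter.eventually_congr (.of_forall fun x => ?_)
  exact h.normSq_eq_zero_iff _ _

theorem toL2_eq_iff (f g : h.SqIntegrable ν) : f.toL2 = g.toL2 ↔ ∀ᵐ x ∂ν, f.sec x = g.sec x := by
  unfold SqIntegrable.toL2
  rw [SeparationQuotient.mk_eq_mk, Metric.inseparable_iff, dist_eq_norm, norm_eq_zero_iff_ae]
  simp only [sec_sub, Pi.sub_apply, sub_eq_zero]

theorem toL2_surjective : Function.Surjective (SqIntegrable.toL2 : h.SqIntegrable ν → h.L2 ν) :=
  SeparationQuotient.surjective_mk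

theorem norm_toL2 (f : h.SqIntegrable ν) : ‖f.toL2‖ = ‖f‖ := SeparationQuotient.norm_mk f

end L2

end HermitianMetric

/-- The linear isometry between the separation quotients induced by a linear isometry. -/
noncomputable def separationQuotientMap {E E' : Type*} [SeminormedAddCommGroup E]
    [SeminormedAddCommGroup E'] [NormedSpace ℂ E] [NormedSpace ℂ E'] (T : E →ₗᵢ[ℂ] E') :
    SeparationQuotient E →ₗᵢ[ℂ] SeparationQuotient E' where
  toLinearMap := (SeparationQuotient.liftCLM
    ((SeparationQuotient.mkCLM ℂ E').comp T.toContinuousLinearMap) fun x y hxy =>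
      SeparationQuotient.mk_eq_mk.2 (hxy.map T.continuous)).toLinearMap
  norm_map' x := by
    obtain ⟨x, rfl⟩ := SeparationQuotient.surjective_mk x
    exact (SeparationQuotient.norm_mk _).trans
      ((T.norm_map x).trans (SeparationQuotient.norm_mk _).symm)

/-! ## Unitaries between `L²`-spaces induced by conformal bundle isomorphisms -/

section Conformal

variable {B B' : Type*} [TopologicalSpace B] [MeasurableSpace B]
  [TopologicalSpace B'] [MeasurableSpace B']
  {F F' : Type*} [NormedAddCommGroup F] [NormedSpace ℂ F]
  [NormedAddCommGroup F'] [NormedSpace ℂ F']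
  {V : B → Type*} [TopologicalSpace (TotalSpace F V)] [∀ x, AddCommGroup (V x)]
  [∀ x, Module ℂ (V x)]
  {V' : B' → Type*} [TopologicalSpace (TotalSpace F' V')] [∀ x, AddCommGroup (V' x)]
  [∀ x, Module ℂ (V' x)]

/-- An isomorphism of vector bundles covering a homeomorphism of the bases which is conformal on the
fibres with factor `ratio`, and such that `ratio` is also the density of the image of the measure `ν`
with respect to `ν'`. -/
structure ConformalIso (h : HermitianMetric F V) (ν : Measure B) (h' : HermitianMetric F' V')
    (ν' : Measure B') where
  base : B ≃ₜ B'
  lin : ∀ x, V x ≃ₗ[ℂ] V' (base x)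
  inv : TotalSpace F' V' → TotalSpace F V
  ratio : B → ℝ
  ratio_pos : ∀ x, 0 < ratio x
  continuous_ratio : Continuous ratio
  continuous_total : Continuous fun v : TotalSpace F V =>
    (⟨base v.proj, lin v.proj v.2⟩ : TotalSpace F' V')
  continuous_inv : Continuous inv
  inv_apply : ∀ x v, inv ⟨base x, lin x v⟩ = ⟨x, v⟩
  conformal : ∀ x v, (h'.form _ (lin x v) (lin x v)).re = ratio x * (h.form x v v).re
  map_measure : ν.map base = ν'.withDensity fun y => ENNReal.ofReal (ratio (base.symm y))

namespace ConformalIso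

variable {h : HermitianMetric F V} {ν : Measure B} {h' : HermitianMetric F' V'}
  {ν' : Measure B'} (Θ : ConformalIso h ν h' ν')

/-- The pullback of a section. -/
def pullSec (k : ∀ y, V' y) (x : B) : V x := (Θ.lin x).symm (k (Θ.base x))

/-- The image of a section. -/
def pushSec (f : ∀ x, V x) (y : B') : V' y :=
  cast (congrArg V' (Θ.base.apply_symm_apply y)) (Θ.lin (Θ.base.symm y) (f (Θ.base.symm y)))

/-- As points of the total space the two sides can be compared without the cast, which makes
continuity and measurability of the pushed section accessible. -/
theorem mk_pushSec (f : ∀ x, V x) (y : B') :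
    (⟨y, Θ.pushSec f y⟩ : TotalSpace F' V') =
      ⟨Θ.base (Θ.base.symm y), Θ.lin (Θ.base.symm y) (f (Θ.base.symm y))⟩ := by
  have key : ∀ (z : B') (hz : z = y) (v : V' z),
      (⟨y, cast (congrArg V' hz) v⟩ : TotalSpace F' V') = ⟨z, v⟩ := by
    rintro z rfl v; rfl
  exact key _ (Θ.base.apply_symm_apply y) _

theorem pushSec_base (f : ∀ x, V x) (x : B) : Θ.pushSec f (Θ.base x) = Θ.lin x (f x) := by
  have := Θ.mk_pushSec f (Θ.base x)
  rw [Θ.base.symm_apply_apply] at this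
  exact TotalSpace.mk_inj.1 this

theorem pullSec_pushSec (f : ∀ x, V x) : Θ.pullSec (Θ.pushSec f) = f := by
  ext x
  rw [pullSec, pushSec_base, LinearEquiv.symm_apply_apply]

theorem mk_pullSec (k : ∀ y, V' y) (x : B) :
    (⟨x, Θ.pullSec k x⟩ : TotalSpace F V) = Θ.inv ⟨Θ.base x, k (Θ.base x)⟩ := by
  have := Θ.inv_apply x (Θ.pullSec k x)
  rw [← this, pullSec, LinearEquiv.apply_symm_apply]

theorem normSq_pullSec (k : ∀ y, V' y) (x : B) :
    h.normSq (Θ.pullSec k) x = (Θ.ratio x)⁻¹ * h'.normSq k (Θ.base x) := by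
  have := Θ.conformal x (Θ.pullSec k x)
  rw [HermitianMetric.normSq, HermitianMetric.normSq]
  simp only [pullSec, LinearEquiv.apply_symm_apply] at this ⊢
  rw [this, inv_mul_cancel_left₀ (Θ.ratio_pos x).ne']

section Measure

variable [BorelSpace B] [BorelSpace B']

theorem measurable_ratio :
    Measurable fun y => ENNReal.ofReal (Θ.ratio (Θ.base.symm y)) :=
  (ENNReal.continuous_ofReal.comp (Θ.continuous_ratio.comp Θ.base.symm.continuous)).measurable

/-- The density `ratio` is positive everywhere, so the image of `ν` and the measure `ν'` have the
same null sets. -/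
theorem ae_base_iff {P : B' → Prop} : (∀ᵐ x ∂ν, P (Θ.base x)) ↔ ∀ᵐ y ∂ν', P y := by
  have h1 : (∀ᵐ y ∂(ν.map Θ.base.toMeasurableEquiv), P y) ↔ ∀ᵐ x ∂ν, P (Θ.base x) :=
    Θ.base.toMeasurableEquiv.measurableEmbedding.ae_map_iff
  rw [← h1, Homeomorph.toMeasurableEquiv_coe, Θ.map_measure, ae_withDensity_iff Θ.measurable_ratio]
  refine Filter.eventually_congr (.of_forall fun y => ?_)
  have := Θ.ratio_pos (Θ.base.symm y)
  simp [this]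

/-- Transporting `ν` to `B'` introduces the density `ratio`, which the factor `ratio⁻¹` removes. The
same cancellation gives the equality of integrals below. -/
theorem integrable_comp_iff (g : B' → ℝ) :
    Integrable (fun x => (Θ.ratio x)⁻¹ * g (Θ.base x)) ν ↔ Integrable g ν' := by
  have h1 := integrable_map_equiv (μ := ν) Θ.base.toMeasurableEquiv
    (fun y => (Θ.ratio (Θ.base.symm y))⁻¹ * g y)
  rw [Homeomorph.toMeasurableEquiv_coe, Θ.map_measure,
    integrable_withDensity_iff_integrable_smul' Θ.measurable_ratio (by simp)] at h1
  have h2 : (fun y => (ENNReal.ofReal (Θ.ratio (Θ.base.symm y))).toReal •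
      ((Θ.ratio (Θ.base.symm y))⁻¹ * g y)) = g := by
    ext y
    have := Θ.ratio_pos (Θ.base.symm y)
    rw [ENNReal.toReal_ofReal this.le, smul_eq_mul, mul_inv_cancel_left₀ this.ne']
  rw [h2] at h1
  rw [h1]
  simp [Function.comp_def]

theorem integral_comp_eq (g : B' → ℝ) :
    ∫ x, (Θ.ratio x)⁻¹ * g (Θ.base x) ∂ν = ∫ y, g y ∂ν' := by
  have h1 := integral_map_equiv (μ := ν) Θ.base.toMeasurableEquiv
    (fun y => (Θ.ratio (Θ.base.symm y))⁻¹ * g y)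
  rw [Homeomorph.toMeasurableEquiv_coe, Θ.map_measure,
    integral_withDensity_eq_integral_toReal_smul Θ.measurable_ratio (by simp)] at h1
  have h2 : (fun y => (ENNReal.ofReal (Θ.ratio (Θ.base.symm y))).toReal •
      ((Θ.ratio (Θ.base.symm y))⁻¹ * g y)) = g := by
    ext y
    have := Θ.ratio_pos (Θ.base.symm y)
    rw [ENNReal.toReal_ofReal this.le, smul_eq_mul, mul_inv_cancel_left₀ this.ne']
  rw [h2] at h1
  rw [h1]
  simp

variable [∀ x, TopologicalSpace (V x)] [FiberBundle F V]
  [SecondCountableTopology B] [FiniteDimensional ℂ F] [VectorBundle ℂ F V]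
  [∀ x, TopologicalSpace (V' x)] [FiberBundle F' V']
  [SecondCountableTopology B'] [FiniteDimensional ℂ F'] [VectorBundle ℂ F' V']

theorem aemeasurable_pullSec {k : ∀ y, V' y}
    (hk : AEMeasurableSection F' ν' k) :
    AEMeasurableSection F ν (Θ.pullSec k) := by
  borelize (TotalSpace F V)
  borelize (TotalSpace F' V')
  refine .of_aemeasurable_total ?_
  have h1 : AEMeasurable (fun y => (⟨y, k y⟩ : TotalSpace F' V')) (ν.map Θ.base) := by
    rw [Θ.map_measure]
    exact hk.aemeasurable_total.mono_ac (withDensity_absolutelyContinuous _ _)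
  have h2 := Θ.continuous_inv.measurable.comp_aemeasurable
    (h1.comp_measurable Θ.base.continuous.measurable)
  exact h2.congr (.of_forall fun x => (Θ.mk_pullSec k x).symm)

theorem aemeasurable_pushSec {f : ∀ x, V x}
    (hf : AEMeasurableSection F ν f) :
    AEMeasurableSection F' ν' (Θ.pushSec f) := by
  borelize (TotalSpace F V)
  borelize (TotalSpace F' V')
  refine .of_aemeasurable_total ?_
  have h0 : AEMeasurable (fun y => (⟨Θ.base.symm y, f (Θ.base.symm y)⟩ : TotalSpace F V))
      (ν.map Θ.base) := by
    refine (MeasurableEmbedding.aemeasurable_map_iff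
      Θ.base.toMeasurableEquiv.measurableEmbedding).2 ?_
    refine hf.aemeasurable_total.congr (.of_forall fun x => ?_)
    simp only [Function.comp_apply, Homeomorph.toMeasurableEquiv_coe]
    rw [Θ.base.symm_apply_apply]
  have h1 : AEMeasurable (fun y => (⟨Θ.base.symm y, f (Θ.base.symm y)⟩ : TotalSpace F V)) ν' := by
    -- The converse of the absolute continuity that is automatic for a density: `ν'` is absolutely
    -- continuous with respect to the image of `ν` because the density does not vanish.
    refine h0.mono_ac (Measure.AbsolutelyContinuous.mk fun s hs hs0 => ?_)
    have hc : sᶜ ∈ ae ν' := by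
      refine (Θ.ae_base_iff (P := fun y => y ∈ sᶜ)).1 ?_
      rw [Measure.map_apply Θ.base.continuous.measurable hs] at hs0
      rw [ae_iff]
      simpa using! hs0
    simpa [mem_ae_iff] using! hc
  exact (Θ.continuous_total.measurable.comp_aemeasurable h1).congr
    (.of_forall fun y => (Θ.mk_pushSec f y).symm)

/-- The pullback of square integrable sections. -/
noncomputable def pull (k : h'.SqIntegrable ν') : h.SqIntegrable ν :=
  ⟨Θ.pullSec k.sec, Θ.aemeasurable_pullSec k.2.1, by
    have := (Θ.integrable_comp_iff (h'.normSq k.sec)).2 k.2.2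
    refine this.congr (.of_forall fun x => (Θ.normSq_pullSec _ _).symm)⟩

/-- The image of square integrable sections. -/
noncomputable def push (f : h.SqIntegrable ν) : h'.SqIntegrable ν' :=
  ⟨Θ.pushSec f.sec, Θ.aemeasurable_pushSec f.2.1, by
    rw [← Θ.integrable_comp_iff]
    simp_rw [← normSq_pullSec, pullSec_pushSec]
    exact f.2.2⟩

theorem pull_sec (k : h'.SqIntegrable ν') : (Θ.pull k).sec = Θ.pullSec k.sec := rfl

theorem push_sec (f : h.SqIntegrable ν) : (Θ.push f).sec = Θ.pushSec f.sec := rfl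

theorem pull_push (f : h.SqIntegrable ν) : Θ.pull (Θ.push f) = f :=
  Subtype.ext (Θ.pullSec_pushSec f.sec)

/-- The pullback of square integrable sections as a linear isometry. -/
noncomputable def pullₗᵢ : h'.SqIntegrable ν' →ₗᵢ[ℂ] h.SqIntegrable ν where
  toFun := Θ.pull
  map_add' k k' := Subtype.ext (funext fun x => map_add (Θ.lin x).symm _ _)
  map_smul' c k := Subtype.ext (funext fun x => map_smul (Θ.lin x).symm _ _)
  norm_map' k := by
    -- Pulling back divides the squared norm by `ratio` pointwise, and `integral_comp_eq` says that
    -- this is exactly compensated by the change of measure.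
    rw [← sq_eq_sq₀ (norm_nonneg _) (norm_nonneg _), HermitianMetric.norm_sq_eq_integral,
      HermitianMetric.norm_sq_eq_integral, ← Θ.integral_comp_eq]
    congr 1; ext x
    exact Θ.normSq_pullSec _ _

/-- The unitary `L²(B, V, ν) → L²(B', V', ν')` induced by a conformal isomorphism. -/
noncomputable def unitary : h.L2 ν ≃ₗᵢ[ℂ] h'.L2 ν' :=
  -- The unitary is the inverse of pulling back: pulling back involves no cast, so it is visibly
  -- linear, and `push` only has to provide preimages.
  (LinearIsometryEquiv.ofSurjective (separationQuotientMap Θ.pullₗᵢ) <| by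
    intro f
    obtain ⟨f, rfl⟩ := HermitianMetric.toL2_surjective f
    exact ⟨(Θ.push f).toL2, congrArg HermitianMetric.SqIntegrable.toL2 (Θ.pull_push f)⟩).symm

theorem unitary_symm_toL2 (k : h'.SqIntegrable ν') :
    Θ.unitary.symm k.toL2 = (Θ.pull k).toL2 := rfl

theorem unitary_toL2_eq_iff (f : h.SqIntegrable ν) (k : h'.SqIntegrable ν') :
    Θ.unitary f.toL2 = k.toL2 ↔ ∀ᵐ x ∂ν, k.sec (Θ.base x) = Θ.lin x (f.sec x) := by
  rw [← LinearIsometryEquiv.eq_symm_apply, unitary_symm_toL2, HermitianMetric.toL2_eq_iff]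
  refine Filter.eventually_congr (.of_forall fun x => ?_)
  rw [pull_sec, pullSec, LinearEquiv.eq_symm_apply, eq_comm]

end Measure

end ConformalIso

end Conformal

/-! ## Vector bundles over compact spaces as direct summands of trivial bundles -/

section Summand

variable {Z : Type*} [TopologicalSpace Z] [CompactSpace Z]
  {F : Type*} [NormedAddCommGroup F] [NormedSpace ℂ F] 
  {V : Z → Type*} [TopologicalSpace (TotalSpace F V)] [∀ x, AddCommGroup (V x)]
  [∀ x, Module ℂ (V x)] [∀ x, TopologicalSpace (V x)] [FiberBundle F V] [VectorBundle ℂ F V]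

/-- Off the base set the coordinate map takes the value `0` and is not continuous at the boundary;
the cutoff vanishes near every point outside the base set, so the product is continuous everywhere.
-/
theorem continuous_mul_coordinate (e : Trivialization F (π F V)) [e.IsLinear ℂ] (f : C(Z, ℝ))
    (hf : tsupport f ⊆ e.baseSet) :
    Continuous fun v : TotalSpace F V => (f v.proj : ℂ) • e.linearMapAt ℂ v.proj v.2 := by
  rw [continuous_iff_continuousAt]
  intro v
  by_cases hv : v.proj ∈ e.baseSet
  · have h1 : ContinuousAt (fun v : TotalSpace F V => (f v.proj : ℂ) • (e v).2) v := by
      have := (e.continuousAt (e.mem_source.2 hv)).snd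
      have h2 : ContinuousAt (fun v : TotalSpace F V => (f v.proj : ℂ)) v :=
        (Complex.continuous_ofReal.comp (f.continuous.comp
          (FiberBundle.continuous_proj F V))).continuousAt
      exact h2.smul this
    refine h1.congr ?_
    filter_upwards [e.open_source.mem_nhds (e.mem_source.2 hv)] with w hw
    rw [e.coe_linearMapAt_of_mem (e.mem_source.1 hw)]
  · have hz : v.proj ∈ (tsupport f)ᶜ := fun h => hv (hf h)
    have h2 : (fun _ : TotalSpace F V => (0 : F)) =ᶠ[𝓝 v]
        fun v : TotalSpace F V => (f v.proj : ℂ) • e.linearMapAt ℂ v.proj v.2 := by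
      filter_upwards [(FiberBundle.continuous_proj F V).continuousAt.preimage_mem_nhds
        ((isClosed_tsupport f).isOpen_compl.mem_nhds hz)] with w hw
      rw [image_eq_zero_of_notMem_tsupport hw]
      simp
    exact continuousAt_const.congr h2

/-- With finitely many trivializations `e_i` and functions `f_i` supported in their base sets such
that `∑ f_i² = 1`, put `j = (f_i e_i)_i` and `q = ∑ f_i e_i⁻¹`. Then `q ∘ j = ∑ f_i² = 1`. -/
theorem exists_continuous_retraction_trivial [T2Space Z] :
    ∃ (n : ℕ) (j : ∀ z, V z →ₗ[ℂ] (Fin n → F)) (q : ∀ z, (Fin n → F) →ₗ[ℂ] V z),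
      (∀ z v, q z (j z v) = v) ∧
      (Continuous fun v : TotalSpace F V => j v.proj v.2) ∧
      Continuous fun y : Z × (Fin n → F) => (⟨y.1, q y.1 y.2⟩ : TotalSpace F V) := by
  classical
  obtain ⟨t, ht⟩ := isCompact_univ.elim_finite_subcover
    (fun b : Z => (trivializationAt F V b).baseSet)
    (fun b => (trivializationAt F V b).open_baseSet)
    (fun b _ => mem_iUnion.2 ⟨b, mem_baseSet_trivializationAt F V b⟩)
  let c : Fin t.card → Z := fun i => (t.equivFin.symm i).1
  have hc : univ ⊆ ⋃ i, (trivializationAt F V (c i)).baseSet := by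
    intro z hz
    obtain ⟨b, hb, hzb⟩ := mem_iUnion₂.1 (ht hz)
    exact mem_iUnion.2 ⟨t.equivFin ⟨b, hb⟩, by simpa [c] using hzb⟩
  obtain ⟨ρ, hρ⟩ := PartitionOfUnity.exists_isSubordinate isClosed_univ
    (fun i => (trivializationAt F V (c i)).baseSet)
    (fun i => (trivializationAt F V (c i)).open_baseSet) hc
  -- Square roots of the partition of unity, so that `j` and `q` each receive one cutoff factor and
  -- are both continuous.
  let f : Fin t.card → C(Z, ℝ) := fun i => ⟨fun z => √ (ρ i z), (ρ i).continuous.sqrt⟩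
  have hf : ∀ i, tsupport (f i) ⊆ (trivializationAt F V (c i)).baseSet := fun i => by
    refine subset_trans (closure_mono ?_) (hρ i)
    intro z hz h0
    exact hz (by simp [f, h0])
  have hsum : ∀ z, ∑ i, (f i z) * (f i z) = 1 := fun z => by
    have := ρ.sum_eq_one (mem_univ z)
    rw [finsum_eq_sum_of_fintype] at this
    rw [← this]
    exact Finset.sum_congr rfl fun i _ => Real.mul_self_sqrt (ρ.nonneg i z)
  let j : ∀ z, V z →ₗ[ℂ] (Fin t.card → F) := fun z =>
    LinearMap.pi fun i => (f i z : ℂ) • (trivializationAt F V (c i)).linearMapAt ℂ z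
  let q : ∀ z, (Fin t.card → F) →ₗ[ℂ] V z := fun z =>
    ∑ i, (f i z : ℂ) • (trivializationAt F V (c i)).symmₗ ℂ z ∘ₗ LinearMap.proj i
  refine ⟨t.card, j, q, ?_, ?_, ?_⟩
  · intro z v
    simp only [j, q, LinearMap.sum_apply, LinearMap.smul_apply, LinearMap.comp_apply,
      LinearMap.proj_apply, LinearMap.pi_apply, map_smul]
    have : ∀ i, (f i z : ℂ) • (f i z : ℂ) • ((trivializationAt F V (c i)).symmₗ ℂ z
        ((trivializationAt F V (c i)).linearMapAt ℂ z v)) = ((f i z * f i z : ℝ) : ℂ) • v := by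
      intro i
      by_cases hz : z ∈ (trivializationAt F V (c i)).baseSet
      · rw [Trivialization.symmₗ_linearMapAt _ hz, smul_smul, Complex.ofReal_mul]
      · have : f i z = 0 := image_eq_zero_of_notMem_tsupport fun h => hz (hf i h)
        simp [this]
    rw [Finset.sum_congr rfl fun i _ => this i, ← Finset.sum_smul, ← Complex.ofReal_sum, hsum]
    simp
  · exact continuous_pi fun i => continuous_mul_coordinate _ (f i) (hf i)
  · rw [continuous_iff_continuousAt]
    rintro ⟨z₀, w₀⟩
    rw [FiberBundle.continuousAt_totalSpace]
    refine ⟨continuousAt_fst, ?_⟩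
    simp only
    set e₀ := trivializationAt F V z₀ with he₀
    have hz₀ : z₀ ∈ e₀.baseSet := mem_baseSet_trivializationAt F V z₀
    have hev : ∀ᶠ y : Z × (Fin t.card → F) in 𝓝 (z₀, w₀), y.1 ∈ e₀.baseSet :=
      continuousAt_fst.preimage_mem_nhds (e₀.open_baseSet.mem_nhds hz₀)
    have hsum' : ContinuousAt (fun y : Z × (Fin t.card → F) =>
        ∑ i, (f i y.1 : ℂ) • e₀.linearMapAt ℂ y.1
          ((trivializationAt F V (c i)).symmₗ ℂ y.1 (y.2 i))) (z₀, w₀) := by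
      refine tendsto_finsetSum _ fun i _ => ?_
      set e := trivializationAt F V (c i) with he
      -- If `z₀` is not in the base set, it lies off the support of `f i`, and the term vanishes in
      -- a neighbourhood.
      by_cases hz : z₀ ∈ e.baseSet
      · have hm : (z₀, w₀ i) ∈ e.target := e.mem_target.2 hz
        have h1 : ContinuousAt (fun y : Z × (Fin t.card → F) =>
            e.toOpenPartialHomeomorph.symm (y.1, y.2 i)) (z₀, w₀) :=
          ContinuousAt.comp (f := fun y : Z × (Fin t.card → F) => (y.1, y.2 i))
            (e.toOpenPartialHomeomorph.symm.continuousAt hm) (by fun_prop)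
        have hp : (e.toOpenPartialHomeomorph.symm (z₀, w₀ i)).proj = z₀ := e.proj_symm_apply hm
        have h2 : ContinuousAt (fun y : Z × (Fin t.card → F) =>
            (e₀ (e.toOpenPartialHomeomorph.symm (y.1, y.2 i))).2) (z₀, w₀) := by
          refine (ContinuousAt.comp (f := fun y : Z × (Fin t.card → F) =>
            e.toOpenPartialHomeomorph.symm (y.1, y.2 i)) (g := e₀) ?_ h1).snd
          exact e₀.continuousAt (e₀.mem_source.2 (by rw [hp]; exact hz₀))
        have h3 : ContinuousAt (fun y : Z × (Fin t.card → F) => (f i y.1 : ℂ)) (z₀, w₀) :=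
          (Complex.continuous_ofReal.comp ((f i).continuous.comp continuous_fst)).continuousAt
        refine (h3.smul h2).congr ?_
        filter_upwards [hev, continuousAt_fst.preimage_mem_nhds (e.open_baseSet.mem_nhds hz)]
          with y hy0 hy
        rw [e₀.coe_linearMapAt_of_mem hy0, e.symmₗ_apply hy]
        change _ = (f i y.1 : ℂ) • (e₀ ⟨y.1, e.symm y.1 (y.2 i)⟩).2
        rw [e.mk_symm hy]
        rfl
      · have hz' : z₀ ∈ (tsupport (f i))ᶜ := fun h => hz (hf i h)
        refine continuousAt_const (y := (0 : F)) |>.congr ?_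
        filter_upwards [continuousAt_fst.preimage_mem_nhds
          ((isClosed_tsupport (f i)).isOpen_compl.mem_nhds hz')] with y hy
        rw [image_eq_zero_of_notMem_tsupport hy]
        simp
    refine hsum'.congr ?_
    filter_upwards [hev] with y hy
    have h4 := congrFun (e₀.coe_linearMapAt_of_mem (R := ℂ) hy) (q y.1 y.2)
    rw [← h4]
    simp [q, LinearMap.sum_apply]

end Summand

/-! ### `L²` over a compact base: completeness, continuous families, density of continuous sections.
-/

section Compact

variable {Z : Type*} [TopologicalSpace Z] [CompactSpace Z] [T2Space Z]
  {F : Type*} [NormedAddCommGroup F] [NormedSpace ℂ F] [FiniteDimensional ℂ F]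
  {V : Z → Type*} [TopologicalSpace (TotalSpace F V)] [∀ x, AddCommGroup (V x)]
  [∀ x, Module ℂ (V x)] [∀ x, TopologicalSpace (V x)] [FiberBundle F V] [VectorBundle ℂ F V]

/-- By homogeneity both bounds need only be checked on unit vectors of the trivial bundle, which
form a compact set over the compact base. They make `q` and `j` bounded between `L²`-spaces. -/
theorem HermitianMetric.exists_bounded_retraction (h : HermitianMetric F V) :
    ∃ (n : ℕ) (j : ∀ z, V z →ₗ[ℂ] (Fin n → F)) (q : ∀ z, (Fin n → F) →ₗ[ℂ] V z) (C : ℝ),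
      0 ≤ C ∧ (∀ z v, q z (j z v) = v) ∧
      (Continuous fun v : TotalSpace F V => j v.proj v.2) ∧
      (Continuous fun y : Z × (Fin n → F) => (⟨y.1, q y.1 y.2⟩ : TotalSpace F V)) ∧
      (∀ z w, (h.form z (q z w) (q z w)).re ≤ C * ‖w‖ ^ 2) ∧
      (∀ z v, ‖j z v‖ ^ 2 ≤ C * (h.form z v v).re) := by
  obtain ⟨n, j, q, hqj, hj, hq⟩ := exists_continuous_retraction_trivial (F := F) (V := V)
  have : ProperSpace (Fin n → F) := FiniteDimensional.proper ℂ _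
  let N : Z × (Fin n → F) → ℝ := fun y => (h.form y.1 (q y.1 y.2) (q y.1 y.2)).re
  have hN : Continuous N := h.continuous_sq.comp hq
  have hhom : ∀ (z : Z) (a : ℝ) (w : Fin n → F), N (z, (a : ℂ) • w) = a ^ 2 * N (z, w) := by
    intro z a w
    simp only [N, map_smul, LinearMap.map_smulₛₗ, LinearMap.smul_apply, smul_eq_mul,
      Complex.conj_ofReal, Complex.re_ofReal_mul]
    ring
  have hunit : ∀ w : Fin n → F, w ≠ 0 → w = ((‖w‖ : ℝ) : ℂ) • (((‖w‖⁻¹ : ℝ) : ℂ) • w) := by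
    intro w hw
    rw [smul_smul, ← Complex.ofReal_mul, mul_inv_cancel₀ (norm_ne_zero_iff.2 hw)]
    simp
  have hun : ∀ w : Fin n → F, w ≠ 0 → ‖((‖w‖⁻¹ : ℝ) : ℂ) • w‖ = 1 := by
    intro w hw
    rw [norm_smul, Complex.norm_real, norm_inv, norm_norm,
      inv_mul_cancel₀ (norm_ne_zero_iff.2 hw)]
  have hS : IsCompact ((univ : Set Z) ×ˢ Metric.sphere (0 : Fin n → F) 1) :=
    isCompact_univ.prod (isCompact_sphere _ _)
  obtain ⟨C₁, hC₁⟩ := hS.bddAbove_image hN.continuousOn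
  have hjq : Continuous fun y : Z × (Fin n → F) => j y.1 (q y.1 y.2) := hj.comp hq
  -- The unit vectors in the image of `j`, described as the fixed points of `j ∘ q` so that the set
  -- is visibly closed. On it `N` is positive, since `q w = 0` would force `w = j 0 = 0`.
  have hK : IsCompact ({y : Z × (Fin n → F) | j y.1 (q y.1 y.2) = y.2} ∩
      (univ : Set Z) ×ˢ Metric.sphere (0 : Fin n → F) 1) :=
    hS.inter_left (isClosed_eq hjq continuous_snd)
  have hpos : ∀ y ∈ {y : Z × (Fin n → F) | j y.1 (q y.1 y.2) = y.2} ∩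
      (univ : Set Z) ×ˢ Metric.sphere (0 : Fin n → F) 1, 0 < N y := by
    rintro ⟨z, w⟩ ⟨hy, -, hw⟩
    refine h.pos _ _ fun h0 => ?_
    simp only [mem_ofPred_eq] at hy
    simp only at h0
    rw [h0, map_zero] at hy
    simp [← hy] at hw
  obtain ⟨C₂, hC₂⟩ := hK.bddAbove_image (f := fun y => (N y)⁻¹)
    (hN.continuousOn.inv₀ fun y hy => (hpos y hy).ne')
  refine ⟨n, j, q, max 0 (max C₁ C₂), le_max_left _ _, hqj, hj, hq, fun z w => ?_, fun z v => ?_⟩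
  · by_cases hw : w = 0
    · simp [hw]
    change N (z, w) ≤ _
    rw [hunit w hw, hhom, ← hunit w hw, mul_comm]
    refine mul_le_mul_of_nonneg_right ?_ (sq_nonneg _)
    refine (hC₁ ⟨_, ⟨mem_univ z, ?_⟩, rfl⟩).trans ((le_max_left _ _).trans (le_max_right _ _))
    simpa using hun w hw
  · by_cases hv : v = 0
    · simp [hv]
    set w := j z v with hw
    have hw0 : w ≠ 0 := fun h0 => hv (by rw [← hqj z v, ← hw, h0, map_zero])
    have e1 : (h.form z v v).re = N (z, w) := by
      simp only [N]
      rw [hw, hqj]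
    have hmem : (z, ((‖w‖⁻¹ : ℝ) : ℂ) • w) ∈ {y : Z × (Fin n → F) | j y.1 (q y.1 y.2) = y.2} ∩
      (univ : Set Z) ×ˢ Metric.sphere (0 : Fin n → F) 1 := by
      refine ⟨?_, mem_univ _, by simpa using hun w hw0⟩
      simp only [mem_ofPred_eq, map_smul]
      rw [hw, hqj]
    have h1 : (N (z, ((‖w‖⁻¹ : ℝ) : ℂ) • w))⁻¹ ≤ max 0 (max C₁ C₂) :=
      (hC₂ ⟨_, hmem, rfl⟩).trans ((le_max_right _ _).trans (le_max_right _ _))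
    have h2 := hpos _ hmem
    rw [e1, hunit w hw0, hhom, ← hunit w hw0]
    have h3 : 1 ≤ max 0 (max C₁ C₂) * N (z, ((‖w‖⁻¹ : ℝ) : ℂ) • w) := by
      calc 1 = (N (z, ((‖w‖⁻¹ : ℝ) : ℂ) • w))⁻¹ * N (z, ((‖w‖⁻¹ : ℝ) : ℂ) • w) :=
            (inv_mul_cancel₀ h2.ne').symm
        _ ≤ _ := mul_le_mul_of_nonneg_right h1 h2.le
    nlinarith [sq_nonneg ‖w‖]

variable [SecondCountableTopology Z] [MeasurableSpace Z] [BorelSpace Z]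

theorem sq_norm_toLp_two {α E : Type*} [MeasurableSpace α] [NormedAddCommGroup E] {ν : Measure α}
    {f : α → E} (hf : MemLp f 2 ν) : ‖hf.toLp f‖ ^ 2 = ∫ x, ‖f x‖ ^ 2 ∂ν := by
  rw [Lp.norm_toLp, hf.eLpNorm_eq_integral_rpow_norm (by simp) (by simp)]
  have h0 : 0 ≤ ∫ x, ‖f x‖ ^ (2 : ENNReal).toReal ∂ν :=
    integral_nonneg fun x => by positivity
  rw [ENNReal.toReal_ofReal (by positivity), ← Real.rpow_natCast, ← Real.rpow_mul h0]
  simp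

namespace HermitianMetric

variable {h : HermitianMetric F V} {ν : Measure Z} {n : ℕ}
  {q : ∀ z, (Fin n → F) →ₗ[ℂ] V z} {j : ∀ z, V z →ₗ[ℂ] (Fin n → F)} {C : ℝ}

theorem retraction_mem (hq : Continuous fun y : Z × (Fin n → F) =>
      (⟨y.1, q y.1 y.2⟩ : TotalSpace F V))
    (hqC : ∀ z w, (h.form z (q z w) (q z w)).re ≤ C * ‖w‖ ^ 2) {f : Z → Fin n → F}
    (hf : MemLp f 2 ν) : (fun z => q z (f z)) ∈ h.squareIntegrable ν := by
  have : ProperSpace (Fin n → F) := FiniteDimensional.proper ℂ _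
  have : SecondCountableTopology (Fin n → F) := inferInstance
  borelize (Fin n → F)
  borelize (TotalSpace F V)
  have hm : AEMeasurableSection F ν fun z => q z (f z) :=
    .of_aemeasurable_total (hq.measurable.comp_aemeasurable
      (aemeasurable_id.prodMk hf.aestronglyMeasurable.aemeasurable))
  refine ⟨hm, ?_⟩
  refine ((hf.integrable_norm_pow (by simp)).const_mul C).mono'
    (h.aestronglyMeasurable_normSq hm) (.of_forall fun z => ?_)
  rw [Real.norm_of_nonneg (h.normSq_nonneg _ _)]
  exact hqC z (f z)

/-- The section `q f` for a square integrable function `f` with values in a trivial bundle. -/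
noncomputable def retract (hq : Continuous fun y : Z × (Fin n → F) =>
      (⟨y.1, q y.1 y.2⟩ : TotalSpace F V))
    (hqC : ∀ z w, (h.form z (q z w) (q z w)).re ≤ C * ‖w‖ ^ 2) (f : Lp (Fin n → F) 2 ν) :
    h.SqIntegrable ν :=
  ⟨_, retraction_mem (h := h) hq hqC (Lp.memLp f)⟩

/-- The map induced on `L²`-spaces by the projection of a trivial bundle onto a vector bundle. -/
noncomputable def retractL2 (hC : 0 ≤ C) (hq : Continuous fun y : Z × (Fin n → F) =>
      (⟨y.1, q y.1 y.2⟩ : TotalSpace F V))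
    (hqC : ∀ z w, (h.form z (q z w) (q z w)).re ≤ C * ‖w‖ ^ 2) :
    Lp (Fin n → F) 2 ν →L[ℂ] h.L2 ν :=
  LinearMap.mkContinuous
    { toFun f := (retract hq hqC f).toL2
      map_add' f g := by
        refine (toL2_eq_iff _ (retract hq hqC f + retract hq hqC g)).2 ?_
        filter_upwards [Lp.coeFn_add f g] with z hz
        change q z _ = q z _ + q z _
        rw [hz, Pi.add_apply, map_add]
      map_smul' c f := by
        refine (toL2_eq_iff _ (c • retract hq hqC f)).2 ?_
        filter_upwards [Lp.coeFn_smul c f] with z hz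
        change q z _ = c • q z _
        rw [hz, Pi.smul_apply, map_smul] } (√ C) fun f => by
    change ‖(retract hq hqC f).toL2‖ ≤ _
    rw [norm_toL2]
    refine le_of_sq_le_sq ?_ (by positivity)
    rw [mul_pow, Real.sq_sqrt hC, norm_sq_eq_integral]
    have e1 := sq_norm_toLp_two (Lp.memLp f)
    rw [Lp.toLp_coeFn] at e1
    rw [e1, ← integral_const_mul]
    refine integral_mono (retract hq hqC f).2.2
      (((Lp.memLp f).integrable_norm_pow (by simp)).const_mul C) fun z => ?_
    exact hqC z (f z)

theorem retractL2_toLp (hC : 0 ≤ C) (hq : Continuous fun y : Z × (Fin n → F) =>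
      (⟨y.1, q y.1 y.2⟩ : TotalSpace F V))
    (hqC : ∀ z w, (h.form z (q z w) (q z w)).re ≤ C * ‖w‖ ^ 2) {f : Lp (Fin n → F) 2 ν}
    {g : Z → Fin n → F} (hfg : f =ᵐ[ν] g) {k : h.SqIntegrable ν} (hk : ∀ z, k.sec z = q z (g z)) :
    retractL2 (ν := ν) hC hq hqC f = k.toL2 := by
  refine (toL2_eq_iff (retract hq hqC f) k).2 ?_
  filter_upwards [hfg] with z hz
  rw [hk, ← hz]
  rfl

theorem memLp_inclusion (hj : Continuous fun v : TotalSpace F V => j v.proj v.2)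
    (hjC : ∀ z v, ‖j z v‖ ^ 2 ≤ C * (h.form z v v).re) (f : h.SqIntegrable ν) :
    MemLp (fun z => j z (f.sec z)) 2 ν := by
  have : ProperSpace (Fin n → F) := FiniteDimensional.proper ℂ _
  have : SecondCountableTopology (Fin n → F) := inferInstance
  borelize (Fin n → F)
  borelize (TotalSpace F V)
  have hf : AEMeasurableSection F ν f.sec := f.2.1
  have hm : AEStronglyMeasurable (fun z => j z (f.sec z)) ν :=
    (hj.measurable.comp_aemeasurable hf.aemeasurable_total).aestronglyMeasurable
  rw [memLp_two_iff_integrable_sq_norm hm]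
  have hi : Integrable (h.normSq f.sec) ν := f.2.2
  refine (hi.const_mul C).mono' (hm.norm.pow 2) (.of_forall fun z => ?_)
  rw [Real.norm_of_nonneg (by positivity)]
  exact hjC z _

/-- The `L²`-space of a vector bundle on a compact space is complete. -/
theorem completeSpace_L2 (h : HermitianMetric F V) (ν : Measure Z) : CompleteSpace (h.L2 ν) := by
  obtain ⟨n, j, q, C, hC, hqj, hj, hq, hqC, hjC⟩ := h.exists_bounded_retraction
  refine Metric.complete_of_cauchySeq_tendsto fun u hu => ?_
  choose g hg using fun i => toL2_surjective (u i)
  -- `J` embeds sections into a complete space and is Lipschitz with constant `√C`; the projection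
  -- `q` brings the limit found there back to sections.
  let J : h.SqIntegrable ν → Lp (Fin n → F) 2 ν := fun f => (memLp_inclusion hj hjC f).toLp _
  have hJ : ∀ a b, dist (J a) (J b) ≤ √ C * dist a.toL2 b.toL2 := by
    intro a b
    rw [dist_eq_norm, dist_eq_norm]
    have e1 : J a - J b = J (a - b) := by
      simp only [J]
      rw [← MemLp.toLp_sub]
      congr 1
      ext z : 1
      exact (map_sub (j z) _ _).symm
    have e2 : a.toL2 - b.toL2 = (a - b).toL2 := rfl
    rw [e1, e2, norm_toL2]
    refine le_of_sq_le_sq ?_ (by positivity)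
    rw [mul_pow, Real.sq_sqrt hC, norm_sq_eq_integral, sq_norm_toLp_two, ← integral_const_mul]
    exact integral_mono ((memLp_inclusion hj hjC (a - b)).integrable_norm_pow (by simp))
      ((a - b).2.2.const_mul C) fun z => hjC z _
  have hc : CauchySeq fun i => J (g i) := by
    rw [Metric.cauchySeq_iff] at hu ⊢
    intro ε hε
    -- Adding `1` keeps the divisor positive when `C = 0`.
    obtain ⟨N, hN⟩ := hu (ε / (√ C + 1)) (by positivity)
    refine ⟨N, fun a ha b hb => (hJ _ _).trans_lt ?_⟩
    rw [hg, hg]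
    have h1 := hN a ha b hb
    rw [lt_div_iff₀ (by positivity)] at h1
    nlinarith [dist_nonneg (x := u a) (y := u b)]
  obtain ⟨x, hx⟩ := cauchySeq_tendsto_of_complete hc
  refine ⟨retractL2 hC hq hqC x, ?_⟩
  have h2 := ((retractL2 (ν := ν) hC hq hqC).continuous.tendsto x).comp hx
  refine h2.congr fun i => ?_
  rw [← hg i]
  refine retractL2_toLp hC hq hqC (MemLp.coeFn_toLp _) fun z => ?_
  exact (hqj z _).symm

/-- A jointly continuous family of sections over a compact base is continuous in `L²`. -/
theorem continuous_toL2 [IsFiniteMeasure ν] {Y : Type*} [TopologicalSpace Y]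
    (s : Y → h.SqIntegrable ν)
    (hs : Continuous fun y : Y × Z => (⟨y.2, (s y.1).sec y.2⟩ : TotalSpace F V)) :
    Continuous fun y => (s y).toL2 := by
  obtain ⟨n, j, q, C, hC, hqj, hj, hq, hqC, hjC⟩ := h.exists_bounded_retraction
  have : ProperSpace (Fin n → F) := FiniteDimensional.proper ℂ _
  have : SecondCountableTopology (Fin n → F) := inferInstance
  -- Currying turns joint continuity into continuity of `Y → C(Z, Fin n → F)`; as `Z` is compact,
  -- this is continuity for uniform convergence, which implies continuity in `Lp`.
  let c : C(Y × Z, Fin n → F) := ⟨fun y => j y.2 ((s y.1).sec y.2), hj.comp hs⟩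
  have h1 : Continuous fun y => retractL2 (h := h) (ν := ν) hC hq hqC
      (ContinuousMap.toLp 2 ν ℂ (c.curry y)) :=
    (retractL2 hC hq hqC).continuous.comp
      ((ContinuousMap.toLp 2 ν ℂ).continuous.comp c.curry.continuous)
  refine h1.congr fun y => ?_
  exact retractL2_toLp hC hq hqC (ContinuousMap.coeFn_toLp ν _) fun z => (hqj z _).symm

/-- Continuous sections over a compact base are dense in `L²`. -/
theorem dense_continuous_sections (h : HermitianMetric F V) (ν : Measure Z) [IsFiniteMeasure ν]
    [ν.WeaklyRegular] :
    Dense {x : h.L2 ν | ∃ k : h.SqIntegrable ν,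
      (Continuous fun z => (⟨z, k.sec z⟩ : TotalSpace F V)) ∧ k.toL2 = x} := by
  obtain ⟨n, j, q, C, hC, hqj, hj, hq, hqC, hjC⟩ := h.exists_bounded_retraction
  have : ProperSpace (Fin n → F) := FiniteDimensional.proper ℂ _
  have : SecondCountableTopology (Fin n → F) := inferInstance
  have hsurj : Function.Surjective (retractL2 (h := h) (ν := ν) hC hq hqC) := by
    intro x
    obtain ⟨f, rfl⟩ := toL2_surjective x
    exact ⟨(memLp_inclusion hj hjC f).toLp _, retractL2_toLp hC hq hqC (MemLp.coeFn_toLp _)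
      fun z => (hqj z _).symm⟩
  -- The projection from `Lp` is continuous and onto, so it maps the dense set of continuous
  -- functions to a dense set, and `q` of a continuous function is a continuous section.
  have hd := hsurj.denseRange.comp (ContinuousMap.toLp_denseRange (Fin n → F) ν ℂ (p := 2) (by simp))
    (retractL2 (h := h) (ν := ν) hC hq hqC).continuous
  refine hd.mono ?_
  rintro _ ⟨c, rfl⟩
  have hm : MemLp c 2 ν := (Lp.memLp (ContinuousMap.toLp 2 ν ℂ c)).ae_eq
    (ContinuousMap.coeFn_toLp ν c)
  refine ⟨⟨_, retraction_mem (h := h) hq hqC hm⟩, ?_, ?_⟩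
  · exact hq.comp (continuous_id.prodMk c.continuous)
  · exact (retractL2_toLp hC hq hqC (ContinuousMap.coeFn_toLp ν c) fun z => rfl).symm

end HermitianMetric

end Compact

/-! ## Positive square roots of hermitian forms -/

section SqrtForm

variable {W : Type*} [AddCommGroup W] [Module ℂ W]

/-- A positive definite hermitian form. -/
structure IsPosDefForm (a : W →ₗ⋆[ℂ] W →ₗ[ℂ] ℂ) : Prop where
  conj_symm : ∀ v w, conj (a w v) = a v w
  pos : ∀ v, v ≠ 0 → 0 < (a v v).re

/-- `S` is the positive square root of the endomorphism `A` such that `b v w = a (A v) w`. -/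
structure IsSqrtForm (a b : W →ₗ⋆[ℂ] W →ₗ[ℂ] ℂ) (S : W →ₗ[ℂ] W) : Prop where
  symm : ∀ v w, a (S v) w = a v (S w)
  nonneg : ∀ v, 0 ≤ (a (S v) v).re
  sq : ∀ v w, b v w = a (S (S v)) w

variable {a b : W →ₗ⋆[ℂ] W →ₗ[ℂ] ℂ}

theorem IsPosDefForm.eq_of_forall (ha : IsPosDefForm a) {v w : W} (h : ∀ x, a v x = a w x) :
    v = w := by
  by_contra hne
  have := ha.pos (v - w) (sub_ne_zero.2 hne)
  have h0 : a (v - w) = 0 := by rw [map_sub, LinearMap.ext h, sub_self]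
  simp [h0] at this

/-- The inner product space structure defined by a positive definite form. -/
@[reducible] noncomputable def IsPosDefForm.core (ha : IsPosDefForm a) :
    InnerProductSpace.Core ℂ W where
  inner v w := a v w
  conj_inner_symm v w := ha.conj_symm v w
  re_inner_nonneg v := by
    by_cases hv : v = 0
    · simp [hv]
    · exact (ha.pos v hv).le
  add_left u v w := by simp
  smul_left v w c := by simp
  definite v hv := by
    by_contra hne
    have := ha.pos v hne
    rw [hv] at this
    simp at this

/-- The spectral theorem for the inner product given by `a`. The conclusion mentions only the form,
so that no norm on `W` survives to conflict with other structures. -/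
theorem IsPosDefForm.exists_eigenbasis [FiniteDimensional ℂ W] (ha : IsPosDefForm a)
    (T : W →ₗ[ℂ] W) (hT : ∀ v w, a (T v) w = a v (T w)) :
    ∃ (e : Module.Basis (Fin (Module.finrank ℂ W)) ℂ W) (c : Fin (Module.finrank ℂ W) → ℝ),
      (∀ i k, a (e i) (e k) = if i = k then 1 else 0) ∧ ∀ i, T (e i) = (c i : ℂ) • e i := by
  let _ : NormedAddCommGroup W := ha.core.toNormedAddCommGroup
  let _ : InnerProductSpace ℂ W := InnerProductSpace.ofCore ha.core.toCore
  have hs : T.IsSymmetric := hT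
  refine ⟨(hs.eigenvectorBasis rfl).toBasis, hs.eigenvalues rfl, fun i k => ?_, fun i => ?_⟩
  · rw [OrthonormalBasis.coe_toBasis]
    exact (orthonormal_iff_ite.1 (hs.eigenvectorBasis rfl).orthonormal) i k
  · rw [OrthonormalBasis.coe_toBasis]
    exact hs.apply_eigenvectorBasis rfl i

/-- Let `e` be an eigenvector of `S'` with eigenvalue `c > 0`. Since `S² e = c² e`, the vector `w =
S e - c e` satisfies `S w = -c w`, which contradicts the positivity of `S` unless `w = 0`. -/
theorem IsSqrtForm.unique [FiniteDimensional ℂ W] (ha : IsPosDefForm a) (hb : IsPosDefForm b)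
    {S S' : W →ₗ[ℂ] W} (hS : IsSqrtForm a b S) (hS' : IsSqrtForm a b S') : S = S' := by
  obtain ⟨e, c, he, hc⟩ := ha.exists_eigenbasis S' hS'.symm
  refine e.ext fun i => ?_
  have hsq : S (S (e i)) = S' (S' (e i)) :=
    ha.eq_of_forall fun x => by rw [← hS.sq, hS'.sq]
  have hne : e i ≠ 0 := e.ne_zero i
  have hc0 : 0 ≤ c i := by
    have := hS'.nonneg (e i)
    simpa [-Complex.coe_smul, hc, he] using this
  -- A zero eigenvalue would make `b` degenerate on `e i`.
  have hcpos : 0 < c i := by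
    refine lt_of_le_of_ne hc0 fun h0 => ?_
    have := hb.pos (e i) hne
    rw [hS'.sq, hc, ← h0] at this
    simp at this
  set w := S (e i) - (c i : ℂ) • e i with hw
  have h1 : S w = -((c i : ℂ) • w) := by
    rw [hw, map_sub, map_smul, hsq, hc, map_smul, hc, smul_sub]
    abel
  have h2 := hS.nonneg w
  rw [h1] at h2
  by_contra hne'
  have hw0 : w ≠ 0 := fun h => hne' (by rw [hc]; exact sub_eq_zero.1 h)
  have h3 := ha.pos w hw0
  simp [-Complex.coe_smul] at h2
  nlinarith

/-- The endomorphism `A` representing `b` with respect to `a` is symmetric with nonnegative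
eigenvalues; take the square roots of these in an orthonormal eigenbasis. -/
theorem IsPosDefForm.exists_sqrt [FiniteDimensional ℂ W] (ha : IsPosDefForm a)
    (hb : IsPosDefForm b) : ∃ S : W →ₗ[ℂ] W, IsSqrtForm a b S := by
  -- The zero operator is diagonalized only to obtain an `a`-orthonormal basis.
  obtain ⟨e, -, he, -⟩ := ha.exists_eigenbasis 0 (by simp)
  have hsum : ∀ w, w = ∑ i, a (e i) w • e i := by
    intro w
    have h1 : ∀ i, a (e i) w = e.repr w i := by
      intro i
      have := congrArg (a (e i)) (e.sum_repr w)
      rw [← this, map_sum]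
      simp only [map_smul, he, smul_eq_mul, mul_ite, mul_one, mul_zero, Finset.sum_ite_eq,
        Finset.mem_univ, if_true]
    simp_rw [h1]
    exact (e.sum_repr w).symm
  let A : W →ₗ[ℂ] W := 
    { toFun := fun v => ∑ i, b (e i) v • e i
      map_add' := fun v w => by simp [add_smul, Finset.sum_add_distrib]
      map_smul' := fun c v => by simp [Finset.smul_sum, smul_smul] }
  have hA : ∀ v w, a (A v) w = b v w := by
    intro v w
    conv_rhs => rw [hsum w]
    simp only [A, LinearMap.coe_mk, AddHom.coe_mk, map_sum, LinearMap.map_smulₛₗ,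
      LinearMap.sum_apply, LinearMap.smul_apply, map_smul, smul_eq_mul, hb.conj_symm]
    exact Finset.sum_congr rfl fun i _ => mul_comm _ _
  have hAs : ∀ v w, a (A v) w = a v (A w) := by
    intro v w
    rw [hA, ← ha.conj_symm, hA, hb.conj_symm]
  obtain ⟨f, c, hf, hc⟩ := ha.exists_eigenbasis A hAs
  have hc0 : ∀ i, 0 ≤ c i := by
    intro i
    have := (hb.pos (f i) (f.ne_zero i)).le
    rw [← hA, hc] at this
    simpa [-Complex.coe_smul, hf] using this
  -- Operators that are diagonal in the basis `f`; `d ↦ R d` is multiplicative and has symmetric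
  -- values.
  let R : (Fin (Module.finrank ℂ W) → ℝ) → W →ₗ[ℂ] W := fun d =>
    f.constr ℂ fun i => (d i : ℂ) • f i
  have hR : ∀ d i, R d (f i) = (d i : ℂ) • f i := fun d i => f.constr_basis ℂ _ i
  have hRR : ∀ d d' v, R d (R d' v) = R (d * d') v := by
    intro d d' v
    have : R d ∘ₗ R d' = R (d * d') := f.ext fun i => by
      simp [-Complex.coe_smul, hR, smul_smul, mul_comm]
    exact LinearMap.congr_fun this v
  have hRs : ∀ d v w, a (R d v) w = a v (R d w) := by
    intro d v w
    have h1 : a.comp (R d) = (LinearMap.lcomp ℂ ℂ (R d)).comp a := by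
      refine f.ext fun i => f.ext fun k => ?_
      simp only [LinearMap.comp_apply, hR, LinearMap.lcomp_apply, map_smul, LinearMap.map_smulₛₗ,
        LinearMap.smul_apply, hf]
      by_cases hik : i = k <;> simp [hik]
    exact LinearMap.congr_fun (LinearMap.congr_fun h1 v) w
  refine ⟨R fun i => √ (c i), hRs _, fun v => ?_, fun v w => ?_⟩
  · have h1 : (fun i => √ (c i)) = (fun i => √ (√ (c i))) * fun i => √ (√ (c i)) := by
      ext i
      simp [Real.mul_self_sqrt]
    rw [h1, ← hRR, hRs]
    by_cases h0 : R (fun i => √ (√ (c i))) v = 0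
    · simp [h0]
    · exact (ha.pos _ h0).le
  · rw [hRR, ← hA]
    congr 2
    refine LinearMap.congr_fun (f.ext fun i => ?_) v
    rw [hR, hc]
    simp [Real.mul_self_sqrt (hc0 i)]

theorem IsSqrtForm.injective (hb : IsPosDefForm b) {S : W →ₗ[ℂ] W} (hS : IsSqrtForm a b S) :
    Function.Injective S := by
  refine (injective_iff_map_eq_zero S).2 fun v hv => ?_
  by_contra hne
  have := hb.pos v hne
  rw [hS.sq, hv] at this
  simp at this

/-- The inverse of the square root of `b` with respect to `a` is the square root of `a` with respect
to `b`. -/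
theorem IsSqrtForm.inverse {S : W →ₗ[ℂ] W} (hS : IsSqrtForm a b S) {R : W →ₗ[ℂ] W}
    (hSR : ∀ v, S (R v) = v) : IsSqrtForm b a R where
  symm v w := by rw [hS.sq, hS.sq, hSR, hS.symm, hS.symm, hSR, hS.symm]
  nonneg v := by
    rw [hS.sq, hSR]
    exact hS.nonneg v
  sq v w := by rw [hS.sq, hSR, hSR]

end SqrtForm

/-! ### Continuous dependence of the positive square root on the two forms. -/

section Continuity

variable {Y : Type*} [TopologicalSpace Y] {F : Type*} [NormedAddCommGroup F] [NormedSpace ℂ F]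
  {a b : Y → F →ₗ⋆[ℂ] F →ₗ[ℂ] ℂ}

/-- Polarization recovers the real part of the form from its squared norms, and replacing the second
vector `w` by `i w` then recovers the imaginary part. -/
theorem IsPosDefForm.continuous_polarization (ha : ∀ y, IsPosDefForm (a y))
    (hc : Continuous fun x : Y × F => (a x.1 x.2 x.2).re) :
    Continuous fun x : Y × F × F => a x.1 x.2.1 x.2.2 := by
  have key : Continuous fun x : Y × F × F => (a x.1 x.2.1 x.2.2).re := by
    have h1 : Continuous fun x : Y × F × F =>
        (1 / 4 : ℝ) * ((a x.1 (x.2.1 + x.2.2) (x.2.1 + x.2.2)).re -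
          (a x.1 (x.2.1 - x.2.2) (x.2.1 - x.2.2)).re) := by
      refine continuous_const.mul (Continuous.sub ?_ ?_)
      · exact hc.comp (g := fun x : Y × F => (a x.1 x.2 x.2).re)
          (f := fun x : Y × F × F => (x.1, x.2.1 + x.2.2)) (by fun_prop)
      · exact hc.comp (g := fun x : Y × F => (a x.1 x.2 x.2).re)
          (f := fun x : Y × F × F => (x.1, x.2.1 - x.2.2)) (by fun_prop)
    refine h1.congr fun x => ?_
    have := congrArg Complex.re ((ha x.1).conj_symm x.2.1 x.2.2)
    rw [Complex.conj_re] at this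
    simp [this]
    ring
  have key2 : Continuous fun x : Y × F × F => (a x.1 x.2.1 (Complex.I • x.2.2)).re :=
    key.comp (g := fun x : Y × F × F => (a x.1 x.2.1 x.2.2).re)
      (f := fun x : Y × F × F => (x.1, x.2.1, Complex.I • x.2.2)) (by fun_prop)
  have h2 : Continuous fun x : Y × F × F => ((a x.1 x.2.1 x.2.2).re : ℂ) -
      ((a x.1 x.2.1 (Complex.I • x.2.2)).re : ℂ) * Complex.I := by fun_prop
  refine h2.congr fun x => ?_
  apply Complex.ext <;> simp

theorem re_form_smul (f : F →ₗ⋆[ℂ] F →ₗ[ℂ] ℂ) (t : ℝ) (v : F) :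
    (f ((t : ℂ) • v) ((t : ℂ) • v)).re = t ^ 2 * (f v v).re := by
  simp only [map_smul, LinearMap.map_smulₛₗ, LinearMap.smul_apply, smul_eq_mul,
    Complex.conj_ofReal, Complex.re_ofReal_mul]
  ring

theorem exists_unit_smul {v : F} (hv : v ≠ 0) :
    ∃ w : F, ‖w‖ = 1 ∧ v = ((‖v‖ : ℝ) : ℂ) • w := by
  refine ⟨((‖v‖⁻¹ : ℝ) : ℂ) • v, ?_, ?_⟩
  · rw [norm_smul, Complex.norm_real, norm_inv, norm_norm, inv_mul_cancel₀ (norm_ne_zero_iff.2 hv)]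
  · rw [smul_smul, ← Complex.ofReal_mul, mul_inv_cancel₀ (norm_ne_zero_iff.2 hv)]
    simp

variable [FiniteDimensional ℂ F]

/-- The identity `a (S v) (S v) = b v v` bounds the operators `S y` near `y₀`. Bounded sets are
relatively compact, any limit along an ultrafilter is again a positive square root at `y₀` because
the defining relations are closed, and by uniqueness that limit is `S y₀`. -/
theorem IsSqrtForm.continuous {S : Y → F →ₗ[ℂ] F} (ha : ∀ y, IsPosDefForm (a y))
    (hb : ∀ y, IsPosDefForm (b y)) (hac : Continuous fun x : Y × F => (a x.1 x.2 x.2).re)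
    (hbc : Continuous fun x : Y × F => (b x.1 x.2 x.2).re) (hS : ∀ y, IsSqrtForm (a y) (b y) (S y)) :
    Continuous fun x : Y × F => S x.1 x.2 := by
  have : ProperSpace F := FiniteDimensional.proper ℂ F
  have : ProperSpace (F →L[ℂ] F) := FiniteDimensional.proper ℂ _
  have hA := IsPosDefForm.continuous_polarization ha hac
  have hB := IsPosDefForm.continuous_polarization hb hbc
  let T : Y → F →L[ℂ] F := fun y => LinearMap.toContinuousLinearMap (S y)
  suffices hT : Continuous T from
    ((hT.comp continuous_fst).clm_apply continuous_snd).congr fun x => rfl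
  rw [continuous_iff_continuousAt]
  intro y₀
  have hsph : IsCompact (Metric.sphere (0 : F) 1) := isCompact_sphere _ _
  obtain ⟨c, hc, hca⟩ : ∃ c > 0, ∀ᶠ y in 𝓝 y₀, ∀ v ∈ Metric.sphere (0 : F) 1,
      c < (a y v v).re := by
    have h0 : ContinuousOn (fun v => ((a y₀ v v).re)⁻¹) (Metric.sphere (0 : F) 1) := by
      refine ContinuousOn.inv₀ (hac.comp (g := fun x : Y × F => (a x.1 x.2 x.2).re)
        (f := fun v => (y₀, v)) (by fun_prop)).continuousOn fun v hv => ?_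
      exact ((ha y₀).pos v (fun h => by simp [h] at hv)).ne'
    obtain ⟨C, hC⟩ := hsph.bddAbove_image h0
    -- `C` bounds `1 / a y₀` on the unit sphere, so `a y₀` strictly exceeds `1 / (|C| + 1)` there;
    -- compactness of the sphere extends this to `y` near `y₀`.
    refine ⟨(|C| + 1)⁻¹, by positivity, ?_⟩
    refine hsph.eventually_forall_of_forall_eventually fun v hv => ?_
    refine hac.continuousAt.eventually (lt_mem_nhds ?_)
    have h1 := hC ⟨v, hv, rfl⟩
    have h2 := (ha y₀).pos v (fun h => by simp [h] at hv)
    rw [inv_lt_comm₀ (by positivity) h2]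
    exact h1.trans_lt ((le_abs_self C).trans_lt (by linarith))
  obtain ⟨C, hC, hCb⟩ : ∃ C > 0, ∀ᶠ y in 𝓝 y₀, ∀ v ∈ Metric.sphere (0 : F) 1,
      (b y v v).re < C := by
    have h0 : ContinuousOn (fun v => (b y₀ v v).re) (Metric.sphere (0 : F) 1) :=
      (hbc.comp (g := fun x : Y × F => (b x.1 x.2 x.2).re)
        (f := fun v => (y₀, v)) (by fun_prop)).continuousOn
    obtain ⟨C, hC⟩ := hsph.bddAbove_image h0
    refine ⟨|C| + 1, by positivity, ?_⟩
    refine hsph.eventually_forall_of_forall_eventually fun v hv => ?_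
    refine hbc.continuousAt.eventually (gt_mem_nhds ?_)
    exact (hC ⟨v, hv, rfl⟩).trans_lt ((le_abs_self C).trans_lt (by linarith))
  -- From `c ‖S v‖² ≤ a (S v) (S v) = b v v ≤ C ‖v‖²`.
  have hbd : ∀ᶠ y in 𝓝 y₀, T y ∈ Metric.closedBall (0 : F →L[ℂ] F) (√ (C / c)) := by
    filter_upwards [hca, hCb] with y h1 h2
    rw [mem_closedBall_zero_iff]
    refine ContinuousLinearMap.opNorm_le_bound _ (by positivity) fun v => ?_
    refine le_of_sq_le_sq ?_ (by positivity)
    rw [mul_pow, Real.sq_sqrt (by positivity)]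
    change ‖S y v‖ ^ 2 ≤ _
    by_cases hv : v = 0
    · simp [hv]
    have hSv : S y v ≠ 0 := fun h => hv ((hS y).injective (hb y) (by rw [h, map_zero]))
    obtain ⟨w, hw, hvw⟩ := exists_unit_smul hv
    obtain ⟨w', hw', hvw'⟩ := exists_unit_smul hSv
    have e1 : (b y v v).re = (a y (S y v) (S y v)).re := by rw [(hS y).sq, (hS y).symm]
    rw [hvw', hvw, re_form_smul, re_form_smul, ← hvw] at e1
    have h3 := h1 w' (by simpa using hw')
    have h4 := h2 w (by simpa using hw)
    rw [div_mul_eq_mul_div, le_div_iff₀ hc]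
    nlinarith [sq_nonneg ‖S y v‖, sq_nonneg ‖v‖]
  rw [ContinuousAt, Filter.tendsto_iff_ultrafilter]
  intro u hu
  obtain ⟨T', -, hT'⟩ := (isCompact_closedBall (0 : F →L[ℂ] F) (√ (C / c))).ultrafilter_le_nhds
    (u.map T) (by
      rw [Ultrafilter.coe_map, Filter.le_principal_iff]
      exact hu hbd)
  have hlim : Filter.Tendsto T u (𝓝 T') := hT'
  have hy : Filter.Tendsto (fun y : Y => y) u (𝓝 y₀) := hu
  have hev : ∀ v, Filter.Tendsto (fun y => S y v) u (𝓝 (T' v)) := fun v =>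
    ((ContinuousLinearMap.apply ℂ F v).continuous.tendsto T').comp hlim
  have hev2 : ∀ v, Filter.Tendsto (fun y => S y (S y v)) u (𝓝 (T' (T' v))) := fun v =>
    ((isBoundedBilinearMap_apply (𝕜 := ℂ) (E := F) (F := F)).continuous.tendsto (T', T' v)).comp
      (hlim.prodMk_nhds (hev v))
  have hAlim : ∀ {f g : Y → F} {v w : F}, Filter.Tendsto f u (𝓝 v) → Filter.Tendsto g u (𝓝 w) →
      Filter.Tendsto (fun y => a y (f y) (g y)) u (𝓝 (a y₀ v w)) := fun {f g v w} hf hg =>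
    (hA.tendsto (y₀, v, w)).comp (hy.prodMk_nhds (hf.prodMk_nhds hg))
  have hBlim : ∀ v w, Filter.Tendsto (fun y => b y v w) u (𝓝 (b y₀ v w)) := fun v w =>
    (hB.tendsto (y₀, v, w)).comp
      (hy.prodMk_nhds (tendsto_const_nhds.prodMk_nhds tendsto_const_nhds))
  -- Each relation for `S y` passes to the limit along `u`.
  have hsq : IsSqrtForm (a y₀) (b y₀) (T' : F →ₗ[ℂ] F) := by
    refine ⟨fun v w => ?_, fun v => ?_, fun v w => ?_⟩
    · refine tendsto_nhds_unique (hAlim (hev v) tendsto_const_nhds) ?_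
      refine (hAlim tendsto_const_nhds (hev w)).congr fun y => ?_
      exact ((hS y).symm v w).symm
    · refine ge_of_tendsto ((Complex.continuous_re.tendsto _).comp
        (hAlim (hev v) tendsto_const_nhds)) (.of_forall fun y => ?_)
      exact (hS y).nonneg v
    · refine tendsto_nhds_unique (hBlim v w) ?_
      refine (hAlim (hev2 v) tendsto_const_nhds).congr fun y => ?_
      exact ((hS y).sq v w).symm
  have heq : T y₀ = T' := by
    ext v
    exact LinearMap.congr_fun (IsSqrtForm.unique (ha y₀) (hb y₀) (hS y₀) hsq) v
  rw [heq]
  exact hlim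

end Continuity

/-! ## Gram matrices of vertical vectors -/

section Gram

variable {dX dM j : ℕ} {M X : Type*}
  [TopologicalSpace M] [ChartedSpace (EuclideanSpace ℝ (Fin dM)) M]
  [TopologicalSpace X] [ChartedSpace (EuclideanSpace ℝ (Fin dX)) X] {p : X → M}
  [IsManifold (𝓡 dX) ∞ X]

/-- The tangent vector to a fibre given by its coordinates. -/
noncomputable def vertVec (dM : ℕ) {dX : ℕ} {M X : Type*}
    [TopologicalSpace M] [ChartedSpace (EuclideanSpace ℝ (Fin dM)) M]
    [TopologicalSpace X] [ChartedSpace (EuclideanSpace ℝ (Fin dX)) X] (p : X → M) (x : X)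
    (v : EuclideanSpace ℝ (Fin dX)) : VertTangent dX dM p x :=
  toVert dX dM p x v

/-- The differential of `p` as a map of coordinate spaces. -/
noncomputable def projDeriv (dM : ℕ) {dX : ℕ} {M X : Type*}
    [TopologicalSpace M] [ChartedSpace (EuclideanSpace ℝ (Fin dM)) M]
    [TopologicalSpace X] [ChartedSpace (EuclideanSpace ℝ (Fin dX)) X] (p : X → M) (x : X) :
    EuclideanSpace ℝ (Fin dX) →L[ℝ] EuclideanSpace ℝ (Fin dM) :=
  mfderiv (𝓡 dX) (𝓡 dM) p x

/-- The inclusion of the vertical tangent space into the coordinate space. -/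
noncomputable def vertIncl (dM : ℕ) {dX : ℕ} {M X : Type*}
    [TopologicalSpace M] [ChartedSpace (EuclideanSpace ℝ (Fin dM)) M]
    [TopologicalSpace X] [ChartedSpace (EuclideanSpace ℝ (Fin dX)) X] (p : X → M) (x : X) :
    VertTangent dX dM p x →ₗ[ℝ] EuclideanSpace ℝ (Fin dX) :=
  (VertTangent dX dM p x).subtype

/-- The Gram matrix of a family of tangent vectors at `x`. -/
noncomputable def VerticalMetric.gramAt (m : VerticalMetric dX dM p) (x : X)
    (l : Fin j → EuclideanSpace ℝ (Fin dX)) : Matrix (Fin j) (Fin j) ℂ :=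
  Matrix.of fun a b => m.form x (1 ⊗ₜ vertVec dM p x (l a)) (1 ⊗ₜ vertVec dM p x (l b))

/-- The square root of the absolute value of the Gram determinant. -/
noncomputable def VerticalMetric.gramVol (m : VerticalMetric dX dM p) (x : X)
    (l : Fin j → EuclideanSpace ℝ (Fin dX)) : ℝ := √ ‖(m.gramAt x l).det‖

/-- The coordinate vectors of a map from `ℝʲ` to `X`. -/
noncomputable def coordVec (dX : ℕ) {X : Type*} [TopologicalSpace X]
    [ChartedSpace (EuclideanSpace ℝ (Fin dX)) X] (ψ : EuclideanSpace ℝ (Fin j) → X)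
    (w : EuclideanSpace ℝ (Fin j)) (a : Fin j) : EuclideanSpace ℝ (Fin dX) :=
  mfderiv (𝓡 j) (𝓡 dX) ψ w (EuclideanSpace.single a (1 : ℝ))

theorem vertIncl_injective (x : X) :
    Function.Injective (vertIncl dM (dX := dX) p x) :=
  Subtype.val_injective

theorem vertIncl_vertVec {x : X} {v : EuclideanSpace ℝ (Fin dX)} (hv : projDeriv dM p x v = 0) :
    vertIncl dM p x (vertVec dM p x v) = v := by
  have h1 : toVert dX dM p x v = ⟨v, hv⟩ := dif_pos hv
  exact congrArg Subtype.val h1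

/-- The map `toVert` sends non-vertical vectors to `0` and is therefore linear only on vertical
ones, whence the hypothesis on `l`. -/
theorem vertVec_sum {x : X} {l : Fin j → EuclideanSpace ℝ (Fin dX)}
    (hl : ∀ c, projDeriv dM p x (l c) = 0) (J : Fin j → ℝ) :
    vertVec dM p x (∑ c, J c • l c) = ∑ c, J c • vertVec dM p x (l c) := by
  refine vertIncl_injective x ?_
  rw [vertIncl_vertVec (by simp [hl]), map_sum]
  refine Finset.sum_congr rfl fun c _ => ?_
  rw [map_smul, vertIncl_vertVec (hl c)]

/-- The congruence `Jᵀ G J`; since `J` is real, conjugate linearity in the first variable leaves no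
trace. -/
theorem VerticalMetric.gramAt_linear (m : VerticalMetric dX dM p) {x : X}
    {l l' : Fin j → EuclideanSpace ℝ (Fin dX)}
    (hl : ∀ c, projDeriv dM p x (l c) = 0) (J : Matrix (Fin j) (Fin j) ℝ)
    (hJ : ∀ a, l' a = ∑ c, J c a • l c) :
    m.gramAt x l' = (J.map Complex.ofReal).transpose * m.gramAt x l * J.map Complex.ofReal := by
  ext a b
  have h1 : ∀ a, (1 : ℂ) ⊗ₜ[ℝ] vertVec dM p x (l' a) =
      ∑ c, (J c a : ℂ) • ((1 : ℂ) ⊗ₜ[ℝ] vertVec dM p x (l c)) := by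
    intro a
    rw [hJ, vertVec_sum hl, TensorProduct.tmul_sum]
    refine Finset.sum_congr rfl fun c _ => ?_
    rw [TensorProduct.tmul_smul, ← algebraMap_smul ℂ (J c a)]
    rfl
  simp only [gramAt, Matrix.of_apply, h1, Matrix.mul_apply, Matrix.transpose_apply, Matrix.map_apply,
    map_sum, LinearMap.map_smulₛₗ, map_smul, LinearMap.sum_apply, LinearMap.smul_apply, smul_eq_mul,
    Complex.conj_ofReal, Finset.sum_mul, Finset.mul_sum]
  refine Finset.sum_congr rfl fun c _ => Finset.sum_congr rfl fun d _ => ?_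
  ring

/-- The determinant of `Jᵀ G J` is `(det J)² det G`; this matches the Jacobian factor in the change
of variables formula. -/
theorem VerticalMetric.gramVol_linear (m : VerticalMetric dX dM p) {x : X}
    {l l' : Fin j → EuclideanSpace ℝ (Fin dX)}
    (hl : ∀ c, projDeriv dM p x (l c) = 0) (J : Matrix (Fin j) (Fin j) ℝ)
    (hJ : ∀ a, l' a = ∑ c, J c a • l c) :
    m.gramVol x l' = |J.det| * m.gramVol x l := by
  rw [gramVol, gramVol, m.gramAt_linear hl J hJ, Matrix.det_mul, Matrix.det_mul,
    Matrix.det_transpose]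
  have h1 : (J.map Complex.ofReal).det = (J.det : ℂ) := by
    exact (RingHom.map_det Complex.ofRealHom J).symm
  rw [h1, norm_mul, norm_mul, Complex.norm_real, Real.norm_eq_abs, mul_comm |J.det|, mul_assoc,
    abs_mul_abs_self, Real.sqrt_mul (norm_nonneg _), Real.sqrt_mul_self_eq_abs, mul_comm]

/-- A null vector of the Gram matrix would give a combination `W` of the vectors with `⟨W, W⟩ = 0`,
hence `W = 0`. -/
theorem VerticalMetric.gramVol_pos (m : VerticalMetric dX dM p) {x : X}
    {l : Fin j → EuclideanSpace ℝ (Fin dX)}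
    (hl : ∀ c, projDeriv dM p x (l c) = 0) (hi : LinearIndependent ℝ l) :
    0 < m.gramVol x l := by
  refine Real.sqrt_pos.2 (norm_pos_iff.2 fun hdet => ?_)
  obtain ⟨v, hv, hMv⟩ := Matrix.exists_mulVec_eq_zero_iff.2 hdet
  have hli : LinearIndependent ℝ fun c => vertVec dM p x (l c) := by
    refine LinearIndependent.of_comp (vertIncl dM p x) ?_
    convert! hi using 1
    ext1 c
    exact vertIncl_vertVec (hl c)
  -- The null vector has complex coefficients, so independence is needed in the complexification.
  have hliC := Module.Flat.linearIndependent_one_tmul (S := ℂ) hli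
  set W := ∑ c, v c • ((1 : ℂ) ⊗ₜ[ℝ] vertVec dM p x (l c)) with hW
  have h0 : ∀ a, m.form x ((1 : ℂ) ⊗ₜ[ℝ] vertVec dM p x (l a)) W = 0 := by
    intro a
    have := congrFun hMv a
    rw [hW, map_sum]
    simp only [map_smul, smul_eq_mul]
    simp only [Matrix.mulVec, dotProduct, gramAt, Matrix.of_apply, Pi.zero_apply] at this
    rw [← this]
    exact Finset.sum_congr rfl fun c _ => mul_comm _ _
  have h1 : m.form x W W = 0 := by
    have h2 : m.form x W = ∑ c, conj (v c) •
        m.form x ((1 : ℂ) ⊗ₜ[ℝ] vertVec dM p x (l c)) := by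
      rw [hW, map_sum]
      exact Finset.sum_congr rfl fun c _ => LinearMap.map_smulₛₗ _ _ _
    rw [h2, LinearMap.sum_apply]
    refine Finset.sum_eq_zero fun c _ => ?_
    rw [LinearMap.smul_apply, h0, smul_zero]
  have h2 : W = 0 := by
    by_contra hne
    have := m.pos x W hne
    rw [h1] at this
    simp at this
  refine hv (funext fun c => ?_)
  exact Fintype.linearIndependent_iff.1 hliC v h2 c

end Gram

/-! ## Parametrizations of the fibres from a smooth local trivialization -/

/-- A smooth local trivialization of a smooth map `p : X → M` with fibre `Z`. -/
structure SmoothTriv (dM dX dZ : ℕ) {M X Z : Type*}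
    [TopologicalSpace M] [ChartedSpace (EuclideanSpace ℝ (Fin dM)) M]
    [TopologicalSpace X] [ChartedSpace (EuclideanSpace ℝ (Fin dX)) X]
    [TopologicalSpace Z] [ChartedSpace (EuclideanSpace ℝ (Fin dZ)) Z] {p : X → M}
    (b : Trivialization Z p) : Prop where
  smooth_proj : ContMDiff (𝓡 dX) (𝓡 dM) ∞ p
  smooth : ContMDiffOn (𝓡 dX) ((𝓡 dM).prod (𝓡 dZ)) ∞ b b.source
  smooth_symm : ContMDiffOn ((𝓡 dM).prod (𝓡 dZ)) (𝓡 dX) ∞ b.toOpenPartialHomeomorph.symm b.target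

section Param

variable {dM dX dZ : ℕ} {M X Z : Type*}
  [TopologicalSpace M] [ChartedSpace (EuclideanSpace ℝ (Fin dM)) M]
  [TopologicalSpace X] [ChartedSpace (EuclideanSpace ℝ (Fin dX)) X]
  [TopologicalSpace Z] [ChartedSpace (EuclideanSpace ℝ (Fin dZ)) Z] {p : X → M}
  [IsManifold (𝓡 dM) ∞ M] [IsManifold (𝓡 dX) ∞ X] [IsManifold (𝓡 dZ) ∞ Z]

/-- The parametrization `(u, w) ↦ x` of `X` given by a local trivialization and a chart of `Z`. -/
def trivParam (b : Trivialization Z p)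
    (e : OpenPartialHomeomorph Z (EuclideanSpace ℝ (Fin dZ)))
    (y : M × EuclideanSpace ℝ (Fin dZ)) : X :=
  b.toOpenPartialHomeomorph.symm (y.1, e.symm y.2)

/-- The coordinate of a point of `X` given by a local trivialization and a chart of `Z`. -/
def trivCoord (b : Trivialization Z p)
    (e : OpenPartialHomeomorph Z (EuclideanSpace ℝ (Fin dZ))) (x : X) :
    EuclideanSpace ℝ (Fin dZ) := e (b x).2

/-- The domain of `trivCoord`. -/
def trivDomain (b : Trivialization Z p)
    (e : OpenPartialHomeomorph Z (EuclideanSpace ℝ (Fin dZ))) : Set X :=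
  b.source ∩ (fun x => (b x).2) ⁻¹' e.source

variable {b : Trivialization Z p} {e : OpenPartialHomeomorph Z (EuclideanSpace ℝ (Fin dZ))}

theorem isOpen_trivDomain : IsOpen (trivDomain b e) :=
  (continuous_snd.comp_continuousOn b.toOpenPartialHomeomorph.continuousOn).isOpen_inter_preimage
    (b.open_source) e.open_source

theorem trivParam_mem {u : M} (hu : u ∈ b.baseSet) {w : EuclideanSpace ℝ (Fin dZ)}
    (hw : w ∈ e.target) : trivParam b e (u, w) ∈ trivDomain b e := by
  have ht : (u, e.symm w) ∈ b.target := b.mem_target.2 hu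
  refine ⟨b.map_target ht, ?_⟩
  simp only [trivParam, mem_preimage]
  rw [b.apply_symm_apply ht]
  exact e.map_target hw

theorem proj_trivParam {u : M} (hu : u ∈ b.baseSet) {w : EuclideanSpace ℝ (Fin dZ)} :
    p (trivParam b e (u, w)) = u :=
  b.proj_symm_apply (b.mem_target.2 hu)

theorem trivCoord_trivParam {u : M} (hu : u ∈ b.baseSet) {w : EuclideanSpace ℝ (Fin dZ)}
    (hw : w ∈ e.target) : trivCoord b e (trivParam b e (u, w)) = w := by
  rw [trivCoord, trivParam, b.apply_symm_apply (b.mem_target.2 hu)]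
  exact e.right_inv hw

theorem trivParam_trivCoord {x : X} (hx : x ∈ trivDomain b e) :
    trivParam b e (p x, trivCoord b e x) = x := by
  rw [trivCoord, trivParam]
  simp only
  rw [e.left_inv hx.2, b.symm_apply_mk_proj hx.1]

theorem trivCoord_mem {x : X} (hx : x ∈ trivDomain b e) : trivCoord b e x ∈ e.target :=
  e.map_source hx.2

theorem proj_mem_of_mem_trivDomain {x : X} (hx : x ∈ trivDomain b e) : p x ∈ b.baseSet :=
  b.mem_source.1 hx.1

theorem SmoothTriv.contMDiffOn_trivParam (hb : SmoothTriv dM dX dZ b)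
    (he : e ∈ IsManifold.maximalAtlas (𝓡 dZ) ∞ Z) :
    ContMDiffOn ((𝓡 dM).prod (𝓡 dZ)) (𝓡 dX) ∞ (trivParam b e) (b.baseSet ×ˢ e.target) := by
  refine hb.smooth_symm.comp (t := b.target) (contMDiffOn_fst.prodMk
    ((contMDiffOn_symm_of_mem_maximalAtlas he).comp contMDiffOn_snd fun y hy => hy.2)) ?_
  intro y hy
  exact b.mem_target.2 hy.1

theorem SmoothTriv.contMDiffOn_trivCoord (hb : SmoothTriv dM dX dZ b)
    (he : e ∈ IsManifold.maximalAtlas (𝓡 dZ) ∞ Z) :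
    ContMDiffOn (𝓡 dX) (𝓡 dZ) ∞ (trivCoord b e) (trivDomain b e) :=
  (contMDiffOn_of_mem_maximalAtlas he).comp
    (contMDiffOn_snd.comp (t := univ) (hb.smooth.mono fun _ hx => hx.1) (fun _ _ => mem_univ _))
    fun _ hx => hx.2

theorem SmoothTriv.mdifferentiableAt_trivParam (hb : SmoothTriv dM dX dZ b)
    (he : e ∈ IsManifold.maximalAtlas (𝓡 dZ) ∞ Z) {u : M} (hu : u ∈ b.baseSet)
    {w : EuclideanSpace ℝ (Fin dZ)} (hw : w ∈ e.target) :
    MDifferentiableAt ((𝓡 dM).prod (𝓡 dZ)) (𝓡 dX) (trivParam b e) (u, w) :=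
  ((hb.contMDiffOn_trivParam he).contMDiffAt
    ((b.open_baseSet.prod e.open_target).mem_nhds ⟨hu, hw⟩)).mdifferentiableAt (by simp)

theorem SmoothTriv.mdifferentiableAt_trivCoord (hb : SmoothTriv dM dX dZ b)
    (he : e ∈ IsManifold.maximalAtlas (𝓡 dZ) ∞ Z) {x : X} (hx : x ∈ trivDomain b e) :
    MDifferentiableAt (𝓡 dX) (𝓡 dZ) (trivCoord b e) x :=
  ((hb.contMDiffOn_trivCoord he).contMDiffAt
    (isOpen_trivDomain.mem_nhds hx)).mdifferentiableAt (by simp)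

/-- The differential of the parametrization of a fibre. -/
theorem SmoothTriv.hasMFDerivAt_trivParam (hb : SmoothTriv dM dX dZ b)
    (he : e ∈ IsManifold.maximalAtlas (𝓡 dZ) ∞ Z) {u : M} (hu : u ∈ b.baseSet)
    {w : EuclideanSpace ℝ (Fin dZ)} (hw : w ∈ e.target) :
    HasMFDerivAt (𝓡 dZ) (𝓡 dX) (fun w => trivParam b e (u, w)) w
      ((mfderiv ((𝓡 dM).prod (𝓡 dZ)) (𝓡 dX) (trivParam b e) (u, w)).comp
        (ContinuousLinearMap.inr ℝ (TangentSpace (𝓡 dM) u) (TangentSpace (𝓡 dZ) w))) := by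
  have h1 := (hb.mdifferentiableAt_trivParam he hu hw).hasMFDerivAt
  have h2 : HasMFDerivAt (𝓡 dZ) ((𝓡 dM).prod (𝓡 dZ)) (fun w : EuclideanSpace ℝ (Fin dZ) => (u, w)) w
      (ContinuousLinearMap.inr ℝ (TangentSpace (𝓡 dM) u) (TangentSpace (𝓡 dZ) w)) := by
    have h3 : MDifferentiableAt (𝓡 dZ) ((𝓡 dM).prod (𝓡 dZ))
        (fun w : EuclideanSpace ℝ (Fin dZ) => (u, w)) w :=
      mdifferentiableAt_const.prodMk mdifferentiableAt_id
    have := h3.hasMFDerivAt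
    rwa [mfderiv_prod_right] at this
  exact h1.comp w h2

/-- The parametrization of an open subset of the fibre over `u` given by a local trivialization and
a chart of `Z`. -/
def SmoothTriv.param (hb : SmoothTriv dM dX dZ b)
    (he : e ∈ IsManifold.maximalAtlas (𝓡 dZ) ∞ Z) {u : M} (hu : u ∈ b.baseSet) : FibreParam dX dZ p u where
  dom := e.target
  isOpen_dom := e.open_target
  toFun w := trivParam b e (u, w)
  mem_fibre _ _ := proj_trivParam hu
  injOn w hw w' hw' hww' := by
    have := congrArg (trivCoord b e) hww'
    rwa [trivCoord_trivParam hu hw, trivCoord_trivParam hu hw'] at this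
  smooth := by
    refine (hb.contMDiffOn_trivParam he).comp (contMDiffOn_const.prodMk contMDiffOn_id) ?_
    exact fun w hw => ⟨hu, hw⟩
  immersion w hw := by
    have h1 := (hb.mdifferentiableAt_trivCoord he (trivParam_mem hu hw)).hasMFDerivAt
    have h2 := (hb.hasMFDerivAt_trivParam he hu hw).mdifferentiableAt.hasMFDerivAt
    have h3 := h1.comp w h2
    -- The fibre coordinate is a left inverse of the parametrization, so the differential of the
    -- latter has a left inverse.
    have h4 : HasMFDerivAt (𝓡 dZ) (𝓡 dZ) (trivCoord b e ∘ fun w => trivParam b e (u, w)) w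
        (ContinuousLinearMap.id ℝ (TangentSpace (𝓡 dZ) w)) := by
      refine (hasMFDerivAt_id w).congr_of_eventuallyEq ?_
      filter_upwards [e.open_target.mem_nhds hw] with w' hw'
      exact trivCoord_trivParam hu hw'
    have h5 := hasMFDerivAt_unique h3 h4
    intro v v' hv
    have h6 := congrArg (mfderiv (𝓡 dX) (𝓡 dZ) (trivCoord b e) (trivParam b e (u, w))) hv
    have h7 : ∀ v, mfderiv (𝓡 dX) (𝓡 dZ) (trivCoord b e) (trivParam b e (u, w))
        (mfderiv (𝓡 dZ) (𝓡 dX) (fun w => trivParam b e (u, w)) w v) = v :=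
      fun v => DFunLike.congr_fun h5 v
    exact (h7 v).symm.trans (h6.trans (h7 v'))

/-- Every vertical vector is tangent to the parametrization of the fibre. -/
theorem SmoothTriv.vertical_eq (hb : SmoothTriv dM dX dZ b)
    (he : e ∈ IsManifold.maximalAtlas (𝓡 dZ) ∞ Z) {x : X} (hx : x ∈ trivDomain b e) (v : TangentSpace (𝓡 dX) x)
    (hv : mfderiv (𝓡 dX) (𝓡 dM) p x v = 0) :
    (v : EuclideanSpace ℝ (Fin dX)) =
      mfderiv (𝓡 dZ) (𝓡 dX) (fun w => trivParam b e (p x, w)) (trivCoord b e x)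
        (mfderiv (𝓡 dX) (𝓡 dZ) (trivCoord b e) x v) := by
  have hp := (hb.smooth_proj.mdifferentiableAt (x := x) (by simp)).hasMFDerivAt
  have hc := (hb.mdifferentiableAt_trivCoord he hx).hasMFDerivAt
  have hu := proj_mem_of_mem_trivDomain hx
  have hw := trivCoord_mem hx
  have h1 := (hb.mdifferentiableAt_trivParam he hu hw).hasMFDerivAt
  have h2 := h1.comp x (hp.prodMk hc)
  -- The identity `x = trivParam (p x, trivCoord x)` is differentiated in the direction `v`; the
  -- first component contributes nothing because `dp v = 0`.
  have h3 : HasMFDerivAt (𝓡 dX) (𝓡 dX) (trivParam b e ∘ fun x => (p x, trivCoord b e x)) x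
      (ContinuousLinearMap.id ℝ (TangentSpace (𝓡 dX) x)) := by
    refine (hasMFDerivAt_id x).congr_of_eventuallyEq ?_
    filter_upwards [isOpen_trivDomain.mem_nhds hx] with x' hx'
    exact trivParam_trivCoord hx'
  have h4 := DFunLike.congr_fun (hasMFDerivAt_unique h3 h2) v
  rw [(hb.hasMFDerivAt_trivParam he hu hw).mfderiv]
  refine Eq.trans h4 ?_
  change mfderiv ((𝓡 dM).prod (𝓡 dZ)) (𝓡 dX) (trivParam b e) (p x, trivCoord b e x)
    (mfderiv (𝓡 dX) (𝓡 dM) p x v, mfderiv (𝓡 dX) (𝓡 dZ) (trivCoord b e) x v) = _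
  rw [hv]
  rfl

end Param

/-! ### Differentials of fibre parametrizations. -/

section FibreParamLemmas

variable {dM dX j : ℕ} {M X : Type*}
  [TopologicalSpace M] [ChartedSpace (EuclideanSpace ℝ (Fin dM)) M]
  [TopologicalSpace X] [ChartedSpace (EuclideanSpace ℝ (Fin dX)) X] {p : X → M}

theorem FibreParam.mdifferentiableAt {u : M} (ψ : FibreParam dX j p u)
    {w : EuclideanSpace ℝ (Fin j)} (hw : w ∈ ψ.dom) :
    MDifferentiableAt (𝓡 j) (𝓡 dX) ψ.toFun w :=
  (ψ.smooth.contMDiffAt (ψ.isOpen_dom.mem_nhds hw)).mdifferentiableAt (by simp)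

/-- The composite `p ∘ ψ` is constant on the domain. -/
theorem FibreParam.mfderiv_vertical (hp : ContMDiff (𝓡 dX) (𝓡 dM) ∞ p) {u : M}
    (ψ : FibreParam dX j p u) {w : EuclideanSpace ℝ (Fin j)} (hw : w ∈ ψ.dom)
    (v : TangentSpace (𝓡 j) w) :
    mfderiv (𝓡 dX) (𝓡 dM) p (ψ.toFun w) (mfderiv (𝓡 j) (𝓡 dX) ψ.toFun w v) = 0 := by
  have h1 := (hp.mdifferentiableAt (x := ψ.toFun w) (by simp)).hasMFDerivAt
  have h2 := h1.comp w (ψ.mdifferentiableAt hw).hasMFDerivAt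
  have h3 : HasMFDerivAt (𝓡 j) (𝓡 dM) (p ∘ ψ.toFun) w
      (0 : TangentSpace (𝓡 j) w →L[ℝ] TangentSpace (𝓡 dM) u) := by
    refine (hasMFDerivAt_const u w).congr_of_eventuallyEq ?_
    filter_upwards [ψ.isOpen_dom.mem_nhds hw] with w' hw'
    exact ψ.mem_fibre w' hw'
  exact DFunLike.congr_fun (hasMFDerivAt_unique h2 h3) v

theorem FibreParam.linearIndependent_coordVec {u : M} (ψ : FibreParam dX j p u)
    {w : EuclideanSpace ℝ (Fin j)} (hw : w ∈ ψ.dom) :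
    LinearIndependent ℝ (coordVec dX ψ.toFun w) := by
  have h1 := (EuclideanSpace.basisFun (Fin j) ℝ).toBasis.linearIndependent
  have h2 := h1.map' (mfderiv (𝓡 j) (𝓡 dX) ψ.toFun w).toLinearMap
    (LinearMap.ker_eq_bot.2 (ψ.immersion w hw))
  convert! h2 using 1
  ext1 a
  simp only [Function.comp_apply, OrthonormalBasis.coe_toBasis, EuclideanSpace.basisFun_apply]
  rfl

end FibreParamLemmas

/-! ### The fibre measure over a coordinate domain as a single local measure. -/

section ChangeOfVariables

variable {dM dX dZ : ℕ} {M X Z : Type*}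
  [TopologicalSpace M] [ChartedSpace (EuclideanSpace ℝ (Fin dM)) M]
  [TopologicalSpace X] [ChartedSpace (EuclideanSpace ℝ (Fin dX)) X]
  [TopologicalSpace Z] [ChartedSpace (EuclideanSpace ℝ (Fin dZ)) Z] {p : X → M}
  [IsManifold (𝓡 dM) ∞ M] [IsManifold (𝓡 dX) ∞ X] [IsManifold (𝓡 dZ) ∞ Z]
  [MeasurableSpace X] [BorelSpace X] (m : VerticalMetric dX dM p)

theorem FibreParam.measurableSet_preimage {u : M} (ψ : FibreParam dX dZ p u) {A : Set X}
    (hA : MeasurableSet A) : MeasurableSet (ψ.dom ∩ ψ.toFun ⁻¹' A) := by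
  classical
  rcases ψ.dom.eq_empty_or_nonempty with h0 | ⟨w₀, -⟩
  · simp [h0]
  have hm := ψ.smooth.continuousOn.measurable_piecewise (g := fun _ => ψ.toFun w₀)
    continuousOn_const ψ.isOpen_dom.measurableSet
  have h1 := ψ.isOpen_dom.measurableSet.inter (hm hA)
  convert! h1 using 1
  ext w
  refine and_congr_right fun hw => ?_
  rw [mem_preimage, mem_preimage, piecewise_eq_of_mem _ _ _ hw]

theorem VerticalMetric.localMeasure_apply {u : M} (ψ : FibreParam dX dZ p u) {A : Set X}
    (hA : MeasurableSet A) :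
    m.localMeasure ψ A = ∫⁻ w in ψ.dom ∩ ψ.toFun ⁻¹' A,
      ENNReal.ofReal (m.gramVol (ψ.toFun w) (coordVec dX ψ.toFun w)) := by
  have hd := ψ.isOpen_dom.measurableSet
  rw [localMeasure, ← restrict_withDensity hd,
    Measure.map_apply_of_aemeasurable (ψ.smooth.continuousOn.aemeasurable hd) hA,
    Measure.restrict_apply' hd, inter_comm, withDensity_apply _ (ψ.measurableSet_preimage hA)]
  rfl

/-- Change of coordinates in the measures on the fibres. -/
theorem VerticalMetric.gramVol_comp (hp : ContMDiff (𝓡 dX) (𝓡 dM) ∞ p) {u : M}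
    (ψ ψ₀ : FibreParam dX dZ p u) {κ : EuclideanSpace ℝ (Fin dZ) → EuclideanSpace ℝ (Fin dZ)}
    {w : EuclideanSpace ℝ (Fin dZ)} (hκ : DifferentiableAt ℝ κ w) (hw : κ w ∈ ψ₀.dom)
    (hψ : ∀ᶠ w' in 𝓝 w, ψ.toFun w' = ψ₀.toFun (κ w')) :
    m.gramVol (ψ.toFun w) (coordVec dX ψ.toFun w) = |(fderiv ℝ κ w).det| *
      m.gramVol (ψ₀.toFun (κ w)) (coordVec dX ψ₀.toFun (κ w)) := by
  let J : Matrix (Fin dZ) (Fin dZ) ℝ := LinearMap.toMatrix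
    (EuclideanSpace.basisFun (Fin dZ) ℝ).toBasis (EuclideanSpace.basisFun (Fin dZ) ℝ).toBasis
    (fderiv ℝ κ w).toLinearMap
  have hJ : J.det = (fderiv ℝ κ w).det := LinearMap.det_toMatrix _ _
  have h1 : HasMFDerivAt (𝓡 dZ) (𝓡 dX) (ψ₀.toFun ∘ κ) w
      ((mfderiv (𝓡 dZ) (𝓡 dX) ψ₀.toFun (κ w)).comp (fderiv ℝ κ w)) :=
    (ψ₀.mdifferentiableAt hw).hasMFDerivAt.comp w hκ.hasFDerivAt.hasMFDerivAt
  have h2 := (h1.congr_of_eventuallyEq hψ).mfderiv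
  have h3 : ∀ a, coordVec dX ψ.toFun w a = ∑ c, J c a • coordVec dX ψ₀.toFun (κ w) c := by
    intro a
    let L : EuclideanSpace ℝ (Fin dZ) →L[ℝ] EuclideanSpace ℝ (Fin dX) :=
      mfderiv (𝓡 dZ) (𝓡 dX) ψ₀.toFun (κ w)
    have e1 : coordVec dX ψ.toFun w a = L (fderiv ℝ κ w (EuclideanSpace.single a 1)) :=
      DFunLike.congr_fun h2 (EuclideanSpace.single a (1 : ℝ))
    have e2 : ∀ c, coordVec dX ψ₀.toFun (κ w) c = L (EuclideanSpace.single c 1) := fun c => rfl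
    have e3 : fderiv ℝ κ w (EuclideanSpace.single a 1) =
        ∑ c, J c a • EuclideanSpace.single c (1 : ℝ) := by
      have := (EuclideanSpace.basisFun (Fin dZ) ℝ).toBasis.sum_repr
        (fderiv ℝ κ w (EuclideanSpace.single a 1))
      rw [← this]
      refine Finset.sum_congr rfl fun c _ => ?_
      simp [J, LinearMap.toMatrix_apply]
    rw [e1, e3, map_sum]
    exact Finset.sum_congr rfl fun c _ => by rw [map_smul, e2]
  rw [hψ.self_of_nhds, m.gramVol_linear (l := coordVec dX ψ₀.toFun (κ w))
    (fun c => ψ₀.mfderiv_vertical hp hw _) J h3, hJ]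

variable {b : Trivialization Z p} {e : OpenPartialHomeomorph Z (EuclideanSpace ℝ (Fin dZ))}

/-- Change of variables along `κ`, the expression of `ψ` in the coordinates of the trivialization:
the Jacobian of `κ` is the factor by which the two Gram volumes differ. Only an inequality holds,
since the image of `ψ` need not be the whole coordinate domain. -/
theorem VerticalMetric.localMeasure_restrict_le (hb : SmoothTriv dM dX dZ b)
    (he : e ∈ IsManifold.maximalAtlas (𝓡 dZ) ∞ Z) {u : M} (hu : u ∈ b.baseSet)
    (ψ : FibreParam dX dZ p u) :
    (m.localMeasure ψ).restrict (trivDomain b e) ≤ m.localMeasure (hb.param he hu) := by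
  refine Measure.le_iff.2 fun A hA => ?_
  have hD : MeasurableSet (trivDomain b e) := isOpen_trivDomain.measurableSet
  rw [Measure.restrict_apply hA, m.localMeasure_apply ψ (hA.inter hD), m.localMeasure_apply _ hA]
  set S := ψ.dom ∩ ψ.toFun ⁻¹' (A ∩ trivDomain b e) with hS
  set κ : EuclideanSpace ℝ (Fin dZ) → EuclideanSpace ℝ (Fin dZ) :=
    fun w => trivCoord b e (ψ.toFun w) with hκ
  have hSm : MeasurableSet S := ψ.measurableSet_preimage (hA.inter hD)
  have hrec : ∀ w ∈ ψ.dom, ψ.toFun w ∈ trivDomain b e →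
      ψ.toFun w = trivParam b e (u, κ w) := by
    intro w hw hw'
    have := trivParam_trivCoord hw'
    rw [ψ.mem_fibre w hw] at this
    exact this.symm
  have hdiff : ∀ w ∈ S, DifferentiableAt ℝ κ w := by
    intro w hw
    have h1 := (hb.mdifferentiableAt_trivCoord he hw.2.2).hasMFDerivAt.comp w
      (ψ.mdifferentiableAt hw.1).hasMFDerivAt
    exact h1.mdifferentiableAt.differentiableAt
  have hG : ∀ w ∈ S, ENNReal.ofReal (m.gramVol (ψ.toFun w) (coordVec dX ψ.toFun w)) =
      ENNReal.ofReal |(fderiv ℝ κ w).det| *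
        ENNReal.ofReal (m.gramVol ((hb.param he hu).toFun (κ w))
          (coordVec dX (hb.param he hu).toFun (κ w))) := by
    intro w hw
    rw [← ENNReal.ofReal_mul (abs_nonneg _)]
    congr 1
    refine m.gramVol_comp hb.smooth_proj ψ (hb.param he hu) (hdiff w hw) (trivCoord_mem hw.2.2) ?_
    have h2 : ContinuousAt ψ.toFun w := (ψ.mdifferentiableAt hw.1).continuousAt
    filter_upwards [ψ.isOpen_dom.mem_nhds hw.1,
      h2.preimage_mem_nhds (isOpen_trivDomain.mem_nhds hw.2.2)] with w' h3 h4
    exact hrec w' h3 h4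
  rw [setLIntegral_congr_fun hSm hG]
  have hinj : InjOn κ S := by
    intro w hw w' hw' hww'
    refine ψ.injOn hw.1 hw'.1 ?_
    rw [hrec w hw.1 hw.2.2, hrec w' hw'.1 hw'.2.2, hww']
  -- The integral over `S` becomes one over `κ '' S`, and enlarging this set to the full preimage of
  -- `A` gives the bound.
  rw [← lintegral_image_eq_lintegral_abs_det_fderiv_mul volume hSm
    (fun w hw => (hdiff w hw).hasFDerivAt.hasFDerivWithinAt) hinj
    (fun w => ENNReal.ofReal (m.gramVol ((hb.param he hu).toFun w)
      (coordVec dX (hb.param he hu).toFun w)))]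
  refine lintegral_mono_set ?_
  rintro _ ⟨w, hw, rfl⟩
  refine ⟨trivCoord_mem hw.2.2, ?_⟩
  change trivParam b e (u, κ w) ∈ A
  rw [← hrec w hw.1 hw.2.2]
  exact hw.2.1

theorem SmoothTriv.localMeasure_restrict (hb : SmoothTriv dM dX dZ b)
    (he : e ∈ IsManifold.maximalAtlas (𝓡 dZ) ∞ Z) {u : M} (hu : u ∈ b.baseSet) :
    (m.localMeasure (hb.param he hu)).restrict (trivDomain b e) =
      m.localMeasure (hb.param he hu) := by
  refine Measure.restrict_eq_self_of_ae_mem ?_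
  have hD : MeasurableSet (trivDomain b e) := isOpen_trivDomain.measurableSet
  rw [ae_iff]
  change m.localMeasure (hb.param he hu) (trivDomain b e)ᶜ = 0
  rw [m.localMeasure_apply _ hD.compl]
  have : (hb.param he hu).dom ∩ (hb.param he hu).toFun ⁻¹' (trivDomain b e)ᶜ = ∅ := by
    ext w
    simp only [mem_inter_iff, mem_preimage, mem_compl_iff, mem_empty_iff_false, iff_false, not_and,
      not_not]
    exact fun hw => trivParam_mem hu hw
  rw [this, setLIntegral_empty]

/-- Over the coordinate domain every local measure is dominated by the one of `hb.param`, which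
itself belongs to the family. -/
theorem VerticalMetric.iSup_localMeasure_restrict (hb : SmoothTriv dM dX dZ b)
    (he : e ∈ IsManifold.maximalAtlas (𝓡 dZ) ∞ Z) {u : M} (hu : u ∈ b.baseSet) :
    (⨆ ψ : FibreParam dX dZ p u, m.localMeasure ψ).restrict (trivDomain b e) =
      m.localMeasure (hb.param he hu) := by
  have hD : MeasurableSet (trivDomain b e) := isOpen_trivDomain.measurableSet
  set N := ⨆ ψ : FibreParam dX dZ p u, m.localMeasure ψ with hN
  have hle : ∀ ψ, m.localMeasure ψ ≤ N := fun ψ => le_iSup (fun ψ => m.localMeasure ψ) ψ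
  refine le_antisymm ?_ ?_
  · have h1 : N ≤ m.localMeasure (hb.param he hu) + N.restrict (trivDomain b e)ᶜ := by
      refine iSup_le fun ψ => ?_
      rw [← Measure.restrict_add_restrict_compl (μ := m.localMeasure ψ) hD]
      exact add_le_add (m.localMeasure_restrict_le hb he hu ψ)
        (Measure.restrict_mono le_rfl (hle ψ))
    refine (Measure.restrict_mono le_rfl h1).trans ?_
    rw [Measure.restrict_add, Measure.restrict_restrict hD, inter_compl_self,
      Measure.restrict_empty, add_zero]
    exact Measure.restrict_le_self
  · rw [← hb.localMeasure_restrict m he hu]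
    exact Measure.restrict_mono le_rfl (hle _)

end ChangeOfVariables

/-! ## Continuity of the densities -/

section Density

variable {dM dX dZ : ℕ} {M X Z : Type*}
  [TopologicalSpace M] [ChartedSpace (EuclideanSpace ℝ (Fin dM)) M]
  [TopologicalSpace X] [ChartedSpace (EuclideanSpace ℝ (Fin dX)) X]
  [TopologicalSpace Z] [ChartedSpace (EuclideanSpace ℝ (Fin dZ)) Z] {p : X → M}
  [IsManifold (𝓡 dM) ∞ M] [IsManifold (𝓡 dX) ∞ X] [IsManifold (𝓡 dZ) ∞ Z]
  (m : VerticalMetric dX dM p)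
  {b : Trivialization Z p} {e : OpenPartialHomeomorph Z (EuclideanSpace ℝ (Fin dZ))}

/-- The coordinate vector fields on `X` along the fibres. -/
noncomputable def fibreField (dX : ℕ) {dZ : ℕ} {M X Z : Type*}
    [TopologicalSpace M]
    [TopologicalSpace X] [ChartedSpace (EuclideanSpace ℝ (Fin dX)) X]
    [TopologicalSpace Z] {p : X → M}
    (b : Trivialization Z p) (e : OpenPartialHomeomorph Z (EuclideanSpace ℝ (Fin dZ))) (x : X) :
    Fin dZ → EuclideanSpace ℝ (Fin dX) :=
  coordVec dX (fun w => trivParam b e (p x, w)) (trivCoord b e x)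

theorem SmoothTriv.projDeriv_fibreField (hb : SmoothTriv dM dX dZ b)
    (he : e ∈ IsManifold.maximalAtlas (𝓡 dZ) ∞ Z) {x : X} (hx : x ∈ trivDomain b e) (a : Fin dZ) :
    projDeriv dM p x (fibreField dX b e x a) = 0 := by
  have h1 := (hb.param he (proj_mem_of_mem_trivDomain hx)).mfderiv_vertical hb.smooth_proj
    (trivCoord_mem hx) (EuclideanSpace.single a (1 : ℝ))
  have h2 : (hb.param he (proj_mem_of_mem_trivDomain hx)).toFun (trivCoord b e x) = x :=
    trivParam_trivCoord hx
  have key : ∀ (y : X) (_ : y = x) (v : EuclideanSpace ℝ (Fin dX)),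
      projDeriv dM p y v = 0 → projDeriv dM p x v = 0 := by
    rintro y rfl v hv
    exact hv
  exact key _ h2 _ h1

/-- The field is the image of the constant field `(0, e_a)` on `M × ℝ^dZ` under the tangent map of
the smooth parametrization, evaluated at the coordinates of `x`. -/
theorem SmoothTriv.contMDiffOn_fibreField (hb : SmoothTriv dM dX dZ b)
    (he : e ∈ IsManifold.maximalAtlas (𝓡 dZ) ∞ Z) (a : Fin dZ) :
    ContMDiffOn (𝓡 dX) (𝓡 dX).tangent ∞
      (fun x => (⟨x, fibreField dX b e x a⟩ : TangentBundle (𝓡 dX) X)) (trivDomain b e) := by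
  have hS : IsOpen (b.baseSet ×ˢ e.target) := b.open_baseSet.prod e.open_target
  have : IsManifold (𝓡 dX) 1 X := IsManifold.of_le (n := ∞) (by simp)
  have : IsManifold (𝓡 dM) 1 M := IsManifold.of_le (n := ∞) (by simp)
  have hT := (hb.contMDiffOn_trivParam he).contMDiffOn_tangentMapWithin (m := ∞) (by simp)
    hS.uniqueMDiffOn
  have hsec : ContMDiffOn (𝓡 dX) ((𝓡 dM).prod (𝓡 dZ)).tangent ∞
      (fun x => (⟨(p x, trivCoord b e x), ((0 : EuclideanSpace ℝ (Fin dM)),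
        (EuclideanSpace.single a (1 : ℝ) : EuclideanSpace ℝ (Fin dZ)))⟩ :
        TangentBundle ((𝓡 dM).prod (𝓡 dZ)) (M × EuclideanSpace ℝ (Fin dZ)))) (trivDomain b e) := by
    have h1 : ContMDiffOn (𝓡 dX) (𝓡 dM).tangent ∞
        (fun x => zeroSection (EuclideanSpace ℝ (Fin dM)) (TangentSpace (𝓡 dM) : M → Type _) (p x))
        (trivDomain b e) :=
      ((Bundle.contMDiff_zeroSection ℝ (TangentSpace (𝓡 dM) : M → Type _)).comp
        hb.smooth_proj).contMDiffOn
    have h2 : ContMDiff (𝓡 dZ) (𝓡 dZ).tangent ∞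
        (fun w : EuclideanSpace ℝ (Fin dZ) =>
          (⟨w, (EuclideanSpace.single a (1 : ℝ) : EuclideanSpace ℝ (Fin dZ))⟩ :
            TangentBundle (𝓡 dZ) (EuclideanSpace ℝ (Fin dZ)))) :=
      contMDiff_vectorSpace_iff_contDiff.2 contDiff_const
    have h3 := h2.comp_contMDiffOn (hb.contMDiffOn_trivCoord he)
    exact (contMDiff_equivTangentBundleProd_symm (I := 𝓡 dM) (I' := 𝓡 dZ) (M := M)
      (M' := EuclideanSpace ℝ (Fin dZ)) (n := ∞)).comp_contMDiffOn (h1.prodMk h3)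
  refine (hT.comp hsec fun x hx => ⟨proj_mem_of_mem_trivDomain hx, trivCoord_mem hx⟩).congr ?_
  intro x hx
  have hu := proj_mem_of_mem_trivDomain hx
  have hw := trivCoord_mem hx
  have key : ∀ (y : X) (_ : y = x) (v : EuclideanSpace ℝ (Fin dX)),
      (⟨x, v⟩ : TangentBundle (𝓡 dX) X) = ⟨y, v⟩ := by
    rintro y rfl v
    rfl
  refine Eq.trans (key _ (trivParam_trivCoord hx) _) ?_
  refine TotalSpace.mk_inj.2 ?_
  rw [mfderivWithin_of_mem_nhds (hS.mem_nhds ⟨hu, hw⟩)]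
  have h5 := (hb.hasMFDerivAt_trivParam he hu hw).mfderiv
  exact DFunLike.congr_fun h5 (EuclideanSpace.single a (1 : ℝ))

theorem SmoothTriv.continuousOn_gramVol_fibreField (hb : SmoothTriv dM dX dZ b)
    (he : e ∈ IsManifold.maximalAtlas (𝓡 dZ) ∞ Z) :
    ContinuousOn (fun x => m.gramVol x (fibreField dX b e x)) (trivDomain b e) := by
  have hξ : ∀ a, ContMDiffOn (𝓡 dX) (𝓡 dX).tangent ∞
      (fun x => (⟨x, (vertVec dM p x (fibreField dX b e x a) : TangentSpace (𝓡 dX) x)⟩ :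
        TangentBundle (𝓡 dX) X)) (trivDomain b e) := by
    intro a
    refine (hb.contMDiffOn_fibreField he a).congr fun x hx => ?_
    refine TotalSpace.mk_inj.2 ?_
    exact vertIncl_vertVec (hb.projDeriv_fibreField he hx a)
  have h1 : ∀ a c, ContinuousOn (fun x => m.gramAt x (fibreField dX b e x) a c)
      (trivDomain b e) := fun a c => m.continuousOn _ isOpen_trivDomain
    (fun x => vertVec dM p x (fibreField dX b e x a))
    (fun x => vertVec dM p x (fibreField dX b e x c)) (hξ a) (hξ c)
  have h2 : ContinuousOn (fun x => (m.gramAt x (fibreField dX b e x)).det) (trivDomain b e) := by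
    simp only [Matrix.det_apply]
    refine continuousOn_finsetSum _ fun σ _ => ContinuousOn.const_smul ?_ _
    exact continuousOn_finsetProd _ fun i _ => h1 _ _
  exact (continuous_norm.comp_continuousOn h2).sqrt

/-- The density of the measure on the fibre over `u` in the coordinates given by a local
trivialization and a chart of `Z`. -/
noncomputable def VerticalMetric.coordDensity (m : VerticalMetric dX dM p) (b : Trivialization Z p)
    (e : OpenPartialHomeomorph Z (EuclideanSpace ℝ (Fin dZ))) (u : M)
    (w : EuclideanSpace ℝ (Fin dZ)) : ℝ :=
  m.gramVol (trivParam b e (u, w)) (coordVec dX (fun w => trivParam b e (u, w)) w)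

/-- Joint continuity in `u` and `w`: the density is the Gram volume of the coordinate fields on `X`,
composed with the parametrization `(u, w) ↦ x`. -/
theorem SmoothTriv.continuousOn_coordDensity (hb : SmoothTriv dM dX dZ b)
    (he : e ∈ IsManifold.maximalAtlas (𝓡 dZ) ∞ Z) :
    ContinuousOn (fun y : M × EuclideanSpace ℝ (Fin dZ) => m.coordDensity b e y.1 y.2)
      (b.baseSet ×ˢ e.target) := by
  have h1 := (hb.continuousOn_gramVol_fibreField m he).comp
    (hb.contMDiffOn_trivParam he).continuousOn fun y hy => trivParam_mem hy.1 hy.2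
  refine h1.congr fun y hy => ?_
  simp only [Function.comp_apply, VerticalMetric.coordDensity, fibreField]
  rw [proj_trivParam (b := b) (e := e) (u := y.1) (w := y.2) hy.1,
    trivCoord_trivParam (b := b) (e := e) (u := y.1) (w := y.2) hy.1 hy.2]

theorem SmoothTriv.coordDensity_pos (hb : SmoothTriv dM dX dZ b)
    (he : e ∈ IsManifold.maximalAtlas (𝓡 dZ) ∞ Z) {u : M} (hu : u ∈ b.baseSet)
    {w : EuclideanSpace ℝ (Fin dZ)} (hw : w ∈ e.target) : 0 < m.coordDensity b e u w := by
  refine m.gramVol_pos ?_ ((hb.param he hu).linearIndependent_coordVec (w := w) hw)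
  intro c
  exact (hb.param he hu).mfderiv_vertical hb.smooth_proj (w := w) hw _

attribute [irreducible] VerticalMetric.coordDensity

end Density

/-! ## Densities of measures in charts -/

theorem ContinuousOn.measurableSet_inter_preimage_of_isOpen {α β : Type*} [TopologicalSpace α]
    [MeasurableSpace α] [OpensMeasurableSpace α] [TopologicalSpace β] [MeasurableSpace β]
    [BorelSpace β] {f : α → β} {s : Set α} (hf : ContinuousOn f s) (hs : IsOpen s) {A : Set β}
    (hA : MeasurableSet A) : MeasurableSet (s ∩ f ⁻¹' A) := by
  have h1 := (continuousOn_iff_continuous_domRestrict.1 hf).measurable hA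
  have h2 := (MeasurableEmbedding.subtype_coe hs.measurableSet).measurableSet_image' h1
  convert! h2 using 1
  ext x
  simp [and_comm]

section ChartDensity

variable {d : ℕ} {Z : Type*} [TopologicalSpace Z] [MeasurableSpace Z] [BorelSpace Z]
  {e : OpenPartialHomeomorph Z (EuclideanSpace ℝ (Fin d))} {ν μ : Measure Z}
  {c ρ : EuclideanSpace ℝ (Fin d) → ℝ}

/-- The measure `ν` has the density `c` in the chart `e`. -/
def HasChartDensity (ν : Measure Z) (e : OpenPartialHomeomorph Z (EuclideanSpace ℝ (Fin d)))
    (c : EuclideanSpace ℝ (Fin d) → ℝ) : Prop :=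
  ∀ A : Set Z, MeasurableSet A →
    ν (A ∩ e.source) = ∫⁻ w in e.target ∩ e.symm ⁻¹' A, ENNReal.ofReal (c w)

theorem HasChartDensity.restrict_eq_map (h : HasChartDensity μ e ρ) :
    μ.restrict e.source =
      ((volume.restrict e.target).withDensity fun w => ENNReal.ofReal (ρ w)).map e.symm := by
  have hs : AEMeasurable e.symm (volume.restrict e.target) :=
    e.continuousOn_symm.aemeasurable e.open_target.measurableSet
  ext A hA
  rw [Measure.restrict_apply hA, h A hA, Measure.map_apply_of_aemeasurable
    (hs.mono_ac (withDensity_absolutelyContinuous _ _)) hA, withDensity_apply',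
    Measure.restrict_restrict' e.open_target.measurableSet, inter_comm]

/-- Both measures are compared with Lebesgue measure in the chart, so the relative density is the
quotient of the two. -/
theorem HasChartDensity.restrict_eq_withDensity (hν : HasChartDensity ν e c)
    (hμ : HasChartDensity μ e ρ) (hc : ContinuousOn c e.target) (hρ : ContinuousOn ρ e.target)
    (hpos : ∀ w ∈ e.target, 0 < ρ w) :
    ν.restrict e.source = (μ.restrict e.source).withDensity
      fun z => ENNReal.ofReal (c (e z) / ρ (e z)) := by
  have ht := e.open_target.measurableSet
  have hs : AEMeasurable e.symm (volume.restrict e.target) :=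
    e.continuousOn_symm.aemeasurable ht
  have hg : AEMeasurable (fun z => ENNReal.ofReal (c (e z) / ρ (e z))) (μ.restrict e.source) := by
    refine ContinuousOn.aemeasurable ?_ e.open_source.measurableSet
    refine ENNReal.continuous_ofReal.comp_continuousOn ?_
    exact (hc.comp e.continuousOn e.mapsTo).div (hρ.comp e.continuousOn e.mapsTo)
      fun z hz => (hpos _ (e.map_source hz)).ne'
  have hρm : AEMeasurable (fun w => ENNReal.ofReal (ρ w)) (volume.restrict e.target) :=
    (ENNReal.continuous_ofReal.comp_continuousOn hρ).aemeasurable ht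
  ext A hA
  rw [Measure.restrict_apply hA, hν A hA, withDensity_apply _ hA, ← lintegral_indicator hA]
  have hgA := hg.indicator hA
  rw [hμ.restrict_eq_map] at hgA ⊢
  have hs' := hs.mono_ac (withDensity_absolutelyContinuous (volume.restrict e.target)
    fun w => ENNReal.ofReal (ρ w))
  rw [lintegral_map' hgA hs']
  have hcomp := (hgA.comp_aemeasurable hs')
  rw [lintegral_withDensity_eq_lintegral_mul_non_measurable₀ _ hρm
    (.of_forall fun _ => ENNReal.ofReal_lt_top)]
  have hm := e.continuousOn_symm.measurableSet_inter_preimage_of_isOpen e.open_target hA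
  have h1 : ∀ w ∈ e.target, ((fun w => ENNReal.ofReal (ρ w)) * fun w =>
      A.indicator (fun z => ENNReal.ofReal (c (e z) / ρ (e z))) (e.symm w)) w =
      (e.target ∩ e.symm ⁻¹' A).indicator (fun w => ENNReal.ofReal (c w)) w := by
    intro w hw
    by_cases hwA : e.symm w ∈ A
    · rw [Pi.mul_apply, indicator_of_mem hwA, indicator_of_mem (show w ∈ e.target ∩ e.symm ⁻¹' A from ⟨hw, hwA⟩), e.right_inv hw, ← ENNReal.ofReal_mul (hpos w hw).le, mul_div_cancel₀ _ (hpos w hw).ne']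
    · rw [Pi.mul_apply, indicator_of_notMem hwA, indicator_of_notMem fun h => hwA h.2, mul_zero]
  rw [setLIntegral_congr_fun ht h1, lintegral_indicator hm, Measure.restrict_restrict hm]
  congr 2
  ext w
  simp +contextual

/-- Near the coordinates of `z` the density stays below `ρ (e z) + 1`, and a small coordinate ball
has finite volume. -/
theorem HasChartDensity.exists_measure_lt_top (h : HasChartDensity μ e ρ)
    (hρ : ContinuousOn ρ e.target) {z : Z} (hz : z ∈ e.source) :
    ∃ N ∈ 𝓝 z, μ N < ⊤ := by
  have hw := e.map_source hz
  have h1 : ∀ᶠ w in 𝓝 (e z), ρ w < ρ (e z) + 1 :=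
    (hρ.continuousAt (e.open_target.mem_nhds hw)).eventually_lt_const (by linarith)
  obtain ⟨δ, hδ, hB⟩ := Metric.eventually_nhds_iff_ball.1 h1
  set A := e.source ∩ e ⁻¹' Metric.ball (e z) δ with hA
  have hAo : IsOpen A := e.isOpen_inter_preimage Metric.isOpen_ball
  refine ⟨A, hAo.mem_nhds ⟨hz, Metric.mem_ball_self hδ⟩, ?_⟩
  have h2 := h A hAo.measurableSet
  rw [inter_eq_left.2 inter_subset_left] at h2
  rw [h2]
  have h3 : e.target ∩ e.symm ⁻¹' A ⊆ Metric.ball (e z) δ := by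
    rintro w ⟨hw1, hw2, hw3⟩
    simpa [e.right_inv hw1] using! hw3
  calc ∫⁻ w in e.target ∩ e.symm ⁻¹' A, ENNReal.ofReal (ρ w)
      ≤ ∫⁻ w in Metric.ball (e z) δ, ENNReal.ofReal (ρ w) := lintegral_mono_set h3
    _ ≤ ∫⁻ _ in Metric.ball (e z) δ, ENNReal.ofReal (ρ (e z) + 1) :=
        setLIntegral_mono measurable_const fun w hw => ENNReal.ofReal_le_ofReal (hB w hw).le
    _ = ENNReal.ofReal (ρ (e z) + 1) * volume (Metric.ball (e z) δ) := setLIntegral_const _ _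
    _ < ⊤ := ENNReal.mul_lt_top ENNReal.ofReal_lt_top Metric.isBounded_ball.measure_lt_top

theorem HasChartDensity.measure_ne_zero (h : HasChartDensity μ e ρ)
    (hρ : ContinuousOn ρ e.target) (hpos : ∀ w ∈ e.target, 0 < ρ w) {O : Set Z} (hO : IsOpen O)
    {z : Z} (hz : z ∈ e.source) (hzO : z ∈ O) : μ O ≠ 0 := by
  intro h0
  have h1 := h O hO.measurableSet
  rw [measure_mono_null inter_subset_left h0] at h1
  have hopen : IsOpen (e.target ∩ e.symm ⁻¹' O) := e.isOpen_inter_preimage_symm hO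
  have h2 : AEMeasurable (fun w => ENNReal.ofReal (ρ w))
      (volume.restrict (e.target ∩ e.symm ⁻¹' O)) :=
    (ENNReal.continuous_ofReal.comp_continuousOn (hρ.mono inter_subset_left)).aemeasurable
      hopen.measurableSet
  have h3 := (lintegral_eq_zero_iff' h2).1 h1.symm
  have h4 : ∀ᵐ w ∂(volume.restrict (e.target ∩ e.symm ⁻¹' O)), False := by
    filter_upwards [h3, ae_restrict_mem hopen.measurableSet] with w hw hw'
    have := hpos w hw'.1
    simp only [Pi.zero_apply, ENNReal.ofReal_eq_zero] at hw
    linarith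
  rw [Filter.eventually_false_iff_eq_bot, ae_eq_bot, Measure.restrict_eq_zero] at h4
  refine hopen.measure_ne_zero volume ⟨e z, e.map_source hz, ?_⟩ h4
  rw [mem_preimage, e.left_inv hz]
  exact hzO

variable [ChartedSpace (EuclideanSpace ℝ (Fin d)) Z]

theorem IsSmoothMeasure.exists_density (hμ : IsSmoothMeasure (d := d) μ)
    (he : e ∈ IsManifold.maximalAtlas (𝓡 d) ∞ Z) :
    ∃ ρ : EuclideanSpace ℝ (Fin d) → ℝ, ContinuousOn ρ e.target ∧ (∀ w ∈ e.target, 0 < ρ w) ∧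
      HasChartDensity μ e ρ := by
  obtain ⟨ρ, hρ, hpos, hmap⟩ := hμ e he
  refine ⟨ρ, hρ.continuousOn, hpos, fun A hA => ?_⟩
  have hm := e.continuousOn_symm.measurableSet_inter_preimage_of_isOpen e.open_target hA
  have h1 := congrArg (fun κ : Measure _ => κ (e.target ∩ e.symm ⁻¹' A)) hmap
  beta_reduce at h1
  rw [Measure.map_apply_of_aemeasurable (e.continuousOn.aemeasurable e.open_source.measurableSet) hm,
    Measure.restrict_apply' e.open_source.measurableSet, withDensity_apply _ hm,
    Measure.restrict_restrict hm] at h1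
  have h2 : e ⁻¹' (e.target ∩ e.symm ⁻¹' A) ∩ e.source = A ∩ e.source := by
    ext z
    simp only [mem_inter_iff, mem_preimage]
    refine and_congr_left fun hz => ?_
    simp [e.left_inv hz, e.map_source hz]
  rw [h2] at h1
  rw [h1]
  congr 2
  ext w
  simp +contextual

variable [IsManifold (𝓡 d) ∞ Z]

theorem IsSmoothMeasure.isLocallyFiniteMeasure (hμ : IsSmoothMeasure (d := d) μ) :
    IsLocallyFiniteMeasure μ := by
  refine ⟨fun z => ?_⟩
  obtain ⟨ρ, hρ, -, h⟩ := hμ.exists_density (IsManifold.chart_mem_maximalAtlas (n := ∞) z)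
  exact h.exists_measure_lt_top hρ (mem_chart_source _ z)

theorem IsSmoothMeasure.isOpenPosMeasure (hμ : IsSmoothMeasure (d := d) μ) :
    μ.IsOpenPosMeasure := by
  refine ⟨fun O hO ⟨z, hz⟩ => ?_⟩
  obtain ⟨ρ, hρ, hpos, h⟩ := hμ.exists_density (IsManifold.chart_mem_maximalAtlas (n := ∞) z)
  exact h.measure_ne_zero hρ hpos hO (mem_chart_source _ z) hz

end ChartDensity

/-! ## Gluing densities -/

section Glue

variable {d : ℕ} {Y Z : Type*} [TopologicalSpace Y] [TopologicalSpace Z]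
  [ChartedSpace (EuclideanSpace ℝ (Fin d)) Z] [MeasurableSpace Z] [BorelSpace Z]
  [SecondCountableTopology Z] {μ : Measure Z} [IsLocallyFiniteMeasure μ] [μ.IsOpenPosMeasure]

/-- Continuous families of densities on the chart domains which define the same measures glue. -/
theorem exists_density_of_charts {U : Set Y} (hUo : IsOpen U) {ν : Y → Measure Z}
    {q : Z → Y → Z → ℝ}
    (hqc : ∀ z₀, ContinuousOn (fun y : Y × Z => q z₀ y.1 y.2)
      (U ×ˢ (chartAt (EuclideanSpace ℝ (Fin d)) z₀).source))
    (hqpos : ∀ z₀, ∀ u ∈ U, ∀ z ∈ (chartAt (EuclideanSpace ℝ (Fin d)) z₀).source, 0 < q z₀ u z)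
    (hqd : ∀ z₀, ∀ u ∈ U, (ν u).restrict (chartAt (EuclideanSpace ℝ (Fin d)) z₀).source =
      (μ.restrict (chartAt (EuclideanSpace ℝ (Fin d)) z₀).source).withDensity
        fun z => ENNReal.ofReal (q z₀ u z)) :
    ∃ r : Y → Z → ℝ, (∀ u ∈ U, ∀ z, 0 < r u z) ∧
      ContinuousOn (fun y : Y × Z => r y.1 y.2) (U ×ˢ univ) ∧
      ∀ u ∈ U, ν u = μ.withDensity fun z => ENNReal.ofReal (r u z) := by
  have hqc' : ∀ z₀, ∀ u ∈ U, ContinuousOn (q z₀ u)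
      (chartAt (EuclideanSpace ℝ (Fin d)) z₀).source := fun z₀ u hu =>
    (hqc z₀).comp (continuousOn_const.prodMk continuousOn_id) fun z hz => ⟨hu, hz⟩
  have hagree : ∀ z₀ z₁, ∀ u ∈ U, EqOn (q z₀ u) (q z₁ u)
      ((chartAt (EuclideanSpace ℝ (Fin d)) z₀).source ∩
        (chartAt (EuclideanSpace ℝ (Fin d)) z₁).source) := by
    intro z₀ z₁ u hu
    set O₀ := (chartAt (EuclideanSpace ℝ (Fin d)) z₀).source
    set O₁ := (chartAt (EuclideanSpace ℝ (Fin d)) z₁).source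
    have hO₀ : IsOpen O₀ := (chartAt _ z₀).open_source
    have hO₁ : IsOpen O₁ := (chartAt _ z₁).open_source
    have hO : IsOpen (O₀ ∩ O₁) := hO₀.inter hO₁
    have c₀ : ContinuousOn (q z₀ u) (O₀ ∩ O₁) := (hqc' z₀ u hu).mono inter_subset_left
    have c₁ : ContinuousOn (q z₁ u) (O₀ ∩ O₁) := (hqc' z₁ u hu).mono inter_subset_right
    -- Two densities of the same measure agree almost everywhere; being continuous, they agree
    -- everywhere because `μ` charges nonempty open sets.
    refine Measure.eqOn_open_of_ae_eq (μ := μ) ?_ hO c₀ c₁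
    have e₀ := congrArg (fun κ : Measure Z => κ.restrict O₁) (hqd z₀ u hu)
    have e₁ := congrArg (fun κ : Measure Z => κ.restrict O₀) (hqd z₁ u hu)
    simp only [restrict_withDensity hO₁.measurableSet, restrict_withDensity hO₀.measurableSet,
      Measure.restrict_restrict hO₁.measurableSet, Measure.restrict_restrict hO₀.measurableSet]
      at e₀ e₁
    rw [inter_comm O₁ O₀] at e₀
    rw [e₀, withDensity_eq_iff_of_sigmaFinite] at e₁
    · filter_upwards [e₁, ae_restrict_mem hO.measurableSet] with z hz hzO
      exact (ENNReal.ofReal_eq_ofReal_iff (hqpos z₀ u hu z hzO.1).le (hqpos z₁ u hu z hzO.2).le).1 hz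
    · exact (ENNReal.continuous_ofReal.comp_continuousOn c₀).aemeasurable hO.measurableSet
    · exact (ENNReal.continuous_ofReal.comp_continuousOn c₁).aemeasurable hO.measurableSet
  -- Each point uses the density of its own preferred chart; near a fixed `z` this coincides with `q
  -- z`, by agreement on overlaps.
  refine ⟨fun u z => q z u z, fun u hu z => hqpos z u hu z (mem_chart_source _ z), ?_, ?_⟩
  · rintro ⟨u, z⟩ ⟨hu, -⟩
    refine ContinuousAt.continuousWithinAt ?_
    have hO : U ×ˢ (chartAt (EuclideanSpace ℝ (Fin d)) z).source ∈ 𝓝 (u, z) :=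
      (hUo.prod (chartAt _ z).open_source).mem_nhds ⟨hu, mem_chart_source _ z⟩
    refine ((hqc z).continuousAt hO).congr ?_
    filter_upwards [hO] with y hy
    exact hagree z y.2 y.1 hy.1 ⟨hy.2, mem_chart_source _ y.2⟩
  · intro u hu
    obtain ⟨s, hs, hU⟩ := TopologicalSpace.countable_cover_nhds
      (f := fun z : Z => (chartAt (EuclideanSpace ℝ (Fin d)) z).source)
      (fun z => (chartAt _ z).open_source.mem_nhds (mem_chart_source _ z))
    have : Countable s := hs.to_subtype
    rw [← Measure.restrict_univ (μ := ν u),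
      ← Measure.restrict_univ (μ := μ.withDensity _), ← hU, biUnion_eq_iUnion,
      Measure.restrict_iUnion_congr]
    rintro ⟨z₀, -⟩
    dsimp only
    rw [hqd z₀ u hu, restrict_withDensity (chartAt _ z₀).open_source.measurableSet]
    refine withDensity_congr_ae ?_
    refine ae_restrict_of_forall_mem (chartAt _ z₀).open_source.measurableSet fun z hz => ?_
    have := hagree z₀ z u hu ⟨hz, mem_chart_source _ z⟩
    exact congrArg ENNReal.ofReal this

end Glue

/-! ## The densities of the measures on the fibres -/

section FibreDensity

variable {dM dX dZ : ℕ} {M X Z : Type*}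
  [TopologicalSpace M] [ChartedSpace (EuclideanSpace ℝ (Fin dM)) M]
  [TopologicalSpace X] [ChartedSpace (EuclideanSpace ℝ (Fin dX)) X]
  [TopologicalSpace Z] [ChartedSpace (EuclideanSpace ℝ (Fin dZ)) Z] {p : X → M}
  [IsManifold (𝓡 dM) ∞ M] [IsManifold (𝓡 dX) ∞ X] [IsManifold (𝓡 dZ) ∞ Z]
  [T1Space M]
  [MeasurableSpace X] [BorelSpace X]
  (m : VerticalMetric dX dM p)
  {b : Trivialization Z p} {e : OpenPartialHomeomorph Z (EuclideanSpace ℝ (Fin dZ))}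

theorem SmoothTriv.measurableEmbedding_fibre (hb : SmoothTriv dM dX dZ b) (u : M) :
    MeasurableEmbedding (Subtype.val : ↥(p ⁻¹' {u}) → X) :=
  MeasurableEmbedding.subtype_coe
    ((isClosed_singleton.preimage hb.smooth_proj.continuous).measurableSet)

variable [MeasurableSpace Z] [BorelSpace Z]

/-- The part of the fibre over the domain of `e` lies in `trivDomain b e`, where the supremum
defining the fibre measure reduces to the local measure of `hb.param`. -/
theorem SmoothTriv.hasChartDensity_map (hb : SmoothTriv dM dX dZ b)
    (he : e ∈ IsManifold.maximalAtlas (𝓡 dZ) ∞ Z) {u : M} (hu : u ∈ b.baseSet) :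
    HasChartDensity ((m.fibreMeasure dZ u).map (b.preimageSingletonHomeomorph hu)) e
      (m.coordDensity b e u) := by
  intro A hA
  have hAe := hA.inter e.open_source.measurableSet
  have hc : Continuous (b.preimageSingletonHomeomorph hu) := Homeomorph.continuous _
  rw [Measure.map_apply hc.measurable hAe, VerticalMetric.fibreMeasure,
    (hb.measurableEmbedding_fibre u).comap_apply]
  set N := ⨆ ψ : FibreParam dX dZ p u, m.localMeasure ψ with hN
  set S := (Subtype.val : ↥(p ⁻¹' {u}) → X) '' (b.preimageSingletonHomeomorph hu ⁻¹' (A ∩ e.source))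
  have hS : MeasurableSet S := (hb.measurableEmbedding_fibre u).measurableSet_image.2
    (hc.measurable hAe)
  have hSD : S ⊆ trivDomain b e := by
    rintro _ ⟨x, hx, rfl⟩
    refine ⟨b.mem_source.2 (mem_of_mem_fibre hu x), hx.2⟩
  have h1 := m.iSup_localMeasure_restrict hb he hu
  have h2 : N S = m.localMeasure (hb.param he hu) S := by
    rw [← h1, Measure.restrict_apply hS, inter_eq_left.2 hSD]
  rw [h2, m.localMeasure_apply _ hS]
  have h3 : (hb.param he hu).dom ∩ (hb.param he hu).toFun ⁻¹' S = e.target ∩ e.symm ⁻¹' A := by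
    ext w
    refine and_congr_right fun hw => ?_
    have hw' : w ∈ e.target := hw
    have hbw : (b (trivParam b e (u, w))).2 = e.symm w := by
      rw [trivParam, b.apply_symm_apply (b.mem_target.2 hu)]
    constructor
    · rintro ⟨x, hx, hxw⟩
      have h5 : x.1 = trivParam b e (u, w) := hxw
      have h4 : (b x.1).2 ∈ A := hx.1
      rw [h5, hbw] at h4
      exact h4
    · intro hwA
      refine ⟨⟨trivParam b e (u, w), proj_trivParam hu⟩, ?_, rfl⟩
      rw [mem_preimage, b.preimageSingletonHomeomorph_apply]
      rw [hbw]
      exact ⟨hwA, e.map_target hw'⟩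
  rw [h3]
  simp only [VerticalMetric.coordDensity]
  rfl

theorem SmoothTriv.continuousOn_coordDensity_left (hb : SmoothTriv dM dX dZ b)
    (he : e ∈ IsManifold.maximalAtlas (𝓡 dZ) ∞ Z) {u : M} (hu : u ∈ b.baseSet) :
    ContinuousOn (m.coordDensity b e u) e.target := by
  have h0 : ContinuousOn (fun w : EuclideanSpace ℝ (Fin dZ) => (u, w)) e.target :=
    continuousOn_const.prodMk continuousOn_id
  exact ContinuousOn.comp
    (g := fun y : M × EuclideanSpace ℝ (Fin dZ) => m.coordDensity b e y.1 y.2)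
    (hb.continuousOn_coordDensity m he) h0 fun w hw => ⟨hu, hw⟩

theorem SmoothTriv.continuousOn_coordDensity_chart (hb : SmoothTriv dM dX dZ b)
    (he : e ∈ IsManifold.maximalAtlas (𝓡 dZ) ∞ Z) :
    ContinuousOn (fun y : M × Z => m.coordDensity b e y.1 (e y.2)) (b.baseSet ×ˢ e.source) := by
  have h0 : ContinuousOn (fun y : M × Z => (y.1, e y.2)) (b.baseSet ×ˢ e.source) :=
    continuousOn_fst.prodMk (e.continuousOn.comp continuousOn_snd fun y hy => hy.2)
  exact ContinuousOn.comp
    (g := fun y : M × EuclideanSpace ℝ (Fin dZ) => m.coordDensity b e y.1 y.2)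
    (hb.continuousOn_coordDensity m he) h0
    fun y hy => ⟨hy.1, e.map_source hy.2⟩

variable [T2Space Z] [SecondCountableTopology Z] [CompactSpace Z] {μ : Measure Z}

/-- The measures on the fibres have a positive continuous density with respect to `μ`. -/
theorem SmoothTriv.exists_density (hb : SmoothTriv dM dX dZ b) (hμ : IsSmoothMeasure (d := dZ) μ) :
    ∃ r : M → Z → ℝ, (∀ u ∈ b.baseSet, ∀ z, 0 < r u z) ∧
      ContinuousOn (fun y : M × Z => r y.1 y.2) (b.baseSet ×ˢ univ) ∧
      ∀ u (hu : u ∈ b.baseSet), (m.fibreMeasure dZ u).map (b.preimageSingletonHomeomorph hu) =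
        μ.withDensity fun z => ENNReal.ofReal (r u z) := by
  have := hμ.isLocallyFiniteMeasure
  have := hμ.isOpenPosMeasure
  have hchart := fun z : Z => hμ.exists_density (IsManifold.chart_mem_maximalAtlas (I := 𝓡 dZ) (n := ∞) z)
  choose ρ hρc hρpos hρ using hchart
  let q : Z → M → Z → ℝ := fun z₀ u z =>
    m.coordDensity b (chartAt _ z₀) u (chartAt (EuclideanSpace ℝ (Fin dZ)) z₀ z) /
      ρ z₀ (chartAt (EuclideanSpace ℝ (Fin dZ)) z₀ z)
  have hqc : ∀ z₀, ContinuousOn (fun y : M × Z => q z₀ y.1 y.2)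
      (b.baseSet ×ˢ (chartAt (EuclideanSpace ℝ (Fin dZ)) z₀).source) := by
    intro z₀
    set e := chartAt (EuclideanSpace ℝ (Fin dZ)) z₀ with he
    have h0 : ContinuousOn (fun y : M × Z => e y.2) (b.baseSet ×ˢ e.source) :=
      e.continuousOn.comp continuousOn_snd fun y hy => hy.2
    exact (hb.continuousOn_coordDensity_chart m (IsManifold.chart_mem_maximalAtlas z₀)).div
      ((hρc z₀).comp h0 fun y hy => e.map_source hy.2)
      fun y hy => (hρpos z₀ _ (e.map_source hy.2)).ne'
  have hqpos : ∀ z₀, ∀ u ∈ b.baseSet, ∀ z ∈ (chartAt (EuclideanSpace ℝ (Fin dZ)) z₀).source,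
      0 < q z₀ u z := fun z₀ u hu z hz =>
    div_pos (hb.coordDensity_pos m (IsManifold.chart_mem_maximalAtlas z₀) hu
      (OpenPartialHomeomorph.map_source _ hz))
      (hρpos z₀ _ (OpenPartialHomeomorph.map_source _ hz))
  have hqd : ∀ z₀, ∀ u (hu : u ∈ b.baseSet),
      ((m.fibreMeasure dZ u).map (b.preimageSingletonHomeomorph hu)).restrict
        (chartAt (EuclideanSpace ℝ (Fin dZ)) z₀).source =
      (μ.restrict (chartAt (EuclideanSpace ℝ (Fin dZ)) z₀).source).withDensity
        fun z => ENNReal.ofReal (q z₀ u z) := fun z₀ u hu =>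
    (hb.hasChartDensity_map m (IsManifold.chart_mem_maximalAtlas z₀) hu).restrict_eq_withDensity
      (hρ z₀) (hb.continuousOn_coordDensity_left m (IsManifold.chart_mem_maximalAtlas z₀) hu)
      (hρc z₀) (hρpos z₀)
  let ν : M → Measure Z := fun u =>
    (m.fibreMeasure dZ u).map fun x => (b x.1).2
  obtain ⟨r, h1, h2, h3⟩ := exists_density_of_charts (ν := ν) b.open_baseSet hqc hqpos
    fun z₀ u hu => hqd z₀ u hu
  exact ⟨r, h1, h2, fun u hu => h3 u hu⟩

end FibreDensity

/-! ## The homeomorphisms of the fibres given by a groupoid action -/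

section Action

variable {dM dG : ℕ} {M G : Type*}
  [TopologicalSpace M] [ChartedSpace (EuclideanSpace ℝ (Fin dM)) M]
  [TopologicalSpace G] [ChartedSpace (EuclideanSpace ℝ (Fin dG)) G]
  {𝒢 : LieGroupoid dM dG M G} {EY HY : Type*} [NormedAddCommGroup EY]
  [NormedSpace ℝ EY] [TopologicalSpace HY] {I : ModelWithCorners ℝ EY HY}
  {Y : Type*} [TopologicalSpace Y] [ChartedSpace HY Y] {p : Y → M} (A : GManifold 𝒢 I p)

theorem LieGroupoid.continuous_tgt : Continuous 𝒢.tgt := 𝒢.submersion_tgt.contMDiff.continuous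

namespace GManifold

theorem act_injective {g : G} {y y' : Y} (hy : 𝒢.src g = p y) (hy' : 𝒢.src g = p y')
    (h : A.act g y = A.act g y') : y = y' := by
  rw [← A.inv_act hy, h, A.inv_act hy']

/-- The unit law follows from the other axioms: acting once more with the unit `ε` gives `ε (ε y) =
(ε ε) y = ε y`, and elements act injectively. -/
theorem act_unit (y : Y) : A.act (𝒢.unit (p y)) y = y := by
  have h1 : 𝒢.src (𝒢.unit (p y)) = p y := 𝒢.src_unit _
  have h2 : p (A.act (𝒢.unit (p y)) y) = p y := (A.anchor_act h1).trans (𝒢.tgt_unit _)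
  refine A.act_injective (h1.trans h2.symm) h1 ?_
  have h3 := 𝒢.mul_unit (𝒢.unit (p y))
  rw [𝒢.src_unit] at h3
  rw [← A.mul_act (h1.trans (𝒢.tgt_unit _).symm) h1, h3]

theorem act_act_inv {g : G} {y : Y} (hy : 𝒢.tgt g = p y) : A.act g (A.act (𝒢.inv g) y) = y := by
  rw [← A.mul_act (𝒢.tgt_inv g).symm ((𝒢.src_inv g).trans hy), 𝒢.mul_inv, hy, A.act_unit]

theorem anchor_act_inv {g : G} {y : Y} (hy : 𝒢.tgt g = p y) : p (A.act (𝒢.inv g) y) = 𝒢.src g :=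
  (A.anchor_act ((𝒢.src_inv g).trans hy)).trans (𝒢.tgt_inv g)

theorem act_inv_inv {g : G} {y : Y} (hy : 𝒢.src g = p y) :
    A.act (𝒢.inv (𝒢.inv g)) y = A.act g y := by
  have h1 : 𝒢.src (𝒢.inv g) = p (A.act g y) := (𝒢.src_inv g).trans (A.anchor_act hy).symm
  have h2 := A.inv_act h1
  rwa [A.inv_act hy] at h2

theorem continuousOn_act :
    ContinuousOn (fun q : G × Y => A.act q.1 q.2) {q | 𝒢.src q.1 = p q.2} :=
  A.smooth_act.continuousOn

theorem contMDiffOn_act (g : G) : ContMDiffOn I I ∞ (A.act g) (p ⁻¹' {𝒢.src g}) :=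
  A.smooth_act.comp (t := {q : G × Y | 𝒢.src q.1 = p q.2})
    (contMDiffOn_const.prodMk contMDiffOn_id) fun _ hy => hy.symm

/-- The homeomorphism of fibres given by an element of the groupoid. -/
def homeo (g : G) {u u' : M} (hu : 𝒢.src g = u) (hu' : 𝒢.tgt g = u') :
    ↥(p ⁻¹' {u}) ≃ₜ ↥(p ⁻¹' {u'}) where
  toFun x := ⟨A.act g x.1, (A.anchor_act (hu.trans x.2.symm)).trans hu'⟩
  invFun y := ⟨A.act (𝒢.inv g) y.1, (A.anchor_act_inv (hu'.trans y.2.symm)).trans hu⟩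
  left_inv x := Subtype.ext (A.inv_act (hu.trans x.2.symm))
  right_inv y := Subtype.ext (A.act_act_inv (hu'.trans y.2.symm))
  continuous_toFun := by
    refine Continuous.subtype_mk ?_ _
    refine (A.contMDiffOn_act g).continuousOn.comp_continuous continuous_subtype_val ?_
    exact fun x => x.2.trans hu.symm
  continuous_invFun := by
    refine Continuous.subtype_mk ?_ _
    refine (A.contMDiffOn_act (𝒢.inv g)).continuousOn.comp_continuous continuous_subtype_val ?_
    exact fun x => x.2.trans (hu'.symm.trans (𝒢.src_inv g).symm)

theorem homeo_inv (g : G) {u u' : M} (hu : 𝒢.src g = u) (hu' : 𝒢.tgt g = u') :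
    (A.homeo (𝒢.inv g) ((𝒢.src_inv g).trans hu') ((𝒢.tgt_inv g).trans hu)).symm =
      A.homeo g hu hu' := by
  ext x
  exact A.act_inv_inv (hu.trans x.2.symm)

end GManifold

end Action

/-! ## Invariance of the measures along the fibres -/

section Invariance

variable {dM dG dX dZ : ℕ} {M G X Z : Type*}
  [TopologicalSpace M] [ChartedSpace (EuclideanSpace ℝ (Fin dM)) M] [IsManifold (𝓡 dM) ∞ M]
  [TopologicalSpace G] [ChartedSpace (EuclideanSpace ℝ (Fin dG)) G]
  [TopologicalSpace X] [ChartedSpace (EuclideanSpace ℝ (Fin dX)) X] [IsManifold (𝓡 dX) ∞ X]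
  [TopologicalSpace Z] [ChartedSpace (EuclideanSpace ℝ (Fin dZ)) Z] [IsManifold (𝓡 dZ) ∞ Z]
  {𝒢 : LieGroupoid dM dG M G} {p : X → M} (A : GManifold 𝒢 (𝓡 dX) p)

/-- The action of `g` is meaningful only on one fibre, so its differential is taken within that
fibre; along a parametrization with open domain the composite is differentiable in the ordinary
sense. -/
theorem GManifold.hasMFDerivAt_act_comp (g : G) {j : ℕ} (ψ : FibreParam dX j p (𝒢.src g))
    {w : EuclideanSpace ℝ (Fin j)} (hw : w ∈ ψ.dom) :
    HasMFDerivAt (𝓡 j) (𝓡 dX) (A.act g ∘ ψ.toFun) w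
      ((mfderivWithin (𝓡 dX) (𝓡 dX) (A.act g) (p ⁻¹' {𝒢.src g}) (ψ.toFun w)).comp
        (mfderiv (𝓡 j) (𝓡 dX) ψ.toFun w)) := by
  have h1 : MDifferentiableWithinAt (𝓡 dX) (𝓡 dX) (A.act g) (p ⁻¹' {𝒢.src g}) (ψ.toFun w) :=
    (A.contMDiffOn_act g).mdifferentiableOn (by simp) _ (ψ.mem_fibre w hw)
  have h2 := (ψ.mdifferentiableAt hw).hasMFDerivAt.hasMFDerivWithinAt (s := ψ.dom)
  exact (h1.hasMFDerivWithinAt.comp w h2 fun w' hw' => ψ.mem_fibre w' hw').hasMFDerivAt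
    (ψ.isOpen_dom.mem_nhds hw)

/-- The translate of a parametrization of a fibre. -/
def GManifold.translate (g : G) {j : ℕ} (ψ : FibreParam dX j p (𝒢.src g)) :
    FibreParam dX j p (𝒢.tgt g) where
  dom := ψ.dom
  isOpen_dom := ψ.isOpen_dom
  toFun := A.act g ∘ ψ.toFun
  mem_fibre w hw := A.anchor_act (ψ.mem_fibre w hw).symm
  injOn w hw w' hw' h := ψ.injOn hw hw'
    (A.act_injective (ψ.mem_fibre w hw).symm (ψ.mem_fibre w' hw').symm h)
  smooth := (A.contMDiffOn_act g).comp ψ.smooth fun w hw => ψ.mem_fibre w hw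
  immersion w hw := by
    have h1 := (A.hasMFDerivAt_act_comp g ψ hw).mdifferentiableAt.hasMFDerivAt.hasMFDerivWithinAt
      (s := ψ.dom)
    have hm : ∀ w' ∈ ψ.dom, (A.act g ∘ ψ.toFun) w' ∈ p ⁻¹' {𝒢.src (𝒢.inv g)} := fun w' hw' =>
      (A.anchor_act (ψ.mem_fibre w' hw').symm).trans (𝒢.src_inv g).symm
    have h2 : MDifferentiableWithinAt (𝓡 dX) (𝓡 dX) (A.act (𝒢.inv g))
        (p ⁻¹' {𝒢.src (𝒢.inv g)}) ((A.act g ∘ ψ.toFun) w) :=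
      (A.contMDiffOn_act (𝒢.inv g)).mdifferentiableOn (by simp) _ (hm w hw)
    have h3 := (h2.hasMFDerivWithinAt.comp w h1 hm).hasMFDerivAt (ψ.isOpen_dom.mem_nhds hw)
    have h4 : HasMFDerivAt (𝓡 j) (𝓡 dX) (A.act (𝒢.inv g) ∘ A.act g ∘ ψ.toFun) w
        (mfderiv (𝓡 j) (𝓡 dX) ψ.toFun w) := by
      refine (ψ.mdifferentiableAt hw).hasMFDerivAt.congr_of_eventuallyEq ?_
      filter_upwards [ψ.isOpen_dom.mem_nhds hw] with w' hw'
      exact A.inv_act (ψ.mem_fibre w' hw').symm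
    -- Acting back with `inv g` recovers `ψ`, so the differential of the translate is injective
    -- because that of `ψ` is.
    have h5 := hasMFDerivAt_unique h4 h3
    intro v v' hv
    refine ψ.immersion w hw ?_
    have h6 : ∀ v, mfderiv (𝓡 j) (𝓡 dX) ψ.toFun w v = mfderivWithin (𝓡 dX) (𝓡 dX)
        (A.act (𝒢.inv g)) (p ⁻¹' {𝒢.src (𝒢.inv g)}) ((A.act g ∘ ψ.toFun) w)
        (mfderiv (𝓡 j) (𝓡 dX) (A.act g ∘ ψ.toFun) w v) := fun v => DFunLike.congr_fun h5 v
    exact (h6 v).trans ((congrArg _ hv).trans (h6 v').symm)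

/-- A vertical vector at `x` is tangent to a fibre parametrization, and the translate of that
parametrization stays in one fibre. -/
theorem GManifold.mfderivWithin_act_vertical {b : Trivialization Z p}
    (hb : SmoothTriv dM dX dZ b) (g : G) {x : X} (hgx : 𝒢.src g = p x) (hx : x ∈ b.source)
    (v : EuclideanSpace ℝ (Fin dX)) (hv : projDeriv dM p x v = 0) :
    projDeriv dM p (A.act g x)
      (mfderivWithin (𝓡 dX) (𝓡 dX) (A.act g) (p ⁻¹' {𝒢.src g}) x v) = 0 := by
  set e := chartAt (EuclideanSpace ℝ (Fin dZ)) (b x).2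
  have he : e ∈ IsManifold.maximalAtlas (𝓡 dZ) ∞ Z := IsManifold.chart_mem_maximalAtlas _
  have hxe : x ∈ trivDomain b e := ⟨hx, mem_chart_source _ _⟩
  have hu : 𝒢.src g ∈ b.baseSet := hgx ▸ proj_mem_of_mem_trivDomain hxe
  have h1 := hb.vertical_eq he hxe v hv
  rw [← hgx] at h1
  set w := trivCoord b e x
  have hw : w ∈ (hb.param he hu).dom := trivCoord_mem hxe
  set v₀ := mfderiv (𝓡 dX) (𝓡 dZ) (trivCoord b e) x v
  have h2 := (A.translate g (hb.param he hu)).mfderiv_vertical hb.smooth_proj hw v₀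
  have h3 : mfderiv (𝓡 dZ) (𝓡 dX) (A.translate g (hb.param he hu)).toFun w v₀ =
      mfderivWithin (𝓡 dX) (𝓡 dX) (A.act g) (p ⁻¹' {𝒢.src g}) ((hb.param he hu).toFun w)
        (mfderiv (𝓡 dZ) (𝓡 dX) (hb.param he hu).toFun w v₀) :=
    DFunLike.congr_fun (A.hasMFDerivAt_act_comp g (hb.param he hu) hw).mfderiv v₀
  have hxw : (hb.param he hu).toFun w = x := by
    have := trivParam_trivCoord hxe
    rw [← hgx] at this
    exact this
  have key : ∀ (y : X) (_ : y = x) (v' : EuclideanSpace ℝ (Fin dX)) (_ : v' = v),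
      projDeriv dM p (A.act g y)
        (mfderivWithin (𝓡 dX) (𝓡 dX) (A.act g) (p ⁻¹' {𝒢.src g}) y v') = 0 →
      projDeriv dM p (A.act g x)
        (mfderivWithin (𝓡 dX) (𝓡 dX) (A.act g) (p ⁻¹' {𝒢.src g}) x v) = 0 := by
    rintro y rfl v' rfl h
    exact h
  refine key _ hxw _ h1.symm ?_
  exact (congrArg _ h3.symm).trans h2

/-- The differential of `g` within the fibre sends the coordinate vectors of `ψ` to those of its
translate, and it preserves the metric. -/
theorem VerticalMetric.IsIsometric.gramVol_translate {m : VerticalMetric dX dM p}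
    (hm : m.IsIsometric A) {b : Trivialization Z p}
    (hb : SmoothTriv dM dX dZ b) (g : G) (hg : 𝒢.src g ∈ b.baseSet) {j : ℕ}
    (ψ : FibreParam dX j p (𝒢.src g)) {w : EuclideanSpace ℝ (Fin j)} (hw : w ∈ ψ.dom) :
    m.gramVol ((A.translate g ψ).toFun w) (coordVec dX (A.translate g ψ).toFun w) =
      m.gramVol (ψ.toFun w) (coordVec dX ψ.toFun w) := by
  set x := ψ.toFun w with hx
  have hgx : 𝒢.src g = p x := (ψ.mem_fibre w hw).symm
  have hxs : x ∈ b.source := b.mem_source.2 (hgx ▸ hg)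
  set D := mfderivWithin (𝓡 dX) (𝓡 dX) (A.act g) (p ⁻¹' {𝒢.src g}) x with hD
  let D₀ : EuclideanSpace ℝ (Fin dX) → EuclideanSpace ℝ (Fin dX) := D
  have hDv : ∀ v : VertTangent dX dM p x, D v ∈ VertTangent dX dM p (A.act g x) := fun v =>
    A.mfderivWithin_act_vertical hb g hgx hxs v.1 v.2
  let D' : VertTangent dX dM p x →ₗ[ℝ] VertTangent dX dM p (A.act g x) :=
    (D.toLinearMap.comp (VertTangent dX dM p x).subtype).codRestrict _ hDv
  have h1 : HasMFDerivWithinAt (𝓡 dX) (𝓡 dX) (A.act g) (p ⁻¹' {𝒢.src g}) x D :=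
    ((A.contMDiffOn_act g).mdifferentiableOn (by simp) _ hgx.symm).hasMFDerivWithinAt
  have h2 := hm g x hgx D D' h1 fun _ => rfl
  have hl : ∀ c, projDeriv dM p x (coordVec dX ψ.toFun w c) = 0 := fun c =>
    ψ.mfderiv_vertical A.submersion.contMDiff hw _
  have h3 : ∀ c, D' (vertVec dM p x (coordVec dX ψ.toFun w c)) =
      vertVec dM p (A.act g x) (coordVec dX (A.translate g ψ).toFun w c) := by
    intro c
    refine vertIncl_injective _ ?_
    have h4 : projDeriv dM p (A.act g x) (coordVec dX (A.translate g ψ).toFun w c) = 0 :=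
      (A.translate g ψ).mfderiv_vertical A.submersion.contMDiff hw _
    rw [vertIncl_vertVec h4]
    have h5 : coordVec dX (A.translate g ψ).toFun w c = D₀ (coordVec dX ψ.toFun w c) :=
      DFunLike.congr_fun (A.hasMFDerivAt_act_comp g ψ hw).mfderiv (EuclideanSpace.single c (1 : ℝ))
    rw [h5]
    exact congrArg D₀ (vertIncl_vertVec (hl c))
  have h6 : m.gramAt (A.act g x) (coordVec dX (A.translate g ψ).toFun w) =
      m.gramAt x (coordVec dX ψ.toFun w) := by
    ext a c
    have := h2 (1 ⊗ₜ vertVec dM p x (coordVec dX ψ.toFun w a))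
      (1 ⊗ₜ vertVec dM p x (coordVec dX ψ.toFun w c))
    rw [LinearMap.baseChange_tmul, LinearMap.baseChange_tmul, h3, h3] at this
    exact this
  exact congrArg (fun R : Matrix (Fin j) (Fin j) ℂ => √ ‖R.det‖) h6

variable [T1Space M] [MeasurableSpace X] [BorelSpace X]

/-- Translation embeds the parametrizations of the source fibre into those of the target fibre and
preserves local measures, so the supremum can only grow. -/
theorem VerticalMetric.IsIsometric.fibreMeasure_le {m : VerticalMetric dX dM p}
    (hm : m.IsIsometric A) {b : Trivialization Z p}
    (hb : SmoothTriv dM dX dZ b) (g : G) (hg : 𝒢.src g ∈ b.baseSet) :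
    m.fibreMeasure dZ (𝒢.src g) ≤
      (m.fibreMeasure dZ (𝒢.tgt g)).map (A.homeo g rfl rfl).symm := by
  set σ := A.homeo g rfl rfl with hσ
  have hval := hb.measurableEmbedding_fibre (𝒢.src g)
  have hval' := hb.measurableEmbedding_fibre (𝒢.tgt g)
  have hσm : Measurable σ.symm := σ.symm.continuous.measurable
  have h1 : (⨆ ψ : FibreParam dX dZ p (𝒢.src g), m.localMeasure ψ) ≤
      ((m.fibreMeasure dZ (𝒢.tgt g)).map σ.symm).map Subtype.val := by
    refine iSup_le fun ψ => Measure.le_iff.2 fun S hS => ?_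
    rw [Measure.map_apply hval.measurable hS, Measure.map_apply hσm (hval.measurable hS),
      VerticalMetric.fibreMeasure, hval'.comap_apply]
    set S' := (Subtype.val : ↥(p ⁻¹' {𝒢.tgt g}) → X) '' (σ.symm ⁻¹' (Subtype.val ⁻¹' S))
    have hS' : MeasurableSet S' := hval'.measurableSet_image.2 (hσm (hval.measurable hS))
    refine le_trans (le_of_eq ?_) (Measure.le_iff.1
      (le_iSup (fun ψ : FibreParam dX dZ p (𝒢.tgt g) => m.localMeasure ψ) (A.translate g ψ)) S' hS')
    rw [m.localMeasure_apply _ hS, m.localMeasure_apply _ hS']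
    have h2 : (A.translate g ψ).dom ∩ (A.translate g ψ).toFun ⁻¹' S' =
        ψ.dom ∩ ψ.toFun ⁻¹' S := by
      ext w
      refine and_congr_right fun hw => ?_
      constructor
      · rintro ⟨y, hy, hyw⟩
        have h3 : A.act (𝒢.inv g) y.1 ∈ S := hy
        have h4 : y.1 = A.act g (ψ.toFun w) := hyw
        rwa [h4, A.inv_act (ψ.mem_fibre w hw).symm] at h3
      · intro h3
        refine ⟨⟨A.act g (ψ.toFun w), A.anchor_act (ψ.mem_fibre w hw).symm⟩, ?_, rfl⟩
        change A.act (𝒢.inv g) (A.act g (ψ.toFun w)) ∈ S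
        rwa [A.inv_act (ψ.mem_fibre w hw).symm]
    rw [h2]
    refine setLIntegral_congr_fun (ψ.measurableSet_preimage hS) fun w hw => ?_
    exact congrArg ENNReal.ofReal (hm.gramVol_translate A hb g hg ψ hw.1).symm
  refine Measure.le_iff.2 fun S hS => ?_
  rw [VerticalMetric.fibreMeasure, hval.comap_apply]
  refine (h1 _).trans (le_of_eq ?_)
  rw [hval.map_apply, preimage_image_eq _ Subtype.val_injective]

/-- One inequality comes from `g`, the reverse one from `inv g`. -/
theorem VerticalMetric.IsIsometric.map_fibreMeasure {m : VerticalMetric dX dM p}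
    (hm : m.IsIsometric A)
    (htriv : ∀ u, ∃ b : Trivialization Z p, u ∈ b.baseSet ∧ SmoothTriv dM dX dZ b)
    (g : G) {u u' : M} (hu : 𝒢.src g = u) (hu' : 𝒢.tgt g = u') :
    (m.fibreMeasure dZ u).map (A.homeo g hu hu') = m.fibreMeasure dZ u' := by
  have hle : ∀ (g : G) {u u' : M} (hu : 𝒢.src g = u) (hu' : 𝒢.tgt g = u'),
      m.fibreMeasure dZ u ≤ (m.fibreMeasure dZ u').map (A.homeo g hu hu').symm := by
    rintro g u u' rfl rfl
    obtain ⟨b, hb, hbs⟩ := htriv (𝒢.src g)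
    exact hm.fibreMeasure_le A hbs g hb
  refine le_antisymm ?_ ?_
  · refine (Measure.map_mono (hle g hu hu') (Homeomorph.continuous _).measurable).trans
      (le_of_eq ?_)
    rw [Measure.map_map (Homeomorph.continuous _).measurable (Homeomorph.continuous _).measurable]
    simp
  · have := hle (𝒢.inv g) ((𝒢.src_inv g).trans hu') ((𝒢.tgt_inv g).trans hu)
    rwa [A.homeo_inv g hu hu'] at this

end Invariance

/-! ## Fibrewise operations on total spaces -/

section Total

variable {B : Type*} [TopologicalSpace B]
  {F : Type*} [NormedAddCommGroup F] [NormedSpace ℂ F]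
  {V : B → Type*} [TopologicalSpace (TotalSpace F V)]

/-- The value of an element of the total space in a fibre equal to the one over its projection. -/
def Bundle.TotalSpace.castFibre (w : TotalSpace F V) {z : B} (h : w.proj = z) : V z :=
  cast (congrArg V h) w.2

theorem Bundle.TotalSpace.mk_castFibre (w : TotalSpace F V) {z : B} (h : w.proj = z) :
    (⟨z, w.castFibre h⟩ : TotalSpace F V) = w := by
  subst h
  rfl

theorem continuous_pullback_mk {B' Y : Type*} [TopologicalSpace B'] [TopologicalSpace Y]
    {j : B' → B} {f : Y → B'} {s : ∀ y, V (j (f y))} (hf : Continuous f)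
    (hs : Continuous fun y => (⟨j (f y), s y⟩ : TotalSpace F V)) :
    Continuous fun y => (⟨f y, s y⟩ : TotalSpace F (j *ᵖ V)) := by
  rw [(inducing_pullbackTotalSpaceEmbedding F V j).continuous_iff]
  exact hf.prodMk hs

/-- Identities over a fibre `X^u` can thus be checked in the total space over `X`, where the axioms
of the action are stated. -/
theorem pullback_lift_injective {B' : Type*} {j : B' → B} (hj : Function.Injective j) :
    Function.Injective (Pullback.lift j : TotalSpace F (j *ᵖ V) → TotalSpace F V) := by
  rintro ⟨x, v⟩ ⟨y, w⟩ h
  have h1 : x = y := hj (congrArg TotalSpace.proj h)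
  subst h1
  have key : ∀ (z : B) (v w : V z), (⟨z, v⟩ : TotalSpace F V) = ⟨z, w⟩ → v = w :=
    fun _ _ _ h => TotalSpace.mk_inj.1 h
  exact congrArg (fun v : V (j x) => (⟨x, v⟩ : TotalSpace F (j *ᵖ V))) (key (j x) v w h)

variable [∀ x, AddCommGroup (V x)]
  [∀ x, Module ℂ (V x)] [∀ x, TopologicalSpace (V x)] [FiberBundle F V] [VectorBundle ℂ F V]

theorem continuous_smul_totalSpace :
    Continuous fun y : ℝ × TotalSpace F V =>
      (⟨y.2.proj, (y.1 : ℂ) • y.2.2⟩ : TotalSpace F V) := by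
  rw [continuous_iff_continuousAt]
  rintro ⟨c, v⟩
  rw [FiberBundle.continuousAt_totalSpace]
  have hp : Continuous fun y : ℝ × TotalSpace F V => y.2.proj :=
    (FiberBundle.continuous_proj F V).comp continuous_snd
  refine ⟨hp.continuousAt, ?_⟩
  dsimp only
  set e := trivializationAt F V v.proj with he
  have hv : v.proj ∈ e.baseSet := mem_baseSet_trivializationAt F V _
  have h1 : ContinuousAt (fun y : ℝ × TotalSpace F V => (y.1 : ℂ) • (e y.2).2) (c, v) := by
    refine ContinuousAt.smul (by fun_prop) ?_
    have : ContinuousAt e v := e.continuousAt (e.mem_source.2 hv)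
    exact continuousAt_snd.comp (this.comp (f := fun y : ℝ × TotalSpace F V => y.2) continuousAt_snd)
  refine h1.congr ?_
  filter_upwards [hp.continuousAt.preimage_mem_nhds (e.open_baseSet.mem_nhds hv)] with y hy
  exact ((e.linear ℂ hy).map_smul (y.1 : ℂ) y.2.2).symm

variable (F V) in
theorem finiteDimensional_fibre [FiniteDimensional ℂ F] (x : B) : FiniteDimensional ℂ (V x) :=
  ((trivializationAt F V x).linearEquivAt ℂ x
    (mem_baseSet_trivializationAt F V x)).symm.finiteDimensional

end Total

/-! ## Continuity of square roots of hermitian metrics -/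

section Transport

variable {W W' : Type*} [AddCommGroup W] [Module ℂ W] [AddCommGroup W'] [Module ℂ W']

/-- The transport of a sesquilinear form by a linear isomorphism. -/
def transportForm (L : W ≃ₗ[ℂ] W') (a : W →ₗ⋆[ℂ] W →ₗ[ℂ] ℂ) : W' →ₗ⋆[ℂ] W' →ₗ[ℂ] ℂ :=
  LinearMap.mk₂'ₛₗ _ _ (fun v w => a (L.symm v) (L.symm w)) (by simp) (by simp) (by simp) (by simp)

theorem transportForm_apply (L : W ≃ₗ[ℂ] W') (a : W →ₗ⋆[ℂ] W →ₗ[ℂ] ℂ) (v w : W') :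
    transportForm L a v w = a (L.symm v) (L.symm w) := rfl

theorem transportForm_apply_apply (L : W ≃ₗ[ℂ] W') (a : W →ₗ⋆[ℂ] W →ₗ[ℂ] ℂ) (v w : W) :
    transportForm L a (L v) (L w) = a v w := by
  rw [transportForm_apply, LinearEquiv.symm_apply_apply, LinearEquiv.symm_apply_apply]

theorem IsPosDefForm.transport {a : W →ₗ⋆[ℂ] W →ₗ[ℂ] ℂ} (ha : IsPosDefForm a)
    (L : W ≃ₗ[ℂ] W') : IsPosDefForm (transportForm L a) where
  conj_symm v w := ha.conj_symm _ _
  pos v hv := ha.pos _ (by simpa using hv)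

theorem IsSqrtForm.transport {a b : W →ₗ⋆[ℂ] W →ₗ[ℂ] ℂ} {S : W →ₗ[ℂ] W} (hS : IsSqrtForm a b S)
    (L : W ≃ₗ[ℂ] W') : IsSqrtForm (transportForm L a) (transportForm L b)
      (L.toLinearMap ∘ₗ S ∘ₗ L.symm.toLinearMap) where
  symm v w := by simpa [transportForm_apply] using hS.symm _ _
  nonneg v := by simpa [transportForm_apply] using hS.nonneg _
  sq v w := by simpa [transportForm_apply] using hS.sq _ _

end Transport

section Sqrt

variable {B : Type*} [TopologicalSpace B]
  {F : Type*} [NormedAddCommGroup F] [NormedSpace ℂ F]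
  {V : B → Type*} [TopologicalSpace (TotalSpace F V)] [∀ x, AddCommGroup (V x)]
  [∀ x, Module ℂ (V x)]

theorem HermitianMetric.isPosDefForm (a : HermitianMetric F V) (x : B) : IsPosDefForm (a.form x) :=
  ⟨a.conj_symm x, a.pos x⟩

variable [∀ x, TopologicalSpace (V x)] [FiberBundle F V] [VectorBundle ℂ F V]

theorem HermitianMetric.continuous_transport (a : HermitianMetric F V) (e : Trivialization F (π F V))
    [e.IsLinear ℂ] :
    Continuous fun x : e.baseSet × F => (transportForm (e.linearEquivAt ℂ x.1.1 x.1.2)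
      (a.form x.1.1) x.2 x.2).re := by
  have h1 : Continuous fun x : e.baseSet × F => e.toOpenPartialHomeomorph.symm (x.1.1, x.2) := by
    refine e.toOpenPartialHomeomorph.symm.continuousOn.comp_continuous (by fun_prop) fun x => ?_
    exact e.mem_target.2 x.1.2
  refine (a.continuous_sq.comp h1).congr fun x => ?_
  have h2 : e.toOpenPartialHomeomorph.symm (x.1.1, x.2) =
      ⟨x.1.1, (e.linearEquivAt ℂ x.1.1 x.1.2).symm x.2⟩ := (e.mk_symm x.1.2 x.2).symm
  simp only [Function.comp_apply]
  rw [h2]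
  rfl

/-- A local trivialization carries both metrics and the square root to families on the fixed space
`F`, to which `IsSqrtForm.continuous` applies. -/
theorem HermitianMetric.continuous_sqrt [FiniteDimensional ℂ F] (a b : HermitianMetric F V)
    {S : ∀ x, V x →ₗ[ℂ] V x} (hS : ∀ x, IsSqrtForm (a.form x) (b.form x) (S x)) :
    Continuous fun v : TotalSpace F V => (⟨v.proj, S v.proj v.2⟩ : TotalSpace F V) := by
  rw [continuous_iff_continuousAt]
  intro v
  rw [FiberBundle.continuousAt_totalSpace]
  refine ⟨(FiberBundle.continuous_proj F V).continuousAt, ?_⟩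
  dsimp only
  set e := trivializationAt F V v.proj with he
  have hv : v.proj ∈ e.baseSet := mem_baseSet_trivializationAt F V _
  let L : ∀ x : e.baseSet, V x.1 ≃ₗ[ℂ] F := fun x => e.linearEquivAt ℂ x.1 x.2
  have key := IsSqrtForm.continuous (Y := e.baseSet)
    (fun x => (a.isPosDefForm x.1).transport (L x)) (fun x => (b.isPosDefForm x.1).transport (L x))
    (a.continuous_transport e) (b.continuous_transport e) fun x => (hS x.1).transport (L x)
  have hsrc : IsOpen e.source := e.open_source
  have hmem : e.source ∈ 𝓝 v := hsrc.mem_nhds (e.mem_source.2 hv)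
  refine ContinuousOn.continuousAt ?_ hmem
  rw [continuousOn_iff_continuous_domRestrict]
  have h1 : Continuous fun w : e.source =>
      ((⟨w.1.proj, e.mem_source.1 w.2⟩ : e.baseSet), (e w.1).2) := by
    refine Continuous.prodMk (Continuous.subtype_mk
      ((FiberBundle.continuous_proj F V).comp continuous_subtype_val) _) ?_
    exact continuous_snd.comp (continuousOn_iff_continuous_domRestrict.1 e.continuousOn)
  refine (key.comp h1).congr fun w => ?_
  have h2 : (e w.1).2 = L ⟨w.1.proj, e.mem_source.1 w.2⟩ w.1.2 := rfl
  simp only [Function.comp_apply, LinearMap.comp_apply, LinearEquiv.coe_coe]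
  rw [h2, LinearEquiv.symm_apply_apply]
  rfl

/-- The positive square root of one hermitian form with respect to another one. -/
noncomputable def IsPosDefForm.sqrtEquiv {W : Type*} [AddCommGroup W] [Module ℂ W]
    [FiniteDimensional ℂ W] {a b : W →ₗ⋆[ℂ] W →ₗ[ℂ] ℂ} (ha : IsPosDefForm a)
    (hb : IsPosDefForm b) : W ≃ₗ[ℂ] W :=
  LinearEquiv.ofInjectiveEndo (ha.exists_sqrt hb).choose
    ((ha.exists_sqrt hb).choose_spec.injective hb)

theorem IsPosDefForm.isSqrtForm_sqrtEquiv {W : Type*} [AddCommGroup W] [Module ℂ W]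
    [FiniteDimensional ℂ W] {a b : W →ₗ⋆[ℂ] W →ₗ[ℂ] ℂ} (ha : IsPosDefForm a)
    (hb : IsPosDefForm b) : IsSqrtForm a b (ha.sqrtEquiv hb).toLinearMap :=
  (ha.exists_sqrt hb).choose_spec

theorem IsPosDefForm.isSqrtForm_sqrtEquiv_symm {W : Type*} [AddCommGroup W] [Module ℂ W]
    [FiniteDimensional ℂ W] {a b : W →ₗ⋆[ℂ] W →ₗ[ℂ] ℂ} (ha : IsPosDefForm a)
    (hb : IsPosDefForm b) : IsSqrtForm b a (ha.sqrtEquiv hb).symm.toLinearMap :=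
  (ha.isSqrtForm_sqrtEquiv hb).inverse fun v => (ha.sqrtEquiv hb).apply_symm_apply v

end Sqrt

/-! ## Composition of unitaries induced by conformal isomorphisms -/

section Conformal

variable {B B' B'' : Type*} [TopologicalSpace B] [MeasurableSpace B] [BorelSpace B]
  [TopologicalSpace B'] [MeasurableSpace B'] [BorelSpace B']
  [TopologicalSpace B''] [MeasurableSpace B''] [BorelSpace B'']
  [SecondCountableTopology B] [SecondCountableTopology B'] [SecondCountableTopology B'']
  {F F' F'' : Type*} [NormedAddCommGroup F] [NormedSpace ℂ F] [FiniteDimensional ℂ F]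
  [NormedAddCommGroup F'] [NormedSpace ℂ F'] [FiniteDimensional ℂ F']
  [NormedAddCommGroup F''] [NormedSpace ℂ F''] [FiniteDimensional ℂ F'']
  {V : B → Type*} [TopologicalSpace (TotalSpace F V)] [∀ x, AddCommGroup (V x)]
  [∀ x, Module ℂ (V x)] [∀ x, TopologicalSpace (V x)] [FiberBundle F V] [VectorBundle ℂ F V]
  {V' : B' → Type*} [TopologicalSpace (TotalSpace F' V')] [∀ x, AddCommGroup (V' x)]
  [∀ x, Module ℂ (V' x)] [∀ x, TopologicalSpace (V' x)] [FiberBundle F' V'] [VectorBundle ℂ F' V']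
  {V'' : B'' → Type*} [TopologicalSpace (TotalSpace F'' V'')] [∀ x, AddCommGroup (V'' x)]
  [∀ x, Module ℂ (V'' x)] [∀ x, TopologicalSpace (V'' x)] [FiberBundle F'' V'']
  [VectorBundle ℂ F'' V'']
  {h : HermitianMetric F V} {ν : Measure B} {h' : HermitianMetric F' V'}
  {ν' : Measure B'} {h'' : HermitianMetric F'' V''} {ν'' : Measure B''}

namespace ConformalIso

theorem unitary_toL2 (Θ : ConformalIso h ν h' ν') (f : h.SqIntegrable ν) :
    Θ.unitary f.toL2 = (Θ.push f).toL2 :=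
  (Θ.unitary_toL2_eq_iff f _).2 (.of_forall fun x => Θ.pushSec_base f.sec x)

/-- The hypothesis compares points of the total space because the base points on the two sides need
not be equal by definition. -/
theorem unitary_eq_comp (Θ₁ : ConformalIso h ν h' ν') (Θ₂ : ConformalIso h' ν' h'' ν'')
    (Θ : ConformalIso h ν h'' ν'')
    (hΘ : ∀ x v, (⟨Θ.base x, Θ.lin x v⟩ : TotalSpace F'' V'') =
      ⟨Θ₂.base (Θ₁.base x), Θ₂.lin _ (Θ₁.lin x v)⟩) (f : h.L2 ν) :
    Θ.unitary f = Θ₂.unitary (Θ₁.unitary f) := by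
  obtain ⟨f, rfl⟩ := HermitianMetric.toL2_surjective f
  rw [Θ₁.unitary_toL2, Θ₂.unitary_toL2, Θ.unitary_toL2_eq_iff]
  refine .of_forall fun x => ?_
  have h1 : Θ.base x = Θ₂.base (Θ₁.base x) := congrArg TotalSpace.proj (hΘ x 0)
  have h2 : (⟨Θ.base x, (Θ₂.push (Θ₁.push f)).sec (Θ.base x)⟩ : TotalSpace F'' V'') =
      ⟨Θ.base x, Θ.lin x (f.sec x)⟩ := by
    rw [hΘ, h1, push_sec, pushSec_base, push_sec, pushSec_base]
  exact TotalSpace.mk_inj.1 h2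

theorem unitary_eq_self (Θ : ConformalIso h ν h ν)
    (hΘ : ∀ x v, (⟨Θ.base x, Θ.lin x v⟩ : TotalSpace F V) = ⟨x, v⟩) (f : h.L2 ν) :
    Θ.unitary f = f := by
  obtain ⟨f, rfl⟩ := HermitianMetric.toL2_surjective f
  rw [Θ.unitary_toL2_eq_iff]
  refine .of_forall fun x => ?_
  have h1 : Θ.base x = x := congrArg TotalSpace.proj (hΘ x 0)
  have h2 : (⟨Θ.base x, f.sec (Θ.base x)⟩ : TotalSpace F V) = ⟨Θ.base x, Θ.lin x (f.sec x)⟩ := by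
    rw [hΘ, h1]
  exact TotalSpace.mk_inj.1 h2

end ConformalIso

end Conformal

/-! ## Charts of the family of `L²`-spaces -/

section L2Charts

variable {dM dX dZ : ℕ} {M X Z : Type*}
  [TopologicalSpace M] [ChartedSpace (EuclideanSpace ℝ (Fin dM)) M]
  [TopologicalSpace X] [ChartedSpace (EuclideanSpace ℝ (Fin dX)) X]
  [TopologicalSpace Z]
  {F : Type*} [NormedAddCommGroup F] [NormedSpace ℂ F]
  {VX : X → Type*} [TopologicalSpace (TotalSpace F VX)] [∀ x, AddCommGroup (VX x)]
  [∀ x, Module ℂ (VX x)]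
  {VZ : Z → Type*} [TopologicalSpace (TotalSpace F VZ)] [∀ z, AddCommGroup (VZ z)]
  [∀ z, Module ℂ (VZ z)] [∀ z, TopologicalSpace (VZ z)] [FiberBundle F VZ]
  {p : X → M} [MeasurableSpace X] [IsManifold (𝓡 dX) ∞ X] [MeasurableSpace Z]

/-- The fibre coordinate of a local trivialization. -/
def trivFibre (b : Trivialization Z p) : C(↥(p ⁻¹' b.baseSet), Z) :=
  ⟨fun x => (b x.1).2, continuous_snd.comp
    (b.toOpenPartialHomeomorph.continuousOn.comp_continuous (f := Subtype.val)
      continuous_subtype_val fun x => b.mem_source.2 x.2)⟩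

/-- The inclusion of a fibre into the part of `X` over an open set. -/
def fibreInto {u : M} {U : Set M} (hu : u ∈ U) (x : ↥(p ⁻¹' {u})) : ↥(p ⁻¹' U) :=
  ⟨x.1, mem_of_mem_fibre hu x⟩

/-- The inclusion of the part of `X` over a set. -/
def overIncl (p : X → M) (U : Set M) : C(↥(p ⁻¹' U), X) := ⟨Subtype.val, continuous_subtype_val⟩

variable (dZ) in
/-- A local trivialization `τ` of `X` over an open set covered by linear isomorphisms of the
fibres of `VX` and `VZ` which are conformal with a continuous factor, which is also the density of
the images of the fibre measures under `τ`. -/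
structure L2Chart (h : HermitianMetric F VX) (m : VerticalMetric dX dM p)
    (hZ : HermitianMetric F VZ) (μ : Measure Z) where
  base : Trivialization Z p
  lin : ∀ x : ↥(p ⁻¹' base.baseSet), VX x.1 ≃ₗ[ℂ] VZ (base x.1).2
  ratio : ↥(p ⁻¹' base.baseSet) → ℝ
  ratio_pos : ∀ x, 0 < ratio x
  continuous_ratio : Continuous ratio
  continuous_total : Continuous fun v : TotalSpace F (overIncl p base.baseSet *ᵖ VX) =>
    (⟨(base v.proj.1).2, lin v.proj v.2⟩ : TotalSpace F VZ)
  continuous_inv : Continuous fun v : TotalSpace F (trivFibre base *ᵖ VZ) =>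
    (⟨v.proj.1, (lin v.proj).symm v.2⟩ : TotalSpace F VX)
  conformal : ∀ x v, (hZ.form _ (lin x v) (lin x v)).re = ratio x * (h.form x.1 v v).re
  map_measure : ∀ u (hu : u ∈ base.baseSet),
    (m.fibreMeasure dZ u).map (base.preimageSingletonHomeomorph hu) =
      μ.withDensity fun z =>
        ENNReal.ofReal (ratio (fibreInto hu ((base.preimageSingletonHomeomorph hu).symm z)))

namespace L2Chart

variable {h : HermitianMetric F VX} {m : VerticalMetric dX dM p}
  {hZ : HermitianMetric F VZ} {μ : Measure Z} (c : L2Chart dZ h m hZ μ)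

/-- The inverse of the bundle map of a chart over `u`. -/
def invFun {u : M} (hu : u ∈ c.base.baseSet) (w : TotalSpace F VZ) :
    TotalSpace F (fibreIncl p u *ᵖ VX) :=
  ⟨(c.base.preimageSingletonHomeomorph hu).symm w.proj,
    (c.lin (fibreInto hu ((c.base.preimageSingletonHomeomorph hu).symm w.proj))).symm
      (w.castFibre ((c.base.preimageSingletonHomeomorph hu).apply_symm_apply w.proj).symm)⟩

theorem lin_symm_castFibre {x' x : ↥(p ⁻¹' c.base.baseSet)} (hx : x' = x) (v : VX x.1)
    (hw : (⟨(c.base x.1).2, c.lin x v⟩ : TotalSpace F VZ).proj = (c.base x'.1).2) :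
    (⟨x'.1, (c.lin x').symm (TotalSpace.castFibre _ hw)⟩ : TotalSpace F VX) = ⟨x.1, v⟩ := by
  subst hx
  have : TotalSpace.castFibre (⟨(c.base x'.1).2, c.lin x' v⟩ : TotalSpace F VZ) hw = c.lin x' v :=
    rfl
  rw [this, LinearEquiv.symm_apply_apply]

theorem continuous_invFun {Y : Type*} [TopologicalSpace Y] {f : Y → ↥(p ⁻¹' c.base.baseSet)}
    {w : Y → TotalSpace F VZ} (hf : Continuous f) (hw : Continuous w)
    (hfw : ∀ y, (w y).proj = (c.base (f y).1).2) :
    Continuous fun y => (⟨(f y).1, (c.lin (f y)).symm ((w y).castFibre (hfw y))⟩ :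
      TotalSpace F VX) := by
  have h1 : Continuous fun y => (⟨f y, (w y).castFibre (hfw y)⟩ :
      TotalSpace F (trivFibre c.base *ᵖ VZ)) := by
    refine continuous_pullback_mk hf ?_
    exact hw.congr fun y => ((w y).mk_castFibre (hfw y)).symm
  exact c.continuous_inv.comp h1

/-- The conformal isomorphism over a point given by a chart. -/
def conformalIso {u : M} (hu : u ∈ c.base.baseSet) :
    ConformalIso (h.pullback (fibreIncl p u)) (m.fibreMeasure dZ u) hZ μ where
  base := c.base.preimageSingletonHomeomorph hu
  lin x := c.lin (fibreInto hu x)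
  inv := c.invFun hu
  ratio x := c.ratio (fibreInto hu x)
  ratio_pos _ := c.ratio_pos _
  continuous_ratio := c.continuous_ratio.comp (continuous_subtype_val.subtype_mk _)
  continuous_total := by
    have h1 : Continuous fun v : TotalSpace F (fibreIncl p u *ᵖ VX) =>
        (⟨fibreInto hu v.proj, v.2⟩ : TotalSpace F (overIncl p c.base.baseSet *ᵖ VX)) :=
      continuous_pullback_mk (j := overIncl p c.base.baseSet)
        (f := fun v : TotalSpace F (fibreIncl p u *ᵖ VX) => fibreInto hu v.proj)
        (s := fun v => v.2) ((continuous_subtype_val.comp (Pullback.continuous_proj F VX _)).subtype_mk _)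
        (Pullback.continuous_lift F VX _)
    exact c.continuous_total.comp h1
  continuous_inv := by
    have h1 : Continuous fun w : TotalSpace F VZ =>
        (c.base.preimageSingletonHomeomorph hu).symm w.proj :=
      (Homeomorph.continuous _).comp (FiberBundle.continuous_proj F VZ)
    exact continuous_pullback_mk (j := fibreIncl p u) h1 (c.continuous_invFun
      (f := fun w : TotalSpace F VZ =>
        fibreInto hu ((c.base.preimageSingletonHomeomorph hu).symm w.proj))
      ((continuous_subtype_val.comp h1).subtype_mk _) continuous_id _)
  inv_apply x v := by
    refine pullback_lift_injective (j := fibreIncl p u) Subtype.val_injective ?_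
    let T := c.base.preimageSingletonHomeomorph hu
    exact c.lin_symm_castFibre (x' := fibreInto hu (T.symm (T x))) (x := fibreInto hu x)
      (congrArg (fibreInto hu) (T.symm_apply_apply x)) v (T.apply_symm_apply (T x)).symm
  conformal x v := c.conformal (fibreInto hu x) v
  map_measure := c.map_measure u hu

end L2Chart

end L2Charts

/-! ## The unitaries given by the groupoid action -/

section Translation

variable {dM dG dX dZ : ℕ} {M G X Z : Type*}
  [TopologicalSpace M] [ChartedSpace (EuclideanSpace ℝ (Fin dM)) M] [IsManifold (𝓡 dM) ∞ M]
  [T1Space M]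
  [TopologicalSpace G] [ChartedSpace (EuclideanSpace ℝ (Fin dG)) G]
  [TopologicalSpace X] [ChartedSpace (EuclideanSpace ℝ (Fin dX)) X] [IsManifold (𝓡 dX) ∞ X]
  [MeasurableSpace X] [BorelSpace X]
  [TopologicalSpace Z] [ChartedSpace (EuclideanSpace ℝ (Fin dZ)) Z] [IsManifold (𝓡 dZ) ∞ Z]
  {F : Type*} [NormedAddCommGroup F] [NormedSpace ℂ F]
  {VX : X → Type*} [TopologicalSpace (TotalSpace F VX)] [∀ x, AddCommGroup (VX x)]
  [∀ x, Module ℂ (VX x)] [∀ x, TopologicalSpace (VX x)] [FiberBundle F VX]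
  {𝒢 : LieGroupoid dM dG M G} {p : X → M} {A : GManifold 𝒢 (𝓡 dX) p}
  (ℰ : EquivariantStructure A F VX)

namespace EquivariantStructure

variable {h : HermitianMetric F VX} (hh : ℰ.IsIsometric h)
  {m : VerticalMetric dX dM p} (hm : m.IsIsometric A)
  (htriv : ∀ u, ∃ b : Trivialization Z p, u ∈ b.baseSet ∧ SmoothTriv dM dX dZ b)

/-- The isomorphism of the restrictions of `VX` to two fibres given by an element of the groupoid. -/
noncomputable def conformalIso (g : G) {u u' : M} (hu : 𝒢.src g = u) (hu' : 𝒢.tgt g = u') :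
    ConformalIso (h.pullback (fibreIncl p u)) (m.fibreMeasure dZ u)
      (h.pullback (fibreIncl p u')) (m.fibreMeasure dZ u') where
  base := A.homeo g hu hu'
  lin x := ℰ.lin g x.1 (hu.trans x.2.symm)
  inv w := ⟨(A.homeo g hu hu').symm w.proj,
    ℰ.lin (𝒢.inv g) w.proj.1 ((𝒢.src_inv g).trans (hu'.trans w.proj.2.symm)) w.2⟩
  -- The metric is `G`-isometric, and the fibre measures are therefore `G`-invariant.
  ratio _ := 1
  ratio_pos _ := one_pos
  continuous_ratio := continuous_const
  continuous_total := by
    refine continuous_pullback_mk (j := fibreIncl p u')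
      (f := fun v : TotalSpace F (fibreIncl p u *ᵖ VX) => A.homeo g hu hu' v.proj)
      ((Homeomorph.continuous _).comp (Pullback.continuous_proj F VX _)) ?_
    have h1 : Continuous fun v : TotalSpace F (fibreIncl p u *ᵖ VX) =>
        ℰ.total.act g (Pullback.lift (fibreIncl p u) v) :=
      (ℰ.total.contMDiffOn_act g).continuousOn.comp_continuous (Pullback.continuous_lift F VX _)
        fun v => v.proj.2.trans hu.symm
    exact h1.congr fun v => ℰ.act_eq g v.proj.1 (hu.trans v.proj.2.symm) v.2
  continuous_inv := by
    refine continuous_pullback_mk (j := fibreIncl p u)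
      (f := fun v : TotalSpace F (fibreIncl p u' *ᵖ VX) => (A.homeo g hu hu').symm v.proj)
      ((Homeomorph.continuous _).comp (Pullback.continuous_proj F VX _)) ?_
    have h1 : Continuous fun v : TotalSpace F (fibreIncl p u' *ᵖ VX) =>
        ℰ.total.act (𝒢.inv g) (Pullback.lift (fibreIncl p u') v) :=
      (ℰ.total.contMDiffOn_act (𝒢.inv g)).continuousOn.comp_continuous
        (Pullback.continuous_lift F VX _)
        fun v => v.proj.2.trans (hu'.symm.trans (𝒢.src_inv g).symm)
    exact h1.congr fun v => ℰ.act_eq (𝒢.inv g) v.proj.1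
      ((𝒢.src_inv g).trans (hu'.trans v.proj.2.symm)) v.2
  inv_apply x v := by
    refine pullback_lift_injective (j := fibreIncl p u) Subtype.val_injective ?_
    have hx : 𝒢.src g = p x.1 := hu.trans x.2.symm
    have h1 := ℰ.total.inv_act (g := g) (y := ⟨x.1, v⟩) hx
    rw [ℰ.act_eq g x.1 hx v, ℰ.act_eq (𝒢.inv g) (A.act g x.1)
      ((𝒢.src_inv g).trans (A.anchor_act hx).symm)] at h1
    exact h1
  conformal x v := by
    rw [one_mul]
    exact congrArg Complex.re (hh g x.1 (hu.trans x.2.symm) v v)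
  map_measure := by
    rw [hm.map_fibreMeasure A htriv g hu hu']
    simp only [ENNReal.ofReal_one]
    exact (withDensity_one).symm

variable [SecondCountableTopology X] [FiniteDimensional ℂ F] [VectorBundle ℂ F VX]

/-- The unitaries given by the elements of the groupoid. -/
noncomputable def unitary (g : G) {u u' : M} (hu : 𝒢.src g = u) (hu' : 𝒢.tgt g = u') :
    FibreL2 dZ h m u ≃ₗᵢ[ℂ] FibreL2 dZ h m u' :=
  (ℰ.conformalIso hh hm htriv g hu hu').unitary

theorem unitary_toL2_eq_iff (g : G) {u u' : M} (hu : 𝒢.src g = u) (hu' : 𝒢.tgt g = u')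
    (f : (h.pullback (fibreIncl p u)).SqIntegrable (m.fibreMeasure dZ u))
    (k : (h.pullback (fibreIncl p u')).SqIntegrable (m.fibreMeasure dZ u')) :
    ℰ.unitary hh hm htriv g hu hu' f.toL2 = k.toL2 ↔
      ∀ᵐ x ∂(m.fibreMeasure dZ u), fibreSec k (A.homeo g hu hu' x) =
        ℰ.lin g x.1 (hu.trans x.2.symm) (fibreSec f x) :=
  (ℰ.conformalIso hh hm htriv g hu hu').unitary_toL2_eq_iff f k

/-- The end points `u`, `u'`, `u''` are variables accompanied by equations, so that composites whose
fibres agree only up to such equations need no casts. -/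
theorem unitary_mul {g g' : G} (hgg' : 𝒢.src g = 𝒢.tgt g') {u u' u'' : M} (hu : 𝒢.src g' = u)
    (hu' : 𝒢.src g = u') (hu'' : 𝒢.tgt g = u'') (f : FibreL2 dZ h m u) :
    ℰ.unitary hh hm htriv (𝒢.mul g g') ((𝒢.src_mul hgg').trans hu) ((𝒢.tgt_mul hgg').trans hu'') f =
      ℰ.unitary hh hm htriv g hu' hu''
        (ℰ.unitary hh hm htriv g' hu (hgg'.symm.trans hu') f) := by
  refine ConformalIso.unitary_eq_comp _ _ _ (fun x v => ?_) f
  refine pullback_lift_injective (j := fibreIncl p u'') Subtype.val_injective ?_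
  have hx : 𝒢.src g' = p x.1 := hu.trans x.2.symm
  have h1 := ℰ.total.mul_act (g := g) (h := g') (y := ⟨x.1, v⟩) hgg' hx
  rw [ℰ.act_eq (𝒢.mul g g') x.1 ((𝒢.src_mul hgg').trans hx) v, ℰ.act_eq g' x.1 hx v,
    ℰ.act_eq g (A.act g' x.1) (hgg'.trans (A.anchor_act hx).symm)] at h1
  exact h1

theorem unitary_unit (u₀ : M) {u : M} (hu : 𝒢.src (𝒢.unit u₀) = u) (hu' : 𝒢.tgt (𝒢.unit u₀) = u)
    (f : FibreL2 dZ h m u) : ℰ.unitary hh hm htriv (𝒢.unit u₀) hu hu' f = f := by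
  have hu₀ : u₀ = u := (𝒢.src_unit u₀).symm.trans hu
  subst hu₀
  refine ConformalIso.unitary_eq_self _ (fun x v => ?_) f
  refine pullback_lift_injective (j := fibreIncl p u₀) Subtype.val_injective ?_
  have hx : p x.1 = u₀ := x.2
  have h1 := ℰ.total.act_unit ⟨x.1, v⟩
  simp only [hx] at h1
  rw [ℰ.act_eq (𝒢.unit u₀) x.1 (hu.trans hx.symm) v] at h1
  exact h1

theorem unitary_inv_apply (g : G) {u u' : M} (hu : 𝒢.src g = u) (hu' : 𝒢.tgt g = u')
    (f : FibreL2 dZ h m u) :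
    ℰ.unitary hh hm htriv (𝒢.inv g) ((𝒢.src_inv g).trans hu') ((𝒢.tgt_inv g).trans hu)
      (ℰ.unitary hh hm htriv g hu hu' f) = f := by
  have h1 := ℰ.unitary_mul hh hm htriv (g := 𝒢.inv g) (g' := g) (𝒢.src_inv g) hu
    ((𝒢.src_inv g).trans hu') ((𝒢.tgt_inv g).trans hu) f
  rw [← h1]
  have key : ∀ (a b : G) (_ : a = b) (ha : 𝒢.src a = u) (ha' : 𝒢.tgt a = u)
      (hb : 𝒢.src b = u) (hb' : 𝒢.tgt b = u),
      ℰ.unitary hh hm htriv a ha ha' f = ℰ.unitary hh hm htriv b hb hb' f := by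
    rintro a b rfl _ _ _ _
    rfl
  rw [key _ _ (𝒢.inv_mul g) _ _ ((𝒢.src_unit _).trans hu) ((𝒢.tgt_unit _).trans hu),
    ℰ.unitary_unit hh hm htriv]

end EquivariantStructure

end Translation

/-! ## Continuity of the action in charts -/

section Kernel

variable {dM dG dX dZ : ℕ} {M G X Z : Type*}
  [TopologicalSpace M] [ChartedSpace (EuclideanSpace ℝ (Fin dM)) M] [IsManifold (𝓡 dM) ∞ M]
  [T1Space M]
  [TopologicalSpace G] [ChartedSpace (EuclideanSpace ℝ (Fin dG)) G]
  [TopologicalSpace X] [ChartedSpace (EuclideanSpace ℝ (Fin dX)) X] [IsManifold (𝓡 dX) ∞ X]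
  [MeasurableSpace X] [BorelSpace X] [SecondCountableTopology X]
  [TopologicalSpace Z] [ChartedSpace (EuclideanSpace ℝ (Fin dZ)) Z] [IsManifold (𝓡 dZ) ∞ Z]
  [T2Space Z] [SecondCountableTopology Z] [CompactSpace Z]
  [MeasurableSpace Z] [BorelSpace Z]
  {F : Type*} [NormedAddCommGroup F] [NormedSpace ℂ F] [FiniteDimensional ℂ F]
  {VX : X → Type*} [TopologicalSpace (TotalSpace F VX)] [∀ x, AddCommGroup (VX x)]
  [∀ x, Module ℂ (VX x)] [∀ x, TopologicalSpace (VX x)] [FiberBundle F VX] [VectorBundle ℂ F VX]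
  {VZ : Z → Type*} [TopologicalSpace (TotalSpace F VZ)] [∀ z, AddCommGroup (VZ z)]
  [∀ z, Module ℂ (VZ z)] [∀ z, TopologicalSpace (VZ z)] [FiberBundle F VZ] [VectorBundle ℂ F VZ]
  {𝒢 : LieGroupoid dM dG M G} {p : X → M} {A : GManifold 𝒢 (𝓡 dX) p}
  (ℰ : EquivariantStructure A F VX)
  {h : HermitianMetric F VX} (hh : ℰ.IsIsometric h)
  {m : VerticalMetric dX dM p} (hm : m.IsIsometric A)
  (htriv : ∀ u, ∃ b : Trivialization Z p, u ∈ b.baseSet ∧ SmoothTriv dM dX dZ b)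
  {hZ : HermitianMetric F VZ} {μ : Measure Z} (c c' : L2Chart dZ h m hZ μ)

theorem L2Chart.continuous_totalFun {Y : Type*} [TopologicalSpace Y]
    {f : Y → ↥(p ⁻¹' c.base.baseSet)}
    {w : Y → TotalSpace F VX} (hf : Continuous f) (hw : Continuous w)
    (hfw : ∀ y, (w y).proj = (f y).1) :
    Continuous fun y => (⟨(c.base (f y).1).2, c.lin (f y) ((w y).castFibre (hfw y))⟩ :
      TotalSpace F VZ) := by
  have h1 : Continuous fun y => (⟨f y, (w y).castFibre (hfw y)⟩ :
      TotalSpace F (overIncl p c.base.baseSet *ᵖ VX)) := by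
    refine continuous_pullback_mk (j := overIncl p c.base.baseSet) hf ?_
    exact hw.congr fun y => ((w y).mk_castFibre (hfw y)).symm
  exact c.continuous_total.comp h1

/-- The unitary over a point given by a chart. -/
noncomputable def L2Chart.unitary {u : M} (hu : u ∈ c.base.baseSet) :
    FibreL2 dZ h m u ≃ₗᵢ[ℂ] hZ.L2 μ := (c.conformalIso hu).unitary

/-- The unitary `L_g` in charts. -/
noncomputable def EquivariantStructure.kernel (g : G) (hs : 𝒢.src g ∈ c.base.baseSet)
    (ht : 𝒢.tgt g ∈ c'.base.baseSet) : hZ.L2 μ ≃ₗᵢ[ℂ] hZ.L2 μ :=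
  ((c.unitary hs).symm.trans (ℰ.unitary hh hm htriv g rfl rfl)).trans (c'.unitary ht)

/-- All kernels are isometries, hence Lipschitz with constant `1`, so continuity in `g` for each
vector of a dense set already gives joint continuity. For a continuous section `k` the kernel gives
the section with value `χ' (g (χ⁻¹ k))` at `z`, where `χ` and `χ'` are the bundle maps of the two
charts; this is jointly continuous in `g` and `z`. -/
theorem EquivariantStructure.continuous_kernel [IsFiniteMeasure μ] [μ.WeaklyRegular] :
    Continuous fun y : {g // 𝒢.src g ∈ c.base.baseSet ∧ 𝒢.tgt g ∈ c'.base.baseSet} × hZ.L2 μ =>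
      ℰ.kernel hh hm htriv c c' y.1.1 y.1.2.1 y.1.2.2 y.2 := by
  set Y := {g // 𝒢.src g ∈ c.base.baseSet ∧ 𝒢.tgt g ∈ c'.base.baseSet} with hY
  have hswap : Continuous fun y : hZ.L2 μ × Y =>
      ℰ.kernel hh hm htriv c c' y.2.1 y.2.2.1 y.2.2.2 y.1 := by
    refine continuous_prod_of_dense_continuous_lipschitzWith _ 1
      (hZ.dense_continuous_sections μ) ?_ fun y =>
        (ℰ.kernel hh hm htriv c c' y.1 y.2.1 y.2.2).lipschitz
    rintro _ ⟨k, hk, rfl⟩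
    let K : ∀ y : Y, ConformalIso (h.pullback (fibreIncl p (𝒢.src y.1)))
      (m.fibreMeasure dZ (𝒢.src y.1)) (h.pullback (fibreIncl p (𝒢.tgt y.1)))
      (m.fibreMeasure dZ (𝒢.tgt y.1)) := fun y => ℰ.conformalIso hh hm htriv y.1 rfl rfl
    let s : Y → hZ.SqIntegrable μ := fun y =>
      (c'.conformalIso y.2.2).push ((K y).push ((c.conformalIso y.2.1).pull k))
    have hs : ∀ y : Y, ℰ.kernel hh hm htriv c c' y.1 y.2.1 y.2.2 k.toL2 = (s y).toL2 := by
      intro y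
      have h1 : (c.unitary y.2.1).symm k.toL2 = ((c.conformalIso y.2.1).pull k).toL2 :=
        (c.conformalIso y.2.1).unitary_symm_toL2 k
      have h2 := (K y).unitary_toL2 ((c.conformalIso y.2.1).pull k)
      have h3 := (c'.conformalIso y.2.2).unitary_toL2 ((K y).push ((c.conformalIso y.2.1).pull k))
      rw [← h3, ← h2, ← h1]
      rfl
    refine (HermitianMetric.continuous_toL2 s ?_).congr fun y => (hs y).symm
    -- the points of `X` corresponding to the points of `Z`
    let x' : Y × Z → ↥(p ⁻¹' c'.base.baseSet) := fun y =>
      fibreInto y.1.2.2 ((c'.base.preimageSingletonHomeomorph y.1.2.2).symm y.2)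
    have hx' : Continuous x' := by
      refine Continuous.subtype_mk ?_ _
      have h1 : Continuous fun y : Y × Z => (𝒢.tgt y.1.1, y.2) :=
        (𝒢.continuous_tgt.comp (continuous_subtype_val.comp continuous_fst)).prodMk continuous_snd
      exact c'.base.toOpenPartialHomeomorph.symm.continuousOn.comp_continuous h1
        fun y => c'.base.mem_target.2 y.1.2.2
    have hpx' : ∀ y, p (x' y).1 = 𝒢.tgt y.1.1 := fun y =>
      ((c'.base.preimageSingletonHomeomorph y.1.2.2).symm y.2).2
    -- The point `g⁻¹ x'` of the source fibre; `w` is the vector over it given by `k` through the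
    -- first chart, and `v = g w` lies over `x'`.
    let x : Y × Z → ↥(p ⁻¹' c.base.baseSet) := fun y =>
      ⟨A.act (𝒢.inv y.1.1) (x' y).1, by
        have h1 := A.anchor_act_inv (hpx' y).symm
        rw [mem_preimage, h1]
        exact y.1.2.1⟩
    have hx : Continuous x := by
      refine Continuous.subtype_mk ?_ _
      have h1 : Continuous fun y : Y × Z => (𝒢.inv y.1.1, (x' y).1) :=
        (𝒢.smooth_inv.continuous.comp (continuous_subtype_val.comp continuous_fst)).prodMk
          (continuous_subtype_val.comp hx')
      exact A.continuousOn_act.comp_continuous h1 fun y => (𝒢.src_inv _).trans (hpx' y).symm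
    have hpx : ∀ y, p (x y).1 = 𝒢.src y.1.1 := fun y => A.anchor_act_inv (hpx' y).symm
    let w : Y × Z → TotalSpace F VX := fun y =>
      ⟨(x y).1, (c.lin (x y)).symm (k.sec (c.base (x y).1).2)⟩
    have hw : Continuous w := by
      refine c.continuous_invFun (f := x)
        (w := fun y => ⟨(c.base (x y).1).2, k.sec (c.base (x y).1).2⟩) hx ?_ fun y => rfl
      exact hk.comp ((trivFibre c.base).continuous.comp hx)
    let v : Y × Z → TotalSpace F VX := fun y => ℰ.total.act y.1.1 (w y)
    have hv : Continuous v := by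
      have h1 : Continuous fun y : Y × Z => (y.1.1, w y) :=
        (continuous_subtype_val.comp continuous_fst).prodMk hw
      exact ℰ.total.continuousOn_act.comp_continuous h1 fun y => (hpx y).symm
    have hvx : ∀ y, (v y).proj = (x' y).1 := by
      intro y
      have h1 := ℰ.act_eq y.1.1 (x y).1 (hpx y).symm ((c.lin (x y)).symm (k.sec (c.base (x y).1).2))
      refine (congrArg TotalSpace.proj h1).trans ?_
      exact A.act_act_inv (hpx' y).symm
    -- The explicit formula is continuous; what remains is to identify it with `s`, which is done in
    -- total spaces to avoid casts.
    refine (c'.continuous_totalFun hx' hv hvx).congr fun y => ?_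
    have e1 := (c'.conformalIso y.1.2.2).mk_pushSec
      ((K y.1).push ((c.conformalIso y.1.2.1).pull k)).sec y.2
    refine Eq.trans ?_ e1.symm
    have e2 := congrArg (Pullback.lift (fibreIncl p (𝒢.tgt y.1.1)))
      ((K y.1).mk_pushSec ((c.conformalIso y.1.2.1).pull k).sec
        ((c'.base.preimageSingletonHomeomorph y.1.2.2).symm y.2))
    have e3 := ℰ.act_eq y.1.1 (x y).1 (hpx y).symm
      ((c.lin (x y)).symm (k.sec (c.base (x y).1).2))
    have e4 : (⟨(x' y).1, (v y).castFibre (hvx y)⟩ : TotalSpace F VX) =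
        ⟨(x' y).1, (K y.1).pushSec ((c.conformalIso y.1.2.1).pull k).sec
          ((c'.base.preimageSingletonHomeomorph y.1.2.2).symm y.2)⟩ :=
      ((v y).mk_castFibre (hvx y)).trans (e3.trans e2.symm)
    have key : ∀ (x : ↥(p ⁻¹' c'.base.baseSet)) (ξ ξ' : VX x.1),
        (⟨x.1, ξ⟩ : TotalSpace F VX) = ⟨x.1, ξ'⟩ →
        (⟨(c'.base x.1).2, c'.lin x ξ⟩ : TotalSpace F VZ) = ⟨(c'.base x.1).2, c'.lin x ξ'⟩ := by
      intro x ξ ξ' h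
      rw [TotalSpace.mk_inj.1 h]
    exact key (x' y) _ _ e4
  exact Continuous.comp (g := fun y : hZ.L2 μ × Y =>
      ℰ.kernel hh hm htriv c c' y.2.1 y.2.2.1 y.2.2.2 y.1)
    (f := fun y : Y × hZ.L2 μ => (y.2, y.1)) hswap continuous_swap

end Kernel

/-! ## The unitary charts induced by the charts of the bundle -/

section ChartOfBundleChart

variable {dM dX dZ : ℕ} {M X Z : Type*}
  [TopologicalSpace M] [ChartedSpace (EuclideanSpace ℝ (Fin dM)) M]
  [TopologicalSpace X] [ChartedSpace (EuclideanSpace ℝ (Fin dX)) X]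
  [TopologicalSpace Z] [ChartedSpace (EuclideanSpace ℝ (Fin dZ)) Z]
  {F : Type*} [NormedAddCommGroup F] [NormedSpace ℂ F] [FiniteDimensional ℂ F]
  {VX : X → Type*} [TopologicalSpace (TotalSpace F VX)] [∀ x, AddCommGroup (VX x)]
  [∀ x, Module ℂ (VX x)] [∀ x, TopologicalSpace (VX x)] [FiberBundle F VX]
  {VZ : Z → Type*} [TopologicalSpace (TotalSpace F VZ)] [∀ z, AddCommGroup (VZ z)]
  [∀ z, Module ℂ (VZ z)] [∀ z, TopologicalSpace (VZ z)] [FiberBundle F VZ] [VectorBundle ℂ F VZ]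
  {p : X → M}

namespace BundleChart

variable (φ : BundleChart dM dX dZ p F VX VZ)

theorem smoothTriv (hp : ContMDiff (𝓡 dX) (𝓡 dM) ∞ p) : SmoothTriv dM dX dZ φ.base :=
  ⟨hp, φ.smooth_base, φ.smooth_base_symm⟩

theorem continuous_lin :
    Continuous fun v : TotalSpace F (overIncl p φ.base.baseSet *ᵖ VX) =>
      (⟨v.proj, φ.lin v.proj.1 v.proj.2 v.2⟩ : TotalSpace F (trivFibre φ.base *ᵖ VZ)) := by
  refine continuous_pullback_mk (j := trivFibre φ.base)
    (f := fun v : TotalSpace F (overIncl p φ.base.baseSet *ᵖ VX) => v.proj)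
    (Pullback.continuous_proj F VX _) ?_
  have h1 : Continuous fun v : TotalSpace F (overIncl p φ.base.baseSet *ᵖ VX) =>
      φ.total (Pullback.lift (overIncl p φ.base.baseSet) v) := by
    refine φ.total.toOpenPartialHomeomorph.continuousOn.comp_continuous
      (Pullback.continuous_lift F VX _) fun v => φ.total.mem_source.2 ?_
    rw [φ.baseSet_eq]
    exact v.proj.2
  exact (continuous_snd.comp h1).congr fun v =>
    congrArg Prod.snd (φ.total_apply v.proj.1 v.proj.2 v.2)

/-- The fibrewise inverses are assembled by the inverse of the total chart, which is continuous. -/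
theorem continuous_lin_symm :
    Continuous fun v : TotalSpace F (trivFibre φ.base *ᵖ VZ) =>
      (⟨v.proj.1, (φ.lin v.proj.1 v.proj.2).symm v.2⟩ : TotalSpace F VX) := by
  have hmem : ∀ v : TotalSpace F (trivFibre φ.base *ᵖ VZ), p v.proj.1 ∈ φ.total.baseSet := by
    intro v
    rw [φ.baseSet_eq]
    exact v.proj.2
  have hp : ContinuousOn p φ.base.source := φ.base.continuousOn_proj
  have h1 : Continuous fun v : TotalSpace F (trivFibre φ.base *ᵖ VZ) =>
      (p v.proj.1, Pullback.lift (trivFibre φ.base) v) := by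
    refine Continuous.prodMk ?_ (Pullback.continuous_lift F VZ _)
    exact hp.comp_continuous
      (continuous_subtype_val.comp (Pullback.continuous_proj F VZ (trivFibre φ.base)))
      fun v => φ.base.mem_source.2 v.proj.2
  have h2 := φ.total.toOpenPartialHomeomorph.symm.continuousOn.comp_continuous h1
    fun v => φ.total.mem_target.2 (hmem v)
  refine h2.congr fun v => ?_
  have key : ∀ (x : X) (hx : p x ∈ φ.base.baseSet) (w : VZ (φ.base x).2),
      φ.total ⟨x, (φ.lin x hx).symm w⟩ = (p x, ⟨(φ.base x).2, w⟩) := by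
    intro x hx w
    rw [φ.total_apply x hx, LinearEquiv.apply_symm_apply]
  have h3 := key v.proj.1 v.proj.2 v.2
  have h4 : φ.total.toOpenPartialHomeomorph.symm (φ.total
      ⟨v.proj.1, (φ.lin v.proj.1 v.proj.2).symm v.2⟩) =
      ⟨v.proj.1, (φ.lin v.proj.1 v.proj.2).symm v.2⟩ :=
    φ.total.toOpenPartialHomeomorph.left_inv (φ.total.mem_source.2 (hmem v))
  rw [h3] at h4
  exact h4

/-- The transport of the hermitian metric on `VX` to the pullback of `VZ`. -/
noncomputable def transportMetric (h : HermitianMetric F VX) :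
    HermitianMetric F (trivFibre φ.base *ᵖ VZ) where
  form x := transportForm (φ.lin x.1 x.2) (h.form x.1)
  conj_symm x _ _ := h.conj_symm x.1 _ _
  pos x := ((h.isPosDefForm x.1).transport (φ.lin x.1 x.2)).pos
  continuous_sq := h.continuous_sq.comp φ.continuous_lin_symm

/-- The positive square root of the endomorphism which relates the metrics on `VX` and `VZ`. -/
noncomputable def sqrt (h : HermitianMetric F VX) (hZ : HermitianMetric F VZ)
    (x : ↥(p ⁻¹' φ.base.baseSet)) : VZ (φ.base x.1).2 ≃ₗ[ℂ] VZ (φ.base x.1).2 :=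
  have := finiteDimensional_fibre F VZ (φ.base x.1).2
  (hZ.isPosDefForm (φ.base x.1).2).sqrtEquiv ((h.isPosDefForm x.1).transport (φ.lin x.1 x.2))

variable (h : HermitianMetric F VX) (hZ : HermitianMetric F VZ)

theorem isSqrtForm_sqrt (x : ↥(p ⁻¹' φ.base.baseSet)) :
    IsSqrtForm (hZ.form (φ.base x.1).2) (transportForm (φ.lin x.1 x.2) (h.form x.1))
      (φ.sqrt h hZ x).toLinearMap :=
  have := finiteDimensional_fibre F VZ (φ.base x.1).2
  (hZ.isPosDefForm (φ.base x.1).2).isSqrtForm_sqrtEquiv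
    ((h.isPosDefForm x.1).transport (φ.lin x.1 x.2))

theorem isSqrtForm_sqrt_symm (x : ↥(p ⁻¹' φ.base.baseSet)) :
    IsSqrtForm (transportForm (φ.lin x.1 x.2) (h.form x.1)) (hZ.form (φ.base x.1).2)
      (φ.sqrt h hZ x).symm.toLinearMap :=
  have := finiteDimensional_fibre F VZ (φ.base x.1).2
  (hZ.isPosDefForm (φ.base x.1).2).isSqrtForm_sqrtEquiv_symm
    ((h.isPosDefForm x.1).transport (φ.lin x.1 x.2))

theorem continuous_sqrt :
    Continuous fun v : TotalSpace F (trivFibre φ.base *ᵖ VZ) =>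
      (⟨v.proj, φ.sqrt h hZ v.proj v.2⟩ : TotalSpace F (trivFibre φ.base *ᵖ VZ)) :=
  HermitianMetric.continuous_sqrt (V := trivFibre φ.base *ᵖ VZ) (hZ.pullback (trivFibre φ.base))
    (φ.transportMetric h) (S := fun x => (φ.sqrt h hZ x).toLinearMap)
    fun x => φ.isSqrtForm_sqrt h hZ x

theorem continuous_sqrt_symm :
    Continuous fun v : TotalSpace F (trivFibre φ.base *ᵖ VZ) =>
      (⟨v.proj, (φ.sqrt h hZ v.proj).symm v.2⟩ : TotalSpace F (trivFibre φ.base *ᵖ VZ)) :=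
  HermitianMetric.continuous_sqrt (V := trivFibre φ.base *ᵖ VZ) (φ.transportMetric h)
    (hZ.pullback (trivFibre φ.base)) (S := fun x => (φ.sqrt h hZ x).symm.toLinearMap)
    fun x => φ.isSqrtForm_sqrt_symm h hZ x

variable [IsManifold (𝓡 dM) ∞ M] [T1Space M] [IsManifold (𝓡 dX) ∞ X] [IsManifold (𝓡 dZ) ∞ Z]
  [MeasurableSpace X] [BorelSpace X] [T2Space Z] [SecondCountableTopology Z] [CompactSpace Z]
  [MeasurableSpace Z] [BorelSpace Z]
  (hp : ContMDiff (𝓡 dX) (𝓡 dM) ∞ p) (m : VerticalMetric dX dM p) {μ : Measure Z}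
  (hμ : IsSmoothMeasure (d := dZ) μ)

/-- The density of the images of the measures on the fibres. -/
noncomputable def density : M → Z → ℝ := ((φ.smoothTriv hp).exists_density m hμ).choose

theorem density_pos {u : M} (hu : u ∈ φ.base.baseSet) (z : Z) : 0 < φ.density hp m hμ u z :=
  ((φ.smoothTriv hp).exists_density m hμ).choose_spec.1 u hu z

theorem continuousOn_density :
    ContinuousOn (fun y : M × Z => φ.density hp m hμ y.1 y.2) (φ.base.baseSet ×ˢ univ) :=
  ((φ.smoothTriv hp).exists_density m hμ).choose_spec.2.1

theorem map_fibreMeasure {u : M} (hu : u ∈ φ.base.baseSet) :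
    (m.fibreMeasure dZ u).map (φ.base.preimageSingletonHomeomorph hu) =
      μ.withDensity fun z => ENNReal.ofReal (φ.density hp m hμ u z) :=
  ((φ.smoothTriv hp).exists_density m hμ).choose_spec.2.2 u hu

theorem continuous_density :
    Continuous fun x : ↥(p ⁻¹' φ.base.baseSet) => φ.density hp m hμ (p x.1) (φ.base x.1).2 := by
  have h1 : Continuous fun x : ↥(p ⁻¹' φ.base.baseSet) => (p x.1, (φ.base x.1).2) :=
    (hp.continuous.comp continuous_subtype_val).prodMk (trivFibre φ.base).continuous
  exact (φ.continuousOn_density hp m hμ).comp_continuous h1 fun x => ⟨x.2, mem_univ _⟩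

/-- The chart of the family of `L²`-spaces given by a chart of the bundle. -/
noncomputable def toL2Chart : L2Chart dZ h m hZ μ where
  base := φ.base
  -- This is `r^{1/2} A^{1/2} φ`.
  lin x := (φ.lin x.1 x.2 ≪≫ₗ φ.sqrt h hZ x) ≪≫ₗ LinearEquiv.smulOfNeZero ℂ _
    ((√ (φ.density hp m hμ (p x.1) (φ.base x.1).2) : ℝ) : ℂ)
    (Complex.ofReal_ne_zero.2 (Real.sqrt_pos.2 (φ.density_pos hp m hμ x.2 _)).ne')
  ratio x := φ.density hp m hμ (p x.1) (φ.base x.1).2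
  ratio_pos x := φ.density_pos hp m hμ x.2 _
  continuous_ratio := φ.continuous_density hp m hμ
  continuous_total := by
    have h1 := (Pullback.continuous_lift F VZ (trivFibre φ.base)).comp
      ((φ.continuous_sqrt h hZ).comp φ.continuous_lin)
    have h2 : Continuous fun v : TotalSpace F (overIncl p φ.base.baseSet *ᵖ VX) =>
        √ (φ.density hp m hμ (p v.proj.1) (φ.base v.proj.1).2) :=
      ((φ.continuous_density hp m hμ).comp (Pullback.continuous_proj F VX
        (overIncl p φ.base.baseSet))).sqrt
    exact continuous_smul_totalSpace.comp (h2.prodMk h1)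
  continuous_inv := by
    have h2 : Continuous fun v : TotalSpace F (trivFibre φ.base *ᵖ VZ) =>
        (√ (φ.density hp m hμ (p v.proj.1) (φ.base v.proj.1).2))⁻¹ := by
      refine Continuous.inv₀ ((φ.continuous_density hp m hμ).comp (Pullback.continuous_proj F VZ
        (trivFibre φ.base))).sqrt fun v => ?_
      exact (Real.sqrt_pos.2 (φ.density_pos hp m hμ v.proj.2 _)).ne'
    have h3 := (continuous_smul_totalSpace (V := trivFibre φ.base *ᵖ VZ)).comp
      (h2.prodMk continuous_id)
    refine (φ.continuous_lin_symm.comp ((φ.continuous_sqrt_symm h hZ).comp h3)).congr fun v => ?_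
    have key : ∀ (x : ↥(p ⁻¹' φ.base.baseSet)) (c : ℝ) (hc : (c : ℂ) ≠ 0) (w : VZ (φ.base x.1).2),
        (φ.lin x.1 x.2).symm ((φ.sqrt h hZ x).symm (((c⁻¹ : ℝ) : ℂ) • w)) =
        ((φ.lin x.1 x.2 ≪≫ₗ φ.sqrt h hZ x) ≪≫ₗ
          LinearEquiv.smulOfNeZero ℂ _ (c : ℂ) hc).symm w := by
      intro x c hc w
      rw [LinearEquiv.eq_symm_apply]
      simp [-Complex.coe_smul, smul_smul, hc]
    exact congrArg (TotalSpace.mk v.proj.1) (key v.proj _ _ v.2)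
  conformal x v := by
    -- With `S = A^{1/2}` symmetric, `⟨S φ v, S φ v⟩ = ⟨A φ v, φ v⟩ = ⟨v, v⟩`; the scalar `√r`
    -- contributes the factor `r`.
    have h1 := (φ.isSqrtForm_sqrt h hZ x).sq (φ.lin x.1 x.2 v) (φ.lin x.1 x.2 v)
    rw [transportForm_apply, LinearEquiv.symm_apply_apply] at h1
    rw [h1, (φ.isSqrtForm_sqrt h hZ x).symm]
    change (hZ.form _ (((√ (φ.density hp m hμ (p x.1) (φ.base x.1).2) : ℝ) : ℂ) •
      φ.sqrt h hZ x (φ.lin x.1 x.2 v)) (((√ (φ.density hp m hμ (p x.1) (φ.base x.1).2) : ℝ) : ℂ) •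
      φ.sqrt h hZ x (φ.lin x.1 x.2 v))).re = _
    have hre : ∀ (c : ℝ) (w : VZ (φ.base x.1).2),
        (hZ.form _ ((c : ℂ) • w) ((c : ℂ) • w)).re = c ^ 2 * (hZ.form _ w w).re := by
      intro c w
      simp only [map_smul, LinearMap.map_smulₛₗ, LinearMap.smul_apply, smul_eq_mul,
        Complex.conj_ofReal, Complex.re_ofReal_mul]
      ring
    rw [hre, Real.sq_sqrt (φ.density_pos hp m hμ x.2 _).le]
    rfl
  map_measure u hu := by
    rw [φ.map_fibreMeasure hp m hμ hu]
    congr 1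
    ext z
    have h1 : p ((φ.base.preimageSingletonHomeomorph hu).symm z).1 = u :=
      ((φ.base.preimageSingletonHomeomorph hu).symm z).2
    have h2 : (φ.base ((φ.base.preimageSingletonHomeomorph hu).symm z).1).2 = z :=
      (φ.base.preimageSingletonHomeomorph hu).apply_symm_apply z
    change _ = ENNReal.ofReal (φ.density hp m hμ
      (p ((φ.base.preimageSingletonHomeomorph hu).symm z).1)
      (φ.base ((φ.base.preimageSingletonHomeomorph hu).symm z).1).2)
    rw [h1, h2]

variable [SecondCountableTopology X] [VectorBundle ℂ F VX]

/-- The unitary is built from the continuous density, whereas the formula uses a Radon–Nikodym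
derivative; they agree `μ`-almost everywhere, hence almost everywhere on the fibre. -/
theorem induces_unitary {u : M} (hu : u ∈ φ.base.baseSet) :
    φ.Induces h m hZ μ u hu ((φ.toL2Chart h hZ hp m hμ).unitary hu) := by
  intro f k hfk
  have := hμ.isLocallyFiniteMeasure
  have h1 := (((φ.toL2Chart h hZ hp m hμ).conformalIso hu).unitary_toL2_eq_iff f k).1 hfk
  have hr : Continuous fun z => φ.density hp m hμ u z :=
    continuousOn_univ.1 ((φ.continuousOn_density hp m hμ).comp
      (continuousOn_const.prodMk continuousOn_id) fun z _ => ⟨hu, mem_univ _⟩)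
  have h2 : ∀ᵐ z ∂μ, ((m.fibreMeasure dZ u).map fun y => (φ.base y.1).2).rnDeriv μ z =
      ENNReal.ofReal (φ.density hp m hμ u z) := by
    have h3 := φ.map_fibreMeasure hp m hμ hu
    have h4 : (φ.base.preimageSingletonHomeomorph hu : ↥(p ⁻¹' {u}) → Z) =
      fun y => (φ.base y.1).2 := rfl
    rw [← h4, h3]
    exact Measure.rnDeriv_withDensity μ (ENNReal.continuous_ofReal.comp hr).measurable
  have h5 := (((φ.toL2Chart h hZ hp m hμ).conformalIso hu).ae_base_iff).2 h2
  filter_upwards [h1, h5] with x hx hx'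
  have hS := φ.isSqrtForm_sqrt h hZ (fibreInto hu x)
  refine ⟨(φ.sqrt h hZ (fibreInto hu x)).toLinearMap, hS.symm, fun v => ?_, fun ξ ξ' => ?_, ?_⟩
  · exact hS.nonneg v
  · have := hS.sq (φ.lin x.1 (mem_of_mem_fibre hu x) ξ) (φ.lin x.1 (mem_of_mem_fibre hu x) ξ')
    refine Eq.trans ?_ this
    exact (transportForm_apply_apply (φ.lin x.1 (mem_of_mem_fibre hu x)) (h.form x.1) ξ ξ').symm
  · have h6 : ((m.fibreMeasure dZ u).map fun y => (φ.base y.1).2).rnDeriv μ (φ.base x.1).2 =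
      ENNReal.ofReal (φ.density hp m hμ u (φ.base x.1).2) := hx'
    rw [h6, ENNReal.toReal_ofReal (φ.density_pos hp m hμ hu _).le]
    refine Eq.trans hx ?_
    have h7 : p x.1 = u := x.2
    change ((√ (φ.density hp m hμ (p x.1) (φ.base x.1).2) : ℝ) : ℂ) •
      φ.sqrt h hZ (fibreInto hu x) (φ.lin x.1 (mem_of_mem_fibre hu x) (fibreSec f x)) = _
    rw [h7]
    rfl

/-- The formula leaves only the choice of `S`, and a positive square root is unique. So the images
under `T` and `T'` agree almost everywhere. -/
theorem Induces.unique {u : M} {hu : u ∈ φ.base.baseSet} {h : HermitianMetric F VX}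
    {hZ : HermitianMetric F VZ} {m : VerticalMetric dX dM p}
    {T T' : FibreL2 dZ h m u ≃ₗᵢ[ℂ] hZ.L2 μ} (c : L2Chart dZ h m hZ μ) (hc : c.base = φ.base)
    (hT : φ.Induces h m hZ μ u hu T) (hT' : φ.Induces h m hZ μ u hu T') : T = T' := by
  ext f
  obtain ⟨f, rfl⟩ := HermitianMetric.toL2_surjective f
  obtain ⟨k, hk⟩ := HermitianMetric.toL2_surjective (T f.toL2)
  obtain ⟨k', hk'⟩ := HermitianMetric.toL2_surjective (T' f.toL2)
  rw [← hk, ← hk', HermitianMetric.toL2_eq_iff]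
  -- The chart `c` serves only to carry null sets of the fibre to null sets of `μ`.
  have hu' : u ∈ c.base.baseSet := hc ▸ hu
  refine ((c.conformalIso hu').ae_base_iff (P := fun z => k.sec z = k'.sec z)).1 ?_
  filter_upwards [hT f k hk.symm, hT' f k' hk'.symm] with x hx hx'
  obtain ⟨S, hS1, hS2, hS3, hS4⟩ := hx
  obtain ⟨S', hS1', hS2', hS3', hS4'⟩ := hx'
  have := finiteDimensional_fibre F VZ (φ.base x.1).2
  have key : ∀ S : VZ (φ.base x.1).2 →ₗ[ℂ] VZ (φ.base x.1).2,
      (∀ v w, hZ.form _ (S v) w = hZ.form _ v (S w)) →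
      (∀ v, 0 ≤ (hZ.form _ (S v) v).re) →
      (∀ ξ ξ' : VX x.1, h.form x.1 ξ ξ' =
        hZ.form _ (S (S (φ.lin x.1 (mem_of_mem_fibre hu x) ξ)))
          (φ.lin x.1 (mem_of_mem_fibre hu x) ξ')) →
      IsSqrtForm (hZ.form (φ.base x.1).2)
        (transportForm (φ.lin x.1 (mem_of_mem_fibre hu x)) (h.form x.1)) S := by
    intro S h1 h2 h3
    refine ⟨h1, h2, fun v w => ?_⟩
    rw [transportForm_apply, h3, LinearEquiv.apply_symm_apply, LinearEquiv.apply_symm_apply]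
  have hSS := (key S hS1 hS2 hS3).unique (hZ.isPosDefForm _)
    ((h.isPosDefForm x.1).transport _) (key S' hS1' hS2' hS3')
  have hbase : (c.conformalIso hu').base x = (φ.base x.1).2 := by
    rw [← hc]
    rfl
  rw [hbase, hS4, hS4', hSS]

end BundleChart

end ChartOfBundleChart

/-! ## Hilbert bundles from families of unitary charts -/

section Prebundle

variable {B : Type*} [TopologicalSpace B] {H : Type*} [NormedAddCommGroup H]
  [InnerProductSpace ℂ H] {E : B → Type*} [∀ b, NormedAddCommGroup (E b)]
  [∀ b, InnerProductSpace ℂ (E b)]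

open Classical in
/-- The extension by `0` of a family of unitaries over `U`. -/
noncomputable def extendUnitary {U : Set B} (T : ∀ b ∈ U, E b ≃ₗᵢ[ℂ] H) (b : B) (v : E b) : H :=
  if hb : b ∈ U then T b hb v else 0

open Classical in
/-- The extension by `0` of the inverses of a family of unitaries over `U`. -/
noncomputable def extendUnitarySymm {U : Set B} (T : ∀ b ∈ U, E b ≃ₗᵢ[ℂ] H) (b : B) (k : H) :
    E b :=
  if hb : b ∈ U then (T b hb).symm k else 0

theorem extendUnitary_of_mem {U : Set B} (T : ∀ b ∈ U, E b ≃ₗᵢ[ℂ] H) {b : B} (hb : b ∈ U)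
    (v : E b) : extendUnitary T b v = T b hb v := dif_pos hb

theorem extendUnitarySymm_of_mem {U : Set B} (T : ∀ b ∈ U, E b ≃ₗᵢ[ℂ] H) {b : B} (hb : b ∈ U)
    (k : H) : extendUnitarySymm T b k = (T b hb).symm k := dif_pos hb

/-- The pretrivialization given by a family of unitaries. -/
noncomputable def unitaryPretrivialization {U : Set B} (hU : IsOpen U)
    (T : ∀ b ∈ U, E b ≃ₗᵢ[ℂ] H) : Pretrivialization H (π H E) where
  toFun v := (v.proj, extendUnitary T v.proj v.2)
  invFun y := ⟨y.1, extendUnitarySymm T y.1 y.2⟩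
  source := π H E ⁻¹' U
  target := U ×ˢ univ
  map_source' v hv := ⟨hv, mem_univ _⟩
  map_target' y hy := hy.1
  left_inv' := by
    rintro ⟨b, v⟩ hb
    refine congrArg (TotalSpace.mk b) ?_
    rw [extendUnitarySymm_of_mem T hb, extendUnitary_of_mem T hb]
    exact (T b hb).symm_apply_apply v
  right_inv' := by
    rintro ⟨b, k⟩ hb
    refine congrArg (Prod.mk b) ?_
    rw [extendUnitary_of_mem T hb.1, extendUnitarySymm_of_mem T hb.1]
    exact (T b hb.1).apply_symm_apply k
  open_target := hU.prod isOpen_univ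
  baseSet := U
  open_baseSet := hU
  source_eq := rfl
  target_eq := rfl
  proj_toFun _ _ := rfl

theorem unitaryPretrivialization_apply {U : Set B} (hU : IsOpen U)
    (T : ∀ b ∈ U, E b ≃ₗᵢ[ℂ] H) {b : B} (hb : b ∈ U) (v : E b) :
    unitaryPretrivialization hU T ⟨b, v⟩ = (b, T b hb v) :=
  congrArg (Prod.mk b) (extendUnitary_of_mem T hb v)

theorem unitaryPretrivialization_symm_apply {U : Set B} (hU : IsOpen U)
    (T : ∀ b ∈ U, E b ≃ₗᵢ[ℂ] H) {b : B} (hb : b ∈ U) (k : H) :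
    (unitaryPretrivialization hU T).toPartialEquiv.symm (b, k) = ⟨b, (T b hb).symm k⟩ :=
  congrArg (TotalSpace.mk b) (extendUnitarySymm_of_mem T hb k)

variable {ι : Type*} {U : ι → Set B} (hU : ∀ i, IsOpen (U i)) (hcover : ∀ b, ∃ i, b ∈ U i)
  (T : ∀ i, ∀ b ∈ U i, E b ≃ₗᵢ[ℂ] H)
  (hT : ∀ i j, Continuous fun y : ↥(U i ∩ U j) × H =>
    T j y.1.1 y.1.2.2 ((T i y.1.1 y.1.2.1).symm y.2))

/-- The prebundle given by a family of unitary charts with continuous transitions. -/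
noncomputable def unitaryPrebundle : FiberPrebundle H E where
  pretrivializationAtlas := range fun i => unitaryPretrivialization (hU i) (T i)
  pretrivializationAt b := unitaryPretrivialization (hU (hcover b).choose) (T (hcover b).choose)
  mem_base_pretrivializationAt b := (hcover b).choose_spec
  pretrivialization_mem_atlas b := ⟨_, rfl⟩
  continuous_trivChange := by
    rintro _ ⟨j, rfl⟩ _ ⟨i, rfl⟩
    have hset : ∀ y ∈ ((unitaryPretrivialization (hU i) (T i)).target ∩
        (unitaryPretrivialization (hU i) (T i)).toPartialEquiv.symm ⁻¹'
          (unitaryPretrivialization (hU j) (T j)).source), y.1 ∈ U i ∩ U j :=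
      fun y hy => ⟨hy.1.1, hy.2⟩
    rw [continuousOn_iff_continuous_domRestrict]
    have h1 : Continuous fun y : ↥((unitaryPretrivialization (hU i) (T i)).target ∩
        (unitaryPretrivialization (hU i) (T i)).toPartialEquiv.symm ⁻¹'
          (unitaryPretrivialization (hU j) (T j)).source) =>
        ((⟨y.1.1, hset y.1 y.2⟩ : ↥(U i ∩ U j)), y.1.2) :=
      ((continuous_fst.comp continuous_subtype_val).subtype_mk _).prodMk
        (continuous_snd.comp continuous_subtype_val)
    refine ((continuous_fst.comp continuous_subtype_val).prodMk
      (Continuous.comp (hT i j) h1)).congr fun y => ?_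
    obtain ⟨⟨b, k⟩, hy⟩ := y
    have hb := hset _ hy
    simp only [Set.domRestrict, Function.comp_apply]
    rw [unitaryPretrivialization_symm_apply (hU i) (T i) hb.1,
      unitaryPretrivialization_apply (hU j) (T j) hb.2]
  totalSpaceMk_isInducing b := by
    have h1 : Topology.IsInducing fun k : H => (b, k) := isInducing_prodMkRight b
    have h2 := h1.comp (T _ b (hcover b).choose_spec).toHomeomorph.isInducing
    have h3 : (unitaryPretrivialization (hU (hcover b).choose) (T (hcover b).choose) :
        TotalSpace H E → B × H) ∘ TotalSpace.mk b =
          (fun k : H => (b, k)) ∘ (T _ b (hcover b).choose_spec).toHomeomorph :=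
      funext fun v => unitaryPretrivialization_apply _ _ (hcover b).choose_spec v
    exact h3 ▸ h2

/-- The unitary charts of the bundle given by a family of unitary charts. -/
noncomputable def unitaryPrebundleChart (i : ι) :
    @UnitaryChart B _ H _ _ E _ _ (unitaryPrebundle hU hcover T hT).totalSpaceTopology :=
  let _ := (unitaryPrebundle hU hcover T hT).totalSpaceTopology
  { (unitaryPrebundle hU hcover T hT).trivializationOfMemPretrivializationAtlas
      (e := unitaryPretrivialization (hU i) (T i)) ⟨i, rfl⟩ with
    unitary := T i
    apply_eq := fun _ hb v => unitaryPretrivialization_apply (hU i) (T i) hb v }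

/-- The Hilbert bundle given by a family of unitary charts. -/
noncomputable def unitaryHilbertBundle [CompleteSpace H] :
    @HilbertBundle B _ H _ _ E _ _ (unitaryPrebundle hU hcover T hT).totalSpaceTopology :=
  let _ := (unitaryPrebundle hU hcover T hT).totalSpaceTopology
  { complete := inferInstance
    atlas := range fun i => unitaryPrebundleChart hU hcover T hT i
    cover := fun b => ⟨_, ⟨_, rfl⟩, (hcover b).choose_spec⟩
    continuous_transition := by
      rintro _ ⟨j, rfl⟩ _ ⟨i, rfl⟩
      -- Strong continuity is continuity at each fixed vector `k`, a special case of the joint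
      -- continuity in `hT`.
      refine continuous_induced_rng.2 (continuous_pi fun k => ?_)
      have h1 : Continuous fun b : ↥(U j ∩ U i) => ((⟨b.1, b.2.2, b.2.1⟩ : ↥(U i ∩ U j)), k) :=
        (continuous_subtype_val.subtype_mk _).prodMk continuous_const
      exact Continuous.comp (hT i j) h1 }

/-- The unitaries `T i` are the fibre maps of unitary charts over the sets `U i`. -/
def HasUnitaryCharts [TopologicalSpace (TotalSpace H E)] (T : ∀ i, ∀ b ∈ U i, E b ≃ₗᵢ[ℂ] H) :
    Prop :=
  ∀ i, ∃ e : UnitaryChart H E, ∃ he : e.baseSet = U i,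
    ∀ b (hb : b ∈ U i), e.unitary b (he ▸ hb) = T i b hb

theorem HasUnitaryCharts.isOpen [TopologicalSpace (TotalSpace H E)]
    {T : ∀ i, ∀ b ∈ U i, E b ≃ₗᵢ[ℂ] H}
    (hT : HasUnitaryCharts T) (i : ι) : IsOpen (U i) := by
  obtain ⟨e, he, -⟩ := hT i
  exact he ▸ e.open_baseSet

/-- Neighbourhoods of `v` are the images of neighbourhoods in `U i × H` under the inverse chart. The
right side depends only on the unitaries `T i`, not on the topology of the total space; this is what
forces uniqueness. -/
theorem HasUnitaryCharts.nhds_eq [TopologicalSpace (TotalSpace H E)]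
    {T : ∀ i, ∀ b ∈ U i, E b ≃ₗᵢ[ℂ] H} (hT : HasUnitaryCharts T) {i : ι} {v : TotalSpace H E}
    (hv : v.proj ∈ U i) (hi : IsOpen (U i)) :
    𝓝 v = Filter.map (unitaryPretrivialization hi (T i)).toPartialEquiv.symm
      (𝓝 (unitaryPretrivialization hi (T i) v)) := by
  obtain ⟨e, he, h⟩ := hT i
  have hsrc : v ∈ e.source := e.mem_source.2 (he ▸ hv)
  have happ : e.toOpenPartialHomeomorph v = unitaryPretrivialization hi (T i) v := by
    obtain ⟨b, v⟩ := v
    rw [unitaryPretrivialization_apply hi (T i) hv, ← h b hv]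
    exact e.apply_eq b (he ▸ hv) v
  have h1 := e.toOpenPartialHomeomorph.symm.map_nhds_eq
    (e.toOpenPartialHomeomorph.map_source hsrc)
  rw [OpenPartialHomeomorph.left_inv _ hsrc] at h1
  rw [← h1, happ]
  refine Filter.map_congr ?_
  have h2 : e.target ∈ 𝓝 (unitaryPretrivialization hi (T i) v) := by
    rw [← happ]
    exact e.open_target.mem_nhds (e.toOpenPartialHomeomorph.map_source hsrc)
  filter_upwards [h2] with y hy
  have hy1 : y.1 ∈ U i := he ▸ e.mem_target.1 hy
  have h3 := e.apply_eq y.1 (he ▸ hy1) ((T i y.1 hy1).symm y.2)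
  rw [h y.1 hy1, LinearIsometryEquiv.apply_symm_apply] at h3
  have h4 := e.toOpenPartialHomeomorph.left_inv
    (x := ⟨y.1, (T i y.1 hy1).symm y.2⟩) (e.mem_source.2 (he ▸ hy1))
  have h5 : e.toOpenPartialHomeomorph ⟨y.1, (T i y.1 hy1).symm y.2⟩ = y := h3
  rw [h5] at h4
  rw [h4]
  exact (unitaryPretrivialization_symm_apply hi (T i) hy1 y.2).symm

/-- A topology for which a covering family of unitary charts consists of local trivializations is
determined by these charts. -/
theorem totalSpaceTopology_unique {T : ∀ i, ∀ b ∈ U i, E b ≃ₗᵢ[ℂ] H}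
    (hcover : ∀ b, ∃ i, b ∈ U i) {t t' : TopologicalSpace (TotalSpace H E)}
    (ht : @HasUnitaryCharts B _ H _ _ E _ _ ι U t T)
    (ht' : @HasUnitaryCharts B _ H _ _ E _ _ ι U t' T) : t = t' := by
  refine TopologicalSpace.ext_nhds fun v => ?_
  obtain ⟨i, hi⟩ := hcover v.proj
  have hUi := @HasUnitaryCharts.isOpen B _ H _ _ E _ _ ι U t T ht i
  exact (@HasUnitaryCharts.nhds_eq B _ H _ _ E _ _ ι U t T ht i v hi hUi).trans
    (@HasUnitaryCharts.nhds_eq B _ H _ _ E _ _ ι U t' T ht' i v hi hUi).symm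

end Prebundle

/-! ## The natural Hilbert bundle and the action of the groupoid -/

section UnitaryChart

variable {B : Type*} [TopologicalSpace B] {H : Type*} [NormedAddCommGroup H]
  [InnerProductSpace ℂ H] {E : B → Type*} [∀ b, NormedAddCommGroup (E b)]
  [∀ b, InnerProductSpace ℂ (E b)] [TopologicalSpace (TotalSpace H E)]

theorem UnitaryChart.symm_apply (e : UnitaryChart H E) {b : B} (hb : b ∈ e.baseSet) (k : H) :
    e.toOpenPartialHomeomorph.symm (b, k) = ⟨b, (e.unitary b hb).symm k⟩ := by
  have h1 := e.apply_eq b hb ((e.unitary b hb).symm k)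
  rw [LinearIsometryEquiv.apply_symm_apply] at h1
  have h2 := e.toOpenPartialHomeomorph.left_inv
    (x := ⟨b, (e.unitary b hb).symm k⟩) (e.mem_source.2 hb)
  rw [← h2]
  exact congrArg _ h1.symm

theorem UnitaryChart.apply_snd (e : UnitaryChart H E) {v : TotalSpace H E}
    (hv : v.proj ∈ e.baseSet) : (e.toOpenPartialHomeomorph v).2 = e.unitary v.proj hv v.2 :=
  congrArg Prod.snd (e.apply_eq v.proj hv v.2)

theorem UnitaryChart.continuous_snd (e : UnitaryChart H E) {Q : Type*} [TopologicalSpace Q]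
    {f : Q → TotalSpace H E} (hf : Continuous f) (hfe : ∀ q, (f q).proj ∈ e.baseSet) :
    Continuous fun q => e.unitary (f q).proj (hfe q) (f q).2 :=
  (_root_.continuous_snd.comp (e.toOpenPartialHomeomorph.continuousOn.comp_continuous hf
    fun q => e.mem_source.2 (hfe q))).congr fun q => e.apply_snd (hfe q)

theorem continuous_of_unitaryCharts {Q : Type*} [TopologicalSpace Q] {f : Q → TotalSpace H E}
    (hproj : Continuous fun q => (f q).proj)
    (hf : ∀ q₀, ∃ e : UnitaryChart H E, ∃ O : Set Q, IsOpen O ∧ q₀ ∈ O ∧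
      ∃ hO : ∀ q ∈ O, (f q).proj ∈ e.baseSet,
        Continuous fun q : O => e.unitary (f q.1).proj (hO q.1 q.2) (f q.1).2) :
    Continuous f := by
  refine continuous_iff_continuousAt.2 fun q₀ => ?_
  obtain ⟨e, O, hOo, hq₀, hO, hc⟩ := hf q₀
  have h1 := e.toOpenPartialHomeomorph.symm.continuousOn.comp_continuous
    ((hproj.comp continuous_subtype_val).prodMk hc) fun q : O => e.mem_target.2 (hO q.1 q.2)
  have h2 : Continuous (O.domRestrict f) := by
    refine h1.congr fun q => (e.symm_apply (hO q.1 q.2) _).trans ?_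
    rw [LinearIsometryEquiv.symm_apply_apply]
    rfl
  exact (continuousOn_iff_continuous_domRestrict.2 h2).continuousAt (hOo.mem_nhds hq₀)

end UnitaryChart

/-! ### Transition functions, the action on the total space, and rigidity of the charts. -/

section Action

variable {dM dG dX dZ : ℕ} {M G X Z : Type*}
  [TopologicalSpace M] [ChartedSpace (EuclideanSpace ℝ (Fin dM)) M] [IsManifold (𝓡 dM) ∞ M]
  [T1Space M]
  [TopologicalSpace G] [ChartedSpace (EuclideanSpace ℝ (Fin dG)) G] [IsManifold (𝓡 dG) ∞ G]
  [TopologicalSpace X] [ChartedSpace (EuclideanSpace ℝ (Fin dX)) X] [IsManifold (𝓡 dX) ∞ X]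
  [MeasurableSpace X] [BorelSpace X] [SecondCountableTopology X]
  [TopologicalSpace Z] [ChartedSpace (EuclideanSpace ℝ (Fin dZ)) Z] [IsManifold (𝓡 dZ) ∞ Z]
  [T2Space Z] [SecondCountableTopology Z] [CompactSpace Z]
  [MeasurableSpace Z] [BorelSpace Z]
  {F : Type*} [NormedAddCommGroup F] [NormedSpace ℂ F] [FiniteDimensional ℂ F]
  {VX : X → Type*} [TopologicalSpace (TotalSpace F VX)] [∀ x, AddCommGroup (VX x)]
  [∀ x, Module ℂ (VX x)] [∀ x, TopologicalSpace (VX x)] [FiberBundle F VX] [VectorBundle ℂ F VX]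
  {VZ : Z → Type*} [TopologicalSpace (TotalSpace F VZ)] [∀ z, AddCommGroup (VZ z)]
  [∀ z, Module ℂ (VZ z)] [∀ z, TopologicalSpace (VZ z)] [FiberBundle F VZ] [VectorBundle ℂ F VZ]
  {𝒢 : LieGroupoid dM dG M G} {p : X → M} {A : GManifold 𝒢 (𝓡 dX) p}
  (ℰ : EquivariantStructure A F VX)
  {h : HermitianMetric F VX} (hh : ℰ.IsIsometric h)
  {m : VerticalMetric dX dM p} (hm : m.IsIsometric A)
  (htriv : ∀ u, ∃ b : Trivialization Z p, u ∈ b.baseSet ∧ SmoothTriv dM dX dZ b)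
  {hZ : HermitianMetric F VZ} {μ : Measure Z} (c c' : L2Chart dZ h m hZ μ)

namespace EquivariantStructure

theorem unitary_eq_kernel {g : G} {u u' : M} (hu : 𝒢.src g = u) (hu' : 𝒢.tgt g = u')
    (hs : 𝒢.src g ∈ c.base.baseSet) (ht : 𝒢.tgt g ∈ c'.base.baseSet)
    (hs' : u ∈ c.base.baseSet) (ht' : u' ∈ c'.base.baseSet) (k : hZ.L2 μ) :
    ℰ.kernel hh hm htriv c c' g hs ht k =
      c'.unitary ht' (ℰ.unitary hh hm htriv g hu hu' ((c.unitary hs').symm k)) := by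
  subst hu hu'
  rfl

/-- Units act as the identity, so the transition from `c` to `c'` at `u` is the kernel of the unit
at `u`. -/
theorem continuous_transition (ℰ : EquivariantStructure A F VX) (hh : ℰ.IsIsometric h)
    (hm : m.IsIsometric A)
    (htriv : ∀ u, ∃ b : Trivialization Z p, u ∈ b.baseSet ∧ SmoothTriv dM dX dZ b)
    [IsFiniteMeasure μ] [μ.WeaklyRegular] :
    Continuous fun y : ↥(c.base.baseSet ∩ c'.base.baseSet) × hZ.L2 μ =>
      c'.unitary y.1.2.2 ((c.unitary y.1.2.1).symm y.2) := by
  have h1 : Continuous fun y : ↥(c.base.baseSet ∩ c'.base.baseSet) × hZ.L2 μ =>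
      ((⟨𝒢.unit y.1.1, (𝒢.src_unit y.1.1).symm ▸ y.1.2.1, (𝒢.tgt_unit y.1.1).symm ▸ y.1.2.2⟩ :
        {g // 𝒢.src g ∈ c.base.baseSet ∧ 𝒢.tgt g ∈ c'.base.baseSet}), y.2) :=
    ((𝒢.smooth_unit.continuous.comp
      (continuous_subtype_val.comp continuous_fst)).subtype_mk _).prodMk continuous_snd
  refine (Continuous.comp (ℰ.continuous_kernel hh hm htriv c c') h1).congr fun y => ?_
  refine (ℰ.unitary_eq_kernel hh hm htriv c c' (𝒢.src_unit y.1.1) (𝒢.tgt_unit y.1.1) _ _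
    y.1.2.1 y.1.2.2 y.2).trans ?_
  rw [ℰ.unitary_unit hh hm htriv]

/-- The map `(g, f) ↦ L_g f`. -/
noncomputable def translate
    (q : {q : G × TotalSpace (hZ.L2 μ) (FibreL2 dZ h m) // 𝒢.src q.1 = q.2.proj}) :
    TotalSpace (hZ.L2 μ) (FibreL2 dZ h m) :=
  ⟨𝒢.tgt q.1.1, ℰ.unitary hh hm htriv q.1.1 q.2 rfl q.1.2.2⟩

theorem translate_mul (g g' : G) (ξ : TotalSpace (hZ.L2 μ) (FibreL2 dZ h m))
    (hgg' : 𝒢.src g = 𝒢.tgt g') (hξ : 𝒢.src g' = ξ.proj) :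
    ℰ.translate hh hm htriv ⟨(𝒢.mul g g', ξ), (𝒢.src_mul hgg').trans hξ⟩ =
      ℰ.translate hh hm htriv ⟨(g, ℰ.translate hh hm htriv ⟨(g', ξ), hξ⟩), hgg'⟩ := by
  have key : ∀ {u u' : M} (v : FibreL2 dZ h m u) (w : FibreL2 dZ h m u') (e : u = u'),
      (∀ e' : u = u', e' ▸ v = w) →
      (⟨u, v⟩ : TotalSpace (hZ.L2 μ) (FibreL2 dZ h m)) = ⟨u', w⟩ := by
    rintro u _ v w rfl h1
    exact congrArg _ (h1 rfl)
  refine key _ _ (𝒢.tgt_mul hgg') fun e => ?_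
  have h1 := ℰ.unitary_mul hh hm htriv hgg' hξ hgg' rfl ξ.2
  refine Eq.trans ?_ h1
  have key' : ∀ {u' : M} (e' : 𝒢.tgt (𝒢.mul g g') = u') (hs : 𝒢.src (𝒢.mul g g') = ξ.proj),
      (e' ▸ ℰ.unitary hh hm htriv (𝒢.mul g g') hs rfl ξ.2 : FibreL2 dZ h m u') =
        ℰ.unitary hh hm htriv (𝒢.mul g g') hs e' ξ.2 := by
    rintro _ rfl hs
    rfl
  exact key' e _

theorem translate_inv (g : G) (ξ : TotalSpace (hZ.L2 μ) (FibreL2 dZ h m))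
    (hξ : 𝒢.src g = ξ.proj) :
    ℰ.translate hh hm htriv ⟨(𝒢.inv g, ℰ.translate hh hm htriv ⟨(g, ξ), hξ⟩), 𝒢.src_inv g⟩ =
      ξ := by
  have h1 := ℰ.unitary_inv_apply hh hm htriv g hξ rfl ξ.2
  have key : ∀ {u : M} (e : 𝒢.tgt (𝒢.inv g) = u) (w : FibreL2 dZ h m (𝒢.tgt g)),
      (⟨𝒢.tgt (𝒢.inv g), ℰ.unitary hh hm htriv (𝒢.inv g) (𝒢.src_inv g) rfl w⟩ :
        TotalSpace (hZ.L2 μ) (FibreL2 dZ h m)) =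
      ⟨u, ℰ.unitary hh hm htriv (𝒢.inv g) (𝒢.src_inv g) e w⟩ := by
    rintro _ rfl w
    rfl
  exact (key ((𝒢.tgt_inv g).trans hξ) _).trans (congrArg (TotalSpace.mk ξ.proj) h1)

/-- In charts around the source and the target the map is `(g, k) ↦ kernel g k`. -/
theorem continuous_translate [TopologicalSpace (TotalSpace (hZ.L2 μ) (FibreL2 dZ h m))]
    [IsFiniteMeasure μ] [μ.WeaklyRegular]
    (hcharts : ∀ u : M, ∃ (c : L2Chart dZ h m hZ μ) (e : UnitaryChart (hZ.L2 μ) (FibreL2 dZ h m)),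
      u ∈ e.baseSet ∧ ∃ he : e.baseSet = c.base.baseSet,
        ∀ b (hb : b ∈ c.base.baseSet), e.unitary b (he ▸ hb) = c.unitary hb)
    (hproj : Continuous (π (hZ.L2 μ) (FibreL2 dZ h m))) :
    Continuous (ℰ.translate hh hm htriv (hZ := hZ) (μ := μ)) := by
  have hg : Continuous fun q : {q : G × TotalSpace (hZ.L2 μ) (FibreL2 dZ h m) //
      𝒢.src q.1 = q.2.proj} => q.1.1 := continuous_fst.comp continuous_subtype_val
  have hv : Continuous fun q : {q : G × TotalSpace (hZ.L2 μ) (FibreL2 dZ h m) //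
      𝒢.src q.1 = q.2.proj} => q.1.2 := continuous_snd.comp continuous_subtype_val
  refine continuous_of_unitaryCharts (𝒢.continuous_tgt.comp hg) fun q₀ => ?_
  obtain ⟨c, e, hs, he, hc⟩ := hcharts q₀.1.2.proj
  obtain ⟨c', e', ht, he', hc'⟩ := hcharts (𝒢.tgt q₀.1.1)
  refine ⟨e', {q | q.1.2.proj ∈ e.baseSet ∧ 𝒢.tgt q.1.1 ∈ e'.baseSet},
    (e.open_baseSet.preimage (hproj.comp hv)).inter
      (e'.open_baseSet.preimage (𝒢.continuous_tgt.comp hg)), ⟨hs, ht⟩, fun q hq => hq.2, ?_⟩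
  set O := {q : {q : G × TotalSpace (hZ.L2 μ) (FibreL2 dZ h m) // 𝒢.src q.1 = q.2.proj} |
    q.1.2.proj ∈ e.baseSet ∧ 𝒢.tgt q.1.1 ∈ e'.baseSet} with hO
  have hsub : Continuous fun q : O => q.1 := continuous_subtype_val
  have hmem : ∀ q : O, q.1.1.2.proj ∈ c.base.baseSet := fun q => he ▸ q.2.1
  have hmem' : ∀ q : O, 𝒢.tgt q.1.1.1 ∈ c'.base.baseSet := fun q => he' ▸ q.2.2
  have hmem'' : ∀ q : O, 𝒢.src q.1.1.1 ∈ c.base.baseSet :=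
    fun q => Set.mem_of_eq_of_mem q.1.2 (hmem q)
  have h1 := e.continuous_snd (hv.comp hsub) fun q : O => q.2.1
  have h2 := Continuous.prodMk ((hg.comp hsub).subtype_mk
    (p := fun g => 𝒢.src g ∈ c.base.baseSet ∧ 𝒢.tgt g ∈ c'.base.baseSet)
    fun q : O => ⟨hmem'' q, hmem' q⟩) h1
  refine (Continuous.comp (ℰ.continuous_kernel hh hm htriv c c') h2).congr fun q => ?_
  refine (ℰ.unitary_eq_kernel hh hm htriv c c' q.1.2 rfl (hmem'' q) (hmem' q) (hmem q) (hmem' q)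
    _).trans ?_
  have h3 : (c.unitary (hmem q)).symm (e.unitary q.1.1.2.proj q.2.1 q.1.1.2.2) = q.1.1.2.2 :=
    ((c.unitary (hmem q)).symm_apply_eq).2 (congrArg (fun T => T q.1.1.2.2) (hc _ (hmem q)))
  exact (congrArg (fun w => c'.unitary (hmem' q) (ℰ.unitary hh hm htriv q.1.1.1 q.1.2 rfl w))
    h3).trans (congrArg (fun T => T (ℰ.unitary hh hm htriv q.1.1.1 q.1.2 rfl q.1.1.2.2))
      (hc' _ (hmem' q)).symm)

end EquivariantStructure

/-- Any admissible structure has the same fibre maps over each chart domain, by uniqueness of the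
induced unitary. -/
theorem IsNaturalHilbertBundle.hasUnitaryCharts {h : HermitianMetric F VX}
    {m : VerticalMetric dX dM p} {hZ : HermitianMetric F VZ} {μ : Measure Z}
    {t : TopologicalSpace (TotalSpace (hZ.L2 μ) (FibreL2 dZ h m))}
    (ht : IsNaturalHilbertBundle dZ h m hZ μ t) (hp : ContMDiff (𝓡 dX) (𝓡 dM) ∞ p)
    (hμ : IsSmoothMeasure (d := dZ) μ) :
    HasUnitaryCharts (U := fun φ : BundleChart dM dX dZ p F VX VZ => φ.base.baseSet)
      fun φ _ hu => (φ.toL2Chart h hZ hp m hμ).unitary hu := by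
  intro φ
  obtain ⟨𝓑, h𝓑⟩ := ht
  obtain ⟨e, -, he, hI⟩ := h𝓑 φ
  exact ⟨e, he, fun b hb => BundleChart.Induces.unique φ (φ.toL2Chart h hZ hp m hμ) rfl
    (hI b (he ▸ hb)) (φ.induces_unitary h hZ hp m hμ hb)⟩

end Action

/-! ### Assembly of the Hilbert bundle, its uniqueness and the action. -/

theorem proposition5p2
    {dM dG dX dZ : ℕ} {M G X Z : Type*}
    -- the manifolds `M = G⁰`, `G`, `X` and the compact manifold `Z`
    [TopologicalSpace M] [T2Space M] [SecondCountableTopology M]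
    [ChartedSpace (EuclideanSpace ℝ (Fin dM)) M] [IsManifold (𝓡 dM) ∞ M]
    [TopologicalSpace G] [T2Space G] [SecondCountableTopology G]
    [ChartedSpace (EuclideanSpace ℝ (Fin dG)) G] [IsManifold (𝓡 dG) ∞ G]
    [TopologicalSpace X] [T2Space X] [SecondCountableTopology X]
    [ChartedSpace (EuclideanSpace ℝ (Fin dX)) X] [IsManifold (𝓡 dX) ∞ X]
    [MeasurableSpace X] [BorelSpace X]
    [TopologicalSpace Z] [T2Space Z] [SecondCountableTopology Z] [CompactSpace Z]
    [ChartedSpace (EuclideanSpace ℝ (Fin dZ)) Z] [IsManifold (𝓡 dZ) ∞ Z]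
    [MeasurableSpace Z] [BorelSpace Z]
    -- the smooth complex vector bundles `VX` over `X` and `VZ` over `Z`
    {F : Type*} [NormedAddCommGroup F] [NormedSpace ℂ F] [FiniteDimensional ℂ F]
    {VX : X → Type*} [TopologicalSpace (TotalSpace F VX)] [∀ x, AddCommGroup (VX x)]
    [∀ x, Module ℂ (VX x)] [∀ x, TopologicalSpace (VX x)] [FiberBundle F VX]
    [VectorBundle ℂ F VX] [VectorBundle ℝ F VX] [ContMDiffVectorBundle ∞ F VX (𝓡 dX)]
    {VZ : Z → Type*} [TopologicalSpace (TotalSpace F VZ)] [∀ z, AddCommGroup (VZ z)]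
    [∀ z, Module ℂ (VZ z)] [∀ z, TopologicalSpace (VZ z)] [FiberBundle F VZ]
    [VectorBundle ℂ F VZ] [VectorBundle ℝ F VZ] [ContMDiffVectorBundle ∞ F VZ (𝓡 dZ)]
    -- the Lie groupoid, the `G`-manifold `(X, p)` and the `G`-action on `VX`
    (𝒢 : LieGroupoid dM dG M G) (p : X → M) (A : GManifold 𝒢 (𝓡 dX) p)
    (ℰ : EquivariantStructure A F VX)
    -- `VX → X → M` is locally trivial with fibre `VZ → Z`
    (hloc : ∀ u : M, ∃ φ : BundleChart dM dX dZ p F VX VZ, u ∈ φ.base.baseSet)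
    -- the `G`-isometric hermitian metrics on `VX` and along the fibres of `p`
    (h : HermitianMetric F VX) (hh : ℰ.IsIsometric h)
    (m : VerticalMetric dX dM p) (hm : m.IsIsometric A)
    -- the smooth measure on `Z` and the hermitian metric on `VZ`
    (μ : Measure Z) (hμ : IsSmoothMeasure (d := dZ) μ) (hZ : HermitianMetric F VZ) :
    ∃ t : TopologicalSpace (TotalSpace (hZ.L2 μ) (FibreL2 dZ h m)),
      IsNaturalHilbertBundle dZ h m hZ μ t ∧
      (∀ t', IsNaturalHilbertBundle dZ h m hZ μ t' → t' = t) ∧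
      ∃ L : UnitaryAction 𝒢 (hZ.L2 μ) (FibreL2 dZ h m),
        -- `L_g f (g x) = g (f x)`
        ∀ (g : G)
          (f : (h.pullback (fibreIncl p (𝒢.src g))).SqIntegrable (m.fibreMeasure dZ (𝒢.src g)))
          (k : (h.pullback (fibreIncl p (𝒢.tgt g))).SqIntegrable (m.fibreMeasure dZ (𝒢.tgt g))),
          L.lin g f.toL2 = k.toL2 →
          ∀ᵐ x ∂(m.fibreMeasure dZ (𝒢.src g)),
            fibreSec k ⟨A.act g x.1, A.anchor_act x.2.symm⟩ =
              ℰ.lin g x.1 x.2.symm (fibreSec f x) := by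
  have hp : ContMDiff (𝓡 dX) (𝓡 dM) ∞ p := A.submersion.contMDiff
  have htriv : ∀ u, ∃ b : Trivialization Z p, u ∈ b.baseSet ∧ SmoothTriv dM dX dZ b := fun u =>
    ⟨(hloc u).choose.base, (hloc u).choose_spec, (hloc u).choose.smoothTriv hp⟩
  have := hμ.isLocallyFiniteMeasure
  have : LocallyCompactSpace Z :=
    ChartedSpace.locallyCompactSpace (EuclideanSpace ℝ (Fin dZ)) Z
  -- A locally finite measure on a compact space is finite.
  have : IsFiniteMeasure μ := inferInstance
  have : CompleteSpace (hZ.L2 μ) := hZ.completeSpace_L2 μ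
  have hT : ∀ φ ψ : BundleChart dM dX dZ p F VX VZ, Continuous fun y :
      ↥(φ.base.baseSet ∩ ψ.base.baseSet) × hZ.L2 μ =>
      (ψ.toL2Chart h hZ hp m hμ).unitary y.1.2.2
        (((φ.toL2Chart h hZ hp m hμ).unitary y.1.2.1).symm y.2) := fun φ ψ =>
    EquivariantStructure.continuous_transition (φ.toL2Chart h hZ hp m hμ)
      (ψ.toL2Chart h hZ hp m hμ) ℰ hh hm htriv
  set P := unitaryPrebundle (fun φ : BundleChart dM dX dZ p F VX VZ => φ.base.open_baseSet) hloc
    (fun φ u hu => (φ.toL2Chart h hZ hp m hμ).unitary hu) hT with hP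
  have hnat : IsNaturalHilbertBundle dZ h m hZ μ P.totalSpaceTopology :=
    ⟨unitaryHilbertBundle _ hloc _ hT, fun φ => ⟨unitaryPrebundleChart _ hloc _ hT φ, ⟨φ, rfl⟩, rfl,
      fun u hu => φ.induces_unitary h hZ hp m hμ hu⟩⟩
  refine ⟨P.totalSpaceTopology, hnat, fun t' ht' => totalSpaceTopology_unique hloc
    (ht'.hasUnitaryCharts hp hμ) (hnat.hasUnitaryCharts hp hμ), ?_⟩
  let _ := P.totalSpaceTopology
  refine ⟨{ lin := fun g => ℰ.unitary hh hm htriv g rfl rfl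
            act := ℰ.translate hh hm htriv
            act_eq := fun _ _ => rfl
            proj_act := fun _ => rfl
            mul_act := fun g g' ξ hgg' hξ => ℰ.translate_mul hh hm htriv g g' ξ hgg' hξ
            inv_act := fun g ξ hξ => ℰ.translate_inv hh hm htriv g ξ hξ
            continuous_act := ?_ }, fun g f k hfk => ?_⟩
  · refine ℰ.continuous_translate hh hm htriv (fun u => ?_) P.continuous_proj
    obtain ⟨φ, hφ⟩ := hloc u
    exact ⟨φ.toL2Chart h hZ hp m hμ, unitaryPrebundleChart _ hloc _ hT φ, hφ, rfl, fun b hb => rfl⟩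
  · exact (ℰ.unitary_toL2_eq_iff hh hm htriv g rfl rfl f k).1 hfk
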